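/- Fix $n\ge 1$ and let $\mathcal S=\mathcal S(\mathbb R^n)$ be the Schwartz space of complex-valued functions and $\mathcal S'$ the space of tempered distributions with its strong topology. All spaces $\mathcal L_b(E,F)$ of continuous linear maps carry the topology of uniform convergence on bounded sets, nets are indexed by $\varepsilon\in(0,1]$, and asymptotics are for $\varepsilon\to0$. A map between locally convex spaces is called smooth if it maps smooth curves to smooth curves; $dR$ is its differential, $dR(\Phi)(\Psi)=\lim_{t\to0}\,(R(\Phi+t\Psi)-R(\Phi))/t$ with $t$ real, and $d^lR$ its $l$-th iterated differential. Let $S$ be the set of all nets $(\Phi_\varepsilon)$ in $\mathcal L_b(\mathcal S',\mathcal S)$ such that $\Phi_\varepsilon\to\mathrm{id}$ in $\mathcal L_b(\mathcal S',\mathcal S')$; $p(\Phi_\varepsilon|_{\mathcal S}-\mathrm{id})=O(\varepsilon^m)$ for all $m$ and all continuous seminorms $p$ of $\mathcal L_b(\mathcal S,\mathcal S)$; and for every continuous seminorm $p$ of $\mathcal L_b(\mathcal S',\mathcal S)$ there is $N$ with $p(\Phi_\varepsilon)=O(\varepsilon^{-N})$. Let $S^0$ be the set defined in the same way with both identities replaced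 by $0$. A smooth map $R\colon\mathcal L_b(\mathcal S',\mathcal S)\to\mathcal S$ is moderate if for every continuous seminorm $p$ of $\mathcal S$, every $l\ge0$, every $(\Phi_\varepsilon)\in S$ and all $(\Psi_{1,\varepsilon}),\dots,(\Psi_{l,\varepsilon})\in S^0$ there is $N$ with $p\big(d^lR(\Phi_\varepsilon)(\Psi_{1,\varepsilon},\dots,\Psi_{l,\varepsilon})\big)=O(\varepsilon^{-N})$, and negligible if this quantity is $O(\varepsilon^m)$ for every $m$. Let $\mathcal G_\tau$ be the complex vector space of moderate maps modulo negligible maps. Let $\mathcal Ff(\xi)=\int f(x)e^{-2\pi i x\cdot\xi}\,dx$ on $\mathcal S$, extended to $\mathcal S'$ by duality. Put $$(\mathcal FR)(\Phi)=\mathcal F\big(R(\mathcal F^{-1}\circ\Phi\circ\mathcal F)\big),\qquad (\mathcal F^{-1}R)(\Phi)=\mathcal F^{-1}\big(R(\mathcal F\circ\Phi\circ\mathcal F^{-1})\big),$$ $(\iota u)(\Phi)=\Phi(u)$ for $u\in\mathcal S'$ and $(\sigma f)(\Phi)=f$ for $f\in\mathcal S$. Operators on $\mathcal S$, the pointwise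 product and the convolution are extended componentwise: $(TR)(\Phi)=T(R(\Phi))$, $(R\cdot Q)(\Phi)=R(\Phi)\,Q(\Phi)$, $(R*Q)(\Phi)=R(\Phi)*Q(\Phi)$. For $a\in\mathbb R^n$ let $\tau_af(x)=f(x-a)$ and $\chi_af(x)=e^{2\pi i a\cdot x}f(x)$; for $f\in\{\tau_a,\chi_a\}$ put also $(\hat fR)(\Phi)=f(R(f^{-1}\circ\Phi\circ f))$. For $c\in\mathbb C$ and $\alpha\in\mathbb N_0^n$ let $(cM)^\alpha$ be multiplication by $\prod_j(cx_j)^{\alpha_j}$, and let $D^\alpha=\partial^\alpha$. For $T=D^\alpha$ or $T=(cM)^\alpha$ put $$(\hat TR)(\Phi)=T(R(\Phi))-dR(\Phi)(T\circ\Phi-\Phi\circ T).$$ Finally let $\widehat D^\alpha=\prod_j(\widehat{\partial_j})^{\alpha_j}$ and $(\widehat{cM})^\alpha=\prod_j(\widehat{cM_j})^{\alpha_j}$, where $M_j$ is multiplication by $x_j$. Then $\iota u$ and $\sigma f$ are moderate, all the above operations are well defined on $\mathcal G_\tau$, and the following hold for all $R,u,v\in\mathcal G_\tau$ (equalities in $\mathcal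 G_\tau$). (i) $\mathcal F\colon\mathcal G_\tau\to\mathcal G_\tau$ is a linear isomorphism with inverse $\mathcal F^{-1}$. (ii) $\mathcal F(\iota w)=\iota(\mathcal Fw)$ and $\mathcal F^{-1}(\iota w)=\iota(\mathcal F^{-1}w)$ for $w\in\mathcal S'$; $\mathcal F(\sigma f)=\sigma(\mathcal Ff)$ and $\mathcal F^{-1}(\sigma f)=\sigma(\mathcal F^{-1}f)$ for $f\in\mathcal S$. (iii) $\mathcal F(\tau_aR)=\chi_{-a}\mathcal F(R)$ and $\mathcal F(\chi_aR)=\tau_a\mathcal F(R)$ for all $a\in\mathbb R^n$; likewise $\mathcal F(\hat\tau_aR)=\hat\chi_{-a}\mathcal F(R)$ and $\mathcal F(\hat\chi_aR)=\hat\tau_a\mathcal F(R)$. (iv) $D^\alpha\mathcal F(R)=\mathcal F((-2\pi iM)^\alpha R)$ and $(2\pi iM)^\alpha\mathcal F(R)=\mathcal F(D^\alpha R)$ for all $\alpha\in\mathbb N_0^n$; likewise $\widehat D^\alpha\mathcal F(R)=\mathcal F((\widehat{-2\pi iM})^\alpha R)$ and $(\widehat{2\pi iM})^\alpha\mathcal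 F(R)=\mathcal F(\widehat D^\alpha R)$, and the same two identities hold with $\widehat{T}$ for the operators $T=D^\alpha$ and $T=(\mp2\pi iM)^\alpha$ themselves. (v) $\mathcal F^{-1}(u\cdot v)=\mathcal F^{-1}(u)*\mathcal F^{-1}(v)$ and $\mathcal F(u*v)=\mathcal F(u)\cdot\mathcal F(v)$. -/

import Mathlib

open Filter Topology Asymptotics SchwartzMap FourierTransform LineDeriv MeasureTheory

noncomputable section

namespace Colombeau

/-! ### Smooth maps between locally convex spaces (convenient calculus) -/

section Calculus

variable {X Y : Type*} [AddCommGroup X] [Module ℝ X] [TopologicalSpace X]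
  [AddCommGroup Y] [Module ℝ Y] [TopologicalSpace Y]

/-- The curve `c` has derivative `v` at time `t`: its difference quotients converge to `v`. -/
def HasCurveDerivAt (c : ℝ → X) (v : X) (t : ℝ) : Prop :=
  Tendsto (fun h : ℝ => h⁻¹ • (c (t + h) - c t)) (𝓝[≠] 0) (𝓝 v)

/-- A curve all of whose iterated derivatives exist. -/
def IsSmoothCurve (c : ℝ → X) : Prop :=
  ∃ d : ℕ → ℝ → X, d 0 = c ∧ ∀ k t, HasCurveDerivAt (d k) (d (k + 1) t) t

/-- Smoothness in the sense of Frölicher and Kriegl-Michor: smooth curves are mapped to smooth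
curves. -/
def IsSmoothMap (f : X → Y) : Prop :=
  ∀ c : ℝ → X, IsSmoothCurve c → IsSmoothCurve (fun t => f (c t))

/-- The differential `df(x)(v) = lim_{h → 0} (f(x + h v) - f(x)) / h`. -/
def differential (f : X → Y) (x v : X) : Y :=
  @limUnder _ _ _ ⟨0⟩ (𝓝[≠] (0 : ℝ)) (fun h : ℝ => h⁻¹ • (f (x + h • v) - f x))

/-- `HasIteratedDifferential l f x v y` says that the `l`-th differential of `f` at `x`, evaluated
on the directions `v 0, …, v (l - 1)`, exists and equals `y`. It is obtained by differentiating
`t ↦ d^{l-1} f (x + t v₀)(v₁, …, v_{l-1})` at `t = 0`. For a smooth `f` it always exists. -/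
def HasIteratedDifferential : (l : ℕ) → (X → Y) → X → (Fin l → X) → Y → Prop
  | 0, f, x, _, y => f x = y
  | l + 1, f, x, v, y => ∃ g : ℝ → Y,
      (∀ t : ℝ, HasIteratedDifferential l f (x + t • v 0) (Fin.tail v) (g t)) ∧
        HasCurveDerivAt g y 0

set_option linter.unusedSectionVars false

variable [IsTopologicalAddGroup Y]

theorem HasCurveDerivAt.add {c d : ℝ → Y} {v w : Y} {t : ℝ} (hc : HasCurveDerivAt c v t)
    (hd : HasCurveDerivAt d w t) : HasCurveDerivAt (fun s => c s + d s) (v + w) t := by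
  unfold HasCurveDerivAt at *
  refine (hc.add hd).congr fun h => ?_
  rw [← smul_add, sub_add_sub_comm]

theorem HasCurveDerivAt.const_smul [Module ℂ Y] [ContinuousConstSMul ℂ Y] [SMulCommClass ℝ ℂ Y]
    {c : ℝ → Y} {v : Y} {t : ℝ} (a : ℂ) (hc : HasCurveDerivAt c v t) :
    HasCurveDerivAt (fun s => a • c s) (a • v) t := by
  unfold HasCurveDerivAt at *
  refine (Tendsto.const_smul hc a).congr fun h => ?_
  rw [← smul_sub, smul_comm (h⁻¹) a]

theorem hasCurveDerivAt_zero (t : ℝ) : HasCurveDerivAt (fun _ => (0 : Y)) 0 t := by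
  unfold HasCurveDerivAt
  simp [tendsto_const_nhds]

theorem IsSmoothMap.add {f g : X → Y} (hf : IsSmoothMap f) (hg : IsSmoothMap g) :
    IsSmoothMap (f + g) := by
  intro c hc
  obtain ⟨d, hd, hd'⟩ := hf c hc
  obtain ⟨e, he, he'⟩ := hg c hc
  exact ⟨fun k t => d k t + e k t, by simp [hd, he], fun k t => (hd' k t).add (he' k t)⟩

theorem IsSmoothMap.const_smul [Module ℂ Y] [ContinuousConstSMul ℂ Y] [SMulCommClass ℝ ℂ Y]
    {f : X → Y} (a : ℂ) (hf : IsSmoothMap f) : IsSmoothMap (a • f) := by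
  intro c hc
  obtain ⟨d, hd, hd'⟩ := hf c hc
  exact ⟨fun k t => a • d k t, by simp [hd], fun k t => (hd' k t).const_smul a⟩

theorem isSmoothMap_zero : IsSmoothMap (0 : X → Y) :=
  fun _ _ => ⟨fun _ _ => 0, rfl, fun _ t => hasCurveDerivAt_zero t⟩

theorem HasIteratedDifferential.add : ∀ {l : ℕ} {f g : X → Y} {x : X} {v : Fin l → X} {y z : Y},
    HasIteratedDifferential l f x v y → HasIteratedDifferential l g x v z →
      HasIteratedDifferential l (f + g) x v (y + z)
  | 0, _, _, _, _, _, _, hf, hg => congrArg₂ (· + ·) hf hg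
  | _ + 1, _, _, _, _, _, _, ⟨a, ha, ha'⟩, ⟨b, hb, hb'⟩ =>
    ⟨fun t => a t + b t, fun t => (ha t).add (hb t), ha'.add hb'⟩

theorem HasIteratedDifferential.const_smul [Module ℂ Y] [ContinuousConstSMul ℂ Y]
    [SMulCommClass ℝ ℂ Y] (a : ℂ) : ∀ {l : ℕ} {f : X → Y} {x : X} {v : Fin l → X} {y : Y},
    HasIteratedDifferential l f x v y → HasIteratedDifferential l (a • f) x v (a • y)
  | 0, _, _, _, _, hf => congrArg (a • ·) hf
  | _ + 1, _, _, _, _, ⟨b, hb, hb'⟩ =>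
    ⟨fun t => a • b t, fun t => (hb t).const_smul a, hb'.const_smul a⟩

theorem hasIteratedDifferential_zero : ∀ {l : ℕ} {x : X} {v : Fin l → X},
    HasIteratedDifferential l (0 : X → Y) x v 0
  | 0, _, _ => rfl
  | _ + 1, _, _ => ⟨fun _ => 0, fun _ => hasIteratedDifferential_zero, hasCurveDerivAt_zero 0⟩

end Calculus

/-! ### The test pair `(𝒮', 𝒮)` -/

/-- `ℝⁿ` with its Euclidean structure. -/
abbrev Eucl (n : ℕ) := EuclideanSpace ℝ (Fin n)

/-- The Schwartz space `𝒮(ℝⁿ)`. -/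
abbrev Sch (n : ℕ) := 𝓢(Eucl n, ℂ)

/-- The space `𝒮'(ℝⁿ)` of tempered distributions with the strong dual topology (uniform
convergence on bounded subsets of `𝒮`). -/
abbrev TD (n : ℕ) := Sch n →L[ℂ] ℂ

/-- `ℒ(Δ) = ℒ_b(𝒮', 𝒮)` for `Δ = {(𝒮', 𝒮)}`, with the topology of uniform convergence on
bounded sets. -/
abbrev SmOp (n : ℕ) := TD n →L[ℂ] Sch n

/-- The continuous inclusion `𝒮 ⊆ 𝒮'`, `⟨f, g⟩ = ∫ f(x) g(x) dx`. -/
def incl (n : ℕ) : Sch n →L[ℂ] TD n where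
  toFun f := (integralCLM ℂ volume) ∘L (pairing (ContinuousLinearMap.mul ℂ ℂ) f)
  map_add' f g := by ext; simp
  map_smul' c f := by ext; simp
  cont := by
    have key : (fun f : Sch n =>
        (integralCLM ℂ (volume : Measure (Eucl n))) ∘L
          (pairing (ContinuousLinearMap.mul ℂ ℂ) f)) =
        fun f => ContinuousLinearMap.precomp ℂ
            (toLpCLM ℂ ℂ 2 (volume : Measure (Eucl n)))
          ((ContinuousLinearMap.mul ℂ ℂ).lpPairing (volume : Measure (Eucl n)) 2 2
            (toLpCLM ℂ ℂ 2 (volume : Measure (Eucl n)) f)) := by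
      ext f g
      simp only [ContinuousLinearMap.comp_apply, integralCLM_apply,
        ContinuousLinearMap.precomp_apply, ContinuousLinearMap.lpPairing_eq_integral]
      refine integral_congr_ae ?_
      filter_upwards [coeFn_toLp f 2 (volume : Measure (Eucl n)),
        coeFn_toLp g 2 (volume : Measure (Eucl n))] with x hf hg
      simp [toLpCLM_apply, hf, hg]
    exact key ▸ by fun_prop

theorem incl_apply (n : ℕ) (f g : Sch n) : incl n f g = ∫ x, f x * g x := by
  simp [incl]

/-! ### Test objects -/

/-- The parameter interval `(0, 1]`. -/
abbrev Par := Set.Ioc (0 : ℝ) 1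

/-- The filter `ε → 0` on `(0, 1]`. -/
def toZero : Filter Par := comap (fun ε : Par => (ε : ℝ)) (𝓝 0)

/-- `S(Δ)`: the set of test objects for `(𝒮', 𝒮)`. -/
def testObjects (n : ℕ) : Set (Par → SmOp n) :=
  {Φ | Tendsto (fun ε => incl n ∘L Φ ε) toZero (𝓝 (ContinuousLinearMap.id ℂ (TD n))) ∧
    (∀ (m : ℕ) (p : Seminorm ℂ (Sch n →L[ℂ] Sch n)), Continuous p →
      (fun ε => p (Φ ε ∘L incl n - ContinuousLinearMap.id ℂ (Sch n)))
        =O[toZero] fun ε => (ε : ℝ) ^ m) ∧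
    (∀ p : Seminorm ℂ (SmOp n), Continuous p →
      ∃ N : ℕ, (fun ε => p (Φ ε)) =O[toZero] fun ε => (ε : ℝ)⁻¹ ^ N)}

/-- `S⁰(Δ)`: the set of `0`-test objects for `(𝒮', 𝒮)`. -/
def zeroTestObjects (n : ℕ) : Set (Par → SmOp n) :=
  {Φ | Tendsto (fun ε => incl n ∘L Φ ε) toZero (𝓝 0) ∧
    (∀ (m : ℕ) (p : Seminorm ℂ (Sch n →L[ℂ] Sch n)), Continuous p →
      (fun ε => p (Φ ε ∘L incl n)) =O[toZero] fun ε => (ε : ℝ) ^ m) ∧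
    (∀ p : Seminorm ℂ (SmOp n), Continuous p →
      ∃ N : ℕ, (fun ε => p (Φ ε)) =O[toZero] fun ε => (ε : ℝ)⁻¹ ^ N)}

/-! ### The quotient construction -/

/-- `p((d^l R)(Φ_ε)(Ψ_{1,ε}, …, Ψ_{l,ε})) = O(r_ε)` as `ε → 0`. -/
def DifferentialIsBigO {n : ℕ} (R : SmOp n → Sch n) (p : Seminorm ℂ (Sch n)) (l : ℕ)
    (Φ : Par → SmOp n) (Ψ : Fin l → Par → SmOp n) (r : Par → ℝ) : Prop :=
  ∃ y : Par → Sch n,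
    (∀ ε, HasIteratedDifferential l R (Φ ε) (fun i => Ψ i ε) (y ε)) ∧
      (fun ε => p (y ε)) =O[toZero] r

theorem DifferentialIsBigO.add {n : ℕ} {R R' : SmOp n → Sch n} {p : Seminorm ℂ (Sch n)} {l : ℕ}
    {Φ : Par → SmOp n} {Ψ : Fin l → Par → SmOp n} {r : Par → ℝ}
    (h : DifferentialIsBigO R p l Φ Ψ r) (h' : DifferentialIsBigO R' p l Φ Ψ r) :
    DifferentialIsBigO (R + R') p l Φ Ψ r := by
  obtain ⟨y, hy, hyr⟩ := h
  obtain ⟨z, hz, hzr⟩ := h'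
  refine ⟨fun ε => y ε + z ε, fun ε => (hy ε).add (hz ε), ?_⟩
  refine (IsBigO.of_norm_le fun ε => ?_).trans (hyr.norm_left.add hzr.norm_left)
  simpa [abs_of_nonneg (apply_nonneg p _)] using map_add_le_add p (y ε) (z ε)

theorem DifferentialIsBigO.const_smul {n : ℕ} {R : SmOp n → Sch n} {p : Seminorm ℂ (Sch n)}
    {l : ℕ} {Φ : Par → SmOp n} {Ψ : Fin l → Par → SmOp n} {r : Par → ℝ} (a : ℂ)
    (h : DifferentialIsBigO R p l Φ Ψ r) : DifferentialIsBigO (a • R) p l Φ Ψ r := by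
  obtain ⟨y, hy, hyr⟩ := h
  refine ⟨fun ε => a • y ε, fun ε => (hy ε).const_smul a, ?_⟩
  simpa only [map_smul_eq_mul] using hyr.const_mul_left ‖a‖

theorem differentialIsBigO_zero {n : ℕ} {p : Seminorm ℂ (Sch n)} {l : ℕ}
    {Φ : Par → SmOp n} {Ψ : Fin l → Par → SmOp n} {r : Par → ℝ} :
    DifferentialIsBigO (0 : SmOp n → Sch n) p l Φ Ψ r :=
  ⟨fun _ => 0, fun _ => hasIteratedDifferential_zero, by simpa using isBigO_zero _ _⟩

theorem DifferentialIsBigO.mono_pow {n : ℕ} {R : SmOp n → Sch n} {p : Seminorm ℂ (Sch n)}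
    {l : ℕ} {Φ : Par → SmOp n} {Ψ : Fin l → Par → SmOp n} {M N : ℕ} (hMN : M ≤ N)
    (h : DifferentialIsBigO R p l Φ Ψ fun ε => (ε : ℝ)⁻¹ ^ M) :
    DifferentialIsBigO R p l Φ Ψ fun ε => (ε : ℝ)⁻¹ ^ N := by
  obtain ⟨y, hy, hyr⟩ := h
  refine ⟨y, hy, hyr.trans (IsBigO.of_norm_le fun ε => ?_)⟩
  have h1 : (1 : ℝ) ≤ (ε : ℝ)⁻¹ := (one_le_inv₀ ε.2.1).2 ε.2.2
  rw [Real.norm_of_nonneg (by positivity)]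
  exact pow_le_pow_right₀ h1 hMN

/-- `ℰ_M`: the space of moderate elements of the basic space `C^∞(ℒ_b(𝒮', 𝒮), 𝒮)`. The exponent
`N` may depend on the test objects, as it does for the test objects themselves. -/
def moderate (n : ℕ) : Submodule ℂ (SmOp n → Sch n) where
  carrier := {R | IsSmoothMap R ∧
    ∀ p : Seminorm ℂ (Sch n), Continuous p → ∀ l : ℕ,
      ∀ Φ ∈ testObjects n, ∀ Ψ : Fin l → Par → SmOp n, (∀ i, Ψ i ∈ zeroTestObjects n) →
        ∃ N : ℕ, DifferentialIsBigO R p l Φ Ψ fun ε => (ε : ℝ)⁻¹ ^ N}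
  add_mem' := by
    rintro R R' ⟨hR, h⟩ ⟨hR', h'⟩
    refine ⟨hR.add hR', fun p hp l Φ hΦ Ψ hΨ => ?_⟩
    obtain ⟨N, hN⟩ := h p hp l Φ hΦ Ψ hΨ
    obtain ⟨N', hN'⟩ := h' p hp l Φ hΦ Ψ hΨ
    exact ⟨max N N', (hN.mono_pow (le_max_left _ _)).add (hN'.mono_pow (le_max_right _ _))⟩
  zero_mem' := ⟨isSmoothMap_zero, fun _ _ _ _ _ _ _ => ⟨0, differentialIsBigO_zero⟩⟩
  smul_mem' := by
    rintro a R ⟨hR, h⟩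
    refine ⟨hR.const_smul a, fun p hp l Φ hΦ Ψ hΨ => ?_⟩
    obtain ⟨N, hN⟩ := h p hp l Φ hΦ Ψ hΨ
    exact ⟨N, hN.const_smul a⟩

/-- `𝒩`: the space of negligible elements of the basic space `C^∞(ℒ_b(𝒮', 𝒮), 𝒮)`. -/
def negligible (n : ℕ) : Submodule ℂ (SmOp n → Sch n) where
  carrier := {R | IsSmoothMap R ∧
    ∀ p : Seminorm ℂ (Sch n), Continuous p → ∀ l m : ℕ,
      ∀ Φ ∈ testObjects n, ∀ Ψ : Fin l → Par → SmOp n, (∀ i, Ψ i ∈ zeroTestObjects n) →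
        DifferentialIsBigO R p l Φ Ψ fun ε => (ε : ℝ) ^ m}
  add_mem' := by
    rintro R R' ⟨hR, h⟩ ⟨hR', h'⟩
    exact ⟨hR.add hR', fun p hp l m Φ hΦ Ψ hΨ =>
      (h p hp l m Φ hΦ Ψ hΨ).add (h' p hp l m Φ hΦ Ψ hΨ)⟩
  zero_mem' := ⟨isSmoothMap_zero, fun _ _ _ _ _ _ _ _ => differentialIsBigO_zero⟩
  smul_mem' := by
    rintro a R ⟨hR, h⟩
    exact ⟨hR.const_smul a, fun p hp l m Φ hΦ Ψ hΨ => (h p hp l m Φ hΦ Ψ hΨ).const_smul a⟩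

/-- The space `𝒢_τ = ℰ_M / 𝒩` of tempered generalized functions on `ℝⁿ`. -/
abbrev Gtau (n : ℕ) := moderate n ⧸ (negligible n).submoduleOf (moderate n)

open scoped Classical in
/-- The class in `𝒢_τ` of a moderate `R` (and `0` if `R` is not moderate). -/
def cls {n : ℕ} (R : SmOp n → Sch n) : Gtau n :=
  if h : R ∈ moderate n then Submodule.Quotient.mk ⟨R, h⟩ else 0

/-- Some moderate representative of a generalized function. -/
def rep {n : ℕ} (U : Gtau n) : SmOp n → Sch n :=
  (Function.surjInv (Submodule.mkQ_surjective ((negligible n).submoduleOf (moderate n))) U :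
    moderate n)

/-- The operation on classes given by an operation on representatives. -/
def descend {n : ℕ} (t : (SmOp n → Sch n) → (SmOp n → Sch n)) (U : Gtau n) : Gtau n :=
  cls (t (rep U))

/-- The binary operation on classes given by a binary operation on representatives. -/
def descend₂ {n : ℕ} (t : (SmOp n → Sch n) → (SmOp n → Sch n) → (SmOp n → Sch n))
    (U V : Gtau n) : Gtau n :=
  cls (t (rep U) (rep V))

/-- `t` is well defined on `𝒢_τ`: it preserves moderateness, and on the class of any moderate
`R` the operation on classes is given by the class of `t R`. -/
def WellDefined {n : ℕ} (t : (SmOp n → Sch n) → (SmOp n → Sch n)) : Prop :=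
  ∀ R ∈ moderate n, t R ∈ moderate n ∧ descend t (cls R) = cls (t R)

/-- The version of `WellDefined` for binary operations. -/
def WellDefined₂ {n : ℕ} (t : (SmOp n → Sch n) → (SmOp n → Sch n) → (SmOp n → Sch n)) : Prop :=
  ∀ R ∈ moderate n, ∀ Q ∈ moderate n,
    t R Q ∈ moderate n ∧ descend₂ t (cls R) (cls Q) = cls (t R Q)

/-! ### Classical operators on `𝒮` and `𝒮'` -/

/-- The Fourier transform `(ℱ f)(ξ) = ∫ f(x) e^{-2π i x ξ} dx` on `𝒮`. -/
def four (n : ℕ) : Sch n →L[ℂ] Sch n := fourierCLM ℂ (Sch n)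

/-- The inverse Fourier transform on `𝒮`. -/
def fourInv (n : ℕ) : Sch n →L[ℂ] Sch n := fourierInvCLM ℂ (Sch n)

/-- Translation `(τ_a f)(x) = f(x - a)` on `𝒮`. -/
def translate {n : ℕ} (a : Eucl n) : Sch n →L[ℂ] Sch n := compSubConstCLM ℂ a

/-- The function `χ_a(x) = exp(2π i a · x)`. -/
def chiFun {n : ℕ} (a x : Eucl n) : ℂ :=
  Complex.exp (2 * Real.pi * Complex.I * (inner ℝ a x : ℝ))

/-- Multiplication by `χ_a` on `𝒮`. -/
def chi {n : ℕ} (a : Eucl n) : Sch n →L[ℂ] Sch n := smulLeftCLM ℂ (chiFun a)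

theorem chiFun_hasTemperateGrowth {n : ℕ} (a : Eucl n) : (chiFun a).HasTemperateGrowth := by
  have he : Function.HasTemperateGrowth
      fun t : ℝ => Complex.exp (2 * Real.pi * Complex.I * t) := by
    have hd : ∀ k : ℕ, iteratedDeriv k (fun t : ℝ => Complex.exp (2 * Real.pi * Complex.I * t)) =
        fun t : ℝ => (2 * Real.pi * Complex.I) ^ k * Complex.exp (2 * Real.pi * Complex.I * t) := by
      intro k
      induction k with
      | zero => simp
      | succ k ih =>
        ext t
        rw [iteratedDeriv_succ, ih]
        have h1 : HasDerivAt (fun t : ℝ => 2 * Real.pi * Complex.I * (t : ℂ))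
            (2 * Real.pi * Complex.I * 1) t := (Complex.ofRealCLM.hasDerivAt).const_mul _
        rw [(h1.cexp.const_mul _).deriv]
        ring
    refine ⟨(contDiff_const.mul Complex.ofRealCLM.contDiff).cexp,
      fun k => ⟨0, (2 * Real.pi) ^ k, fun t => ?_⟩⟩
    rw [norm_iteratedFDeriv_eq_norm_iteratedDeriv, hd]
    simp [Complex.norm_exp, abs_of_pos Real.pi_pos]
  exact he.comp (Function.hasTemperateGrowth_inner_right a)

theorem chi_apply {n : ℕ} (a : Eucl n) (f : Sch n) (x : Eucl n) :
    chi a f x = chiFun a x * f x := by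
  simp [chi, smulLeftCLM_apply_apply (chiFun_hasTemperateGrowth a)]

/-- The partial derivative `D^α` on `𝒮`, for a multi-index `α`. -/
def pderiv {n : ℕ} (α : Fin n → ℕ) : Sch n →L[ℂ] Sch n :=
  ((List.finRange n).map fun j =>
    (lineDerivOpCLM ℂ (Sch n) (EuclideanSpace.single j (1 : ℝ) : Eucl n)) ^ α j).prod

/-- The function `(c x)^α = ∏ⱼ (c xⱼ)^{αⱼ}`. -/
def monomialFun {n : ℕ} (c : ℂ) (α : Fin n → ℕ) (x : Eucl n) : ℂ :=
  ∏ j, (c * (x j : ℂ)) ^ α j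

/-- `(c M)^α` on `𝒮`: multiplication by the function `x ↦ (c x)^α`. -/
def mulMon {n : ℕ} (c : ℂ) (α : Fin n → ℕ) : Sch n →L[ℂ] Sch n := smulLeftCLM ℂ (monomialFun c α)

theorem monomialFun_hasTemperateGrowth {n : ℕ} (c : ℂ) (α : Fin n → ℕ) :
    (monomialFun (n := n) c α).HasTemperateGrowth := by
  have h : ∀ j : Fin n, Function.HasTemperateGrowth fun x : Eucl n => (c * (x j : ℂ)) ^ α j := by
    intro j
    have h1 : Function.HasTemperateGrowth fun x : Eucl n => (x j : ℂ) :=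
      (Complex.ofRealCLM.comp (EuclideanSpace.proj j : Eucl n →L[ℝ] ℝ)).hasTemperateGrowth
    exact ((Function.HasTemperateGrowth.const c).mul h1).pow _
  have h2 : monomialFun (n := n) c α = ∏ j, fun x : Eucl n => (c * (x j : ℂ)) ^ α j := by
    ext x
    simp [monomialFun]
  rw [h2]
  exact Finset.prod_induction _ (fun f => Function.HasTemperateGrowth f)
    (fun f g hf hg => hf.mul hg) (Function.HasTemperateGrowth.const 1) fun j _ => h j

theorem mulMon_apply {n : ℕ} (c : ℂ) (α : Fin n → ℕ) (f : Sch n) (x : Eucl n) :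
    mulMon c α f x = monomialFun c α x * f x := by
  simp [mulMon, smulLeftCLM_apply_apply (monomialFun_hasTemperateGrowth c α)]

/-- The transpose `u ↦ u ∘ T` on `𝒮'` of an operator `T` on `𝒮`. -/
def transpose {n : ℕ} (T : Sch n →L[ℂ] Sch n) : TD n →L[ℂ] TD n := ContinuousLinearMap.precomp ℂ T

/-- The Fourier transform on `𝒮'`. -/
def fourTD (n : ℕ) : TD n →L[ℂ] TD n := transpose (four n)

/-- The inverse Fourier transform on `𝒮'`. -/
def fourInvTD (n : ℕ) : TD n →L[ℂ] TD n := transpose (fourInv n)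

/-- Translation `τ_a` on `𝒮'`. -/
def transTD {n : ℕ} (a : Eucl n) : TD n →L[ℂ] TD n := transpose (translate (-a))

/-- Multiplication by `χ_a` on `𝒮'`. -/
def chiTD {n : ℕ} (a : Eucl n) : TD n →L[ℂ] TD n := transpose (chi a)

/-- The distributional derivative `D^α` on `𝒮'`. -/
def pderivTD {n : ℕ} (α : Fin n → ℕ) : TD n →L[ℂ] TD n :=
  ((-1 : ℂ) ^ ∑ j, α j) • transpose (pderiv α)

/-- `(c M)^α` on `𝒮'`. -/
def mulMonTD {n : ℕ} (c : ℂ) (α : Fin n → ℕ) : TD n →L[ℂ] TD n := transpose (mulMon c α)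

/-! ### Operations on representatives -/

section Representatives

variable {n : ℕ}

/-- `(ι u)(Φ) = Φ(u)`. -/
def iotaRep (u : TD n) : SmOp n → Sch n := fun Φ => Φ u

/-- `(σ f)(Φ) = f`. -/
def sigmaRep (f : Sch n) : SmOp n → Sch n := fun _ => f

/-- Componentwise extension of an operator: `(T R)(Φ) = T (R(Φ))`. -/
def compRep (T : Sch n →L[ℂ] Sch n) (R : SmOp n → Sch n) : SmOp n → Sch n := fun Φ => T (R Φ)

/-- Extension of an isomorphism `f` of `𝒮'` that restricts to an isomorphism of `𝒮`:
`(f R)(Φ) = f (R (f⁻¹ ∘ Φ ∘ f))`. The arguments are `f` on `𝒮`, `f⁻¹` on `𝒮` and `f` on `𝒮'`. -/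
def conjRep (f fInv : Sch n →L[ℂ] Sch n) (fTD : TD n →L[ℂ] TD n) (R : SmOp n → Sch n) :
    SmOp n → Sch n :=
  fun Φ => f (R (fInv ∘L Φ ∘L fTD))

/-- Geometric (infinitesimal) extension of an operator `T` of `𝒮'` that restricts to `𝒮`:
`(T̂ R)(Φ) = T (R(Φ)) - dR(Φ)(T ∘ Φ - Φ ∘ T)`. The arguments are `T` on `𝒮` and `T` on `𝒮'`. -/
def hatRep (T : Sch n →L[ℂ] Sch n) (TTD : TD n →L[ℂ] TD n) (R : SmOp n → Sch n) :
    SmOp n → Sch n :=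
  fun Φ => T (R Φ) - differential R Φ (T ∘L Φ - Φ ∘L TTD)

/-- The componentwise pointwise product. -/
def mulRep (R Q : SmOp n → Sch n) : SmOp n → Sch n :=
  fun Φ => pairing (ContinuousLinearMap.mul ℂ ℂ) (R Φ) (Q Φ)

/-- The componentwise convolution. -/
def convRep (R Q : SmOp n → Sch n) : SmOp n → Sch n :=
  fun Φ => SchwartzMap.convolution (ContinuousLinearMap.mul ℂ ℂ) (R Φ) (Q Φ)

theorem convRep_apply (R Q : SmOp n → Sch n) (Φ : SmOp n) (x : Eucl n) :
    convRep R Q Φ x = ∫ y, R Φ y * Q Φ (x - y) :=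
  SchwartzMap.convolution_apply _ _ _ _

/-- The Fourier transform `(ℱ R)(Φ) = ℱ (R (ℱ⁻¹ ∘ Φ ∘ ℱ))`. -/
def fourRep : (SmOp n → Sch n) → (SmOp n → Sch n) := conjRep (four n) (fourInv n) (fourTD n)

/-- The inverse Fourier transform `(ℱ⁻¹ R)(Φ) = ℱ⁻¹ (R (ℱ ∘ Φ ∘ ℱ⁻¹))`. -/
def fourInvRep : (SmOp n → Sch n) → (SmOp n → Sch n) := conjRep (fourInv n) (four n) (fourInvTD n)

/-- The geometric translation `τ̂_a`. -/
def hatTransRep (a : Eucl n) : (SmOp n → Sch n) → (SmOp n → Sch n) :=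
  conjRep (translate a) (translate (-a)) (transTD a)

/-- The geometric modulation `χ̂_a`. -/
def hatChiRep (a : Eucl n) : (SmOp n → Sch n) → (SmOp n → Sch n) :=
  conjRep (chi a) (chi (-a)) (chiTD a)

/-- The geometric extension of the operator `D^α`. -/
def hatPderivRep (α : Fin n → ℕ) : (SmOp n → Sch n) → (SmOp n → Sch n) :=
  hatRep (pderiv α) (pderivTD α)

/-- The geometric extension of the operator `(c M)^α`. -/
def hatMulMonRep (c : ℂ) (α : Fin n → ℕ) : (SmOp n → Sch n) → (SmOp n → Sch n) :=
  hatRep (mulMon c α) (mulMonTD c α)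

end Representatives

/-! ### Operations on `𝒢_τ` -/

section Operations

variable {n : ℕ}

/-- The embedding `ι` of `𝒮'` into `𝒢_τ`. -/
def iota (u : TD n) : Gtau n := cls (iotaRep u)

/-- The embedding `σ` of `𝒮` into `𝒢_τ`. -/
def sigma (f : Sch n) : Gtau n := cls (sigmaRep f)

/-- The Fourier transform on `𝒢_τ`. -/
def fourG : Gtau n → Gtau n := descend fourRep

/-- The inverse Fourier transform on `𝒢_τ`. -/
def fourInvG : Gtau n → Gtau n := descend fourInvRep

/-- Componentwise translation on `𝒢_τ`. -/
def transG (a : Eucl n) : Gtau n → Gtau n := descend (compRep (translate a))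

/-- Componentwise multiplication by `χ_a` on `𝒢_τ`. -/
def chiG (a : Eucl n) : Gtau n → Gtau n := descend (compRep (chi a))

/-- Geometric translation on `𝒢_τ`. -/
def hatTransG (a : Eucl n) : Gtau n → Gtau n := descend (hatTransRep a)

/-- Geometric modulation on `𝒢_τ`. -/
def hatChiG (a : Eucl n) : Gtau n → Gtau n := descend (hatChiRep a)

/-- Componentwise `D^α` on `𝒢_τ`. -/
def pderivG (α : Fin n → ℕ) : Gtau n → Gtau n := descend (compRep (pderiv α))

/-- Componentwise multiplication by `(c x)^α` on `𝒢_τ`. -/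
def mulMonG (c : ℂ) (α : Fin n → ℕ) : Gtau n → Gtau n := descend (compRep (mulMon c α))

/-- The geometric extension of the operator `D^α`, on `𝒢_τ`. -/
def hatPderivG (α : Fin n → ℕ) : Gtau n → Gtau n := descend (hatPderivRep α)

/-- The geometric extension of the operator `(c M)^α`, on `𝒢_τ`. -/
def hatMulMonG (c : ℂ) (α : Fin n → ℕ) : Gtau n → Gtau n := descend (hatMulMonRep c α)

/-- `t₀^{α₀} ∘ ⋯ ∘ t_{n-1}^{α_{n-1}}` (iterates). -/
def multiPow (t : Fin n → Gtau n → Gtau n) (α : Fin n → ℕ) : Gtau n → Gtau n :=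
  ((List.finRange n).map fun j => (t j)^[α j]).foldr (fun f g => f ∘ g) id

/-- `D̂^α = D̂₁^{α₁} ⋯ D̂ₙ^{αₙ}`, with `D̂ⱼ` the geometric extension of `∂ⱼ`. -/
def hatPderivPowG (α : Fin n → ℕ) : Gtau n → Gtau n :=
  multiPow (fun j => hatPderivG (Pi.single j 1)) α

/-- The product over `j` of the `αⱼ`-th iterates of the geometric extensions of multiplication
by `c xⱼ`. -/
def hatMulMonPowG (c : ℂ) (α : Fin n → ℕ) : Gtau n → Gtau n :=
  multiPow (fun j => hatMulMonG c (Pi.single j 1)) α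

/-- The product of `𝒢_τ`. -/
def mulG : Gtau n → Gtau n → Gtau n := descend₂ mulRep

/-- The convolution of `𝒢_τ`. -/
def convG : Gtau n → Gtau n → Gtau n := descend₂ convRep

end Operations

end Colombeau

end

/-! The identities (i)–(v) hold exactly for representatives, before passing to the quotient. If `f ∘
T = T' ∘ f` on `𝒮` and the corresponding relation holds on `𝒮'`, then the conjugation `R ↦ f (R (f⁻¹
∘ Φ ∘ f))` carries every extension of `T` to the same extension of `T'`. With `f = ℱ` this turns the
classical exchange formulas into the asserted ones (`conjRep_compRep`, `conjRep_conjRep`,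
`conjRep_hatRep`). The convolution is reduced to the product by `f * g = ℱ⁻¹(ℱf · ℱg)`.

The work lies in showing that the operations preserve moderate and negligible maps. For a
conjugation, the chain rule moves the linear map `Φ ↦ f⁻¹ ∘ Φ ∘ f` onto the test objects. It
preserves `S` and `S⁰` because `f` and `f⁻¹` commute with the inclusion `𝒮 ⊆ 𝒮'` and identities are
conjugated to identities. For `T̂`, the linear map `A Φ = T ∘ Φ - Φ ∘ T` kills identities, hence
sends `S` and `S⁰` into `S⁰`. The iterated differentials of `Φ ↦ dR(Φ)(A Φ)` are sums of iterated
differentials of `R` in directions from `S⁰` (`iterDiff_differential_self`). Products are handled by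
the Leibniz rule and seminorm estimates.

These differentiation rules require `dR` to be smooth in both variables and real linear in the
direction, although smoothness is only defined through curves. Both facts follow from Boman's
theorem on finite-dimensional families (`AlongCurves.contDiff`), applied after composing with
continuous linear maps from `𝒮` to Banach spaces. Completeness of `𝒮` (`completeSpace_schwartz`)
then brings smoothness of curves back to `𝒮`. In Boman's theorem, the special curve lemma bounds all
derivatives along lines locally. For a compactly supported map this makes the Fourier transform
decay rapidly, and Fourier inversion gives smoothness. -/

noncomputable section

namespace Colombeau

/-! ### Curves in topological vector spaces -/

section Curves

variable {X Y : Type*} [AddCommGroup X] [Module ℝ X] [TopologicalSpace X]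
  [AddCommGroup Y] [Module ℝ Y] [TopologicalSpace Y]

theorem HasCurveDerivAt.unique [T2Space X] {c : ℝ → X} {v w : X} {t : ℝ}
    (h : HasCurveDerivAt c v t) (h' : HasCurveDerivAt c w t) : v = w :=
  tendsto_nhds_unique h h'

theorem HasCurveDerivAt.clm_comp {c : ℝ → X} {v : X} {t : ℝ} (L : X →L[ℝ] Y)
    (h : HasCurveDerivAt c v t) : HasCurveDerivAt (fun s => L (c s)) (L v) t := by
  unfold HasCurveDerivAt at *
  exact ((L.continuous.tendsto v).comp h).congr fun s => by simp

theorem hasCurveDerivAt_const (x : X) (t : ℝ) : HasCurveDerivAt (fun _ => x) 0 t := by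
  unfold HasCurveDerivAt
  simp [tendsto_const_nhds]

/-- Coinduction principle for smooth curves. -/
theorem IsSmoothCurve.coinduction (P : (ℝ → X) → Prop)
    (h : ∀ c, P c → ∃ c', P c' ∧ ∀ t, HasCurveDerivAt c (c' t) t) {c : ℝ → X} (hc : P c) :
    IsSmoothCurve c := by
  choose! D hD hD' using h
  refine ⟨fun k => D^[k] c, rfl, fun k t => ?_⟩
  have hk : P (D^[k] c) := by
    induction k with
    | zero => exact hc
    | succ k ih => rw [Function.iterate_succ_apply']; exact hD _ ih
  simp only [Function.iterate_succ_apply']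
  exact hD' _ hk t

theorem IsSmoothCurve.exists_deriv {c : ℝ → X} (hc : IsSmoothCurve c) :
    ∃ c', IsSmoothCurve c' ∧ ∀ t, HasCurveDerivAt c (c' t) t := by
  obtain ⟨d, rfl, hd⟩ := hc
  exact ⟨d 1, ⟨fun k => d (k + 1), rfl, fun k t => hd (k + 1) t⟩, fun t => hd 0 t⟩

theorem isSmoothCurve_const (x : X) : IsSmoothCurve (fun _ : ℝ => x) :=
  ⟨fun k _ => if k = 0 then x else 0, by simp, fun k t => by
    simpa using hasCurveDerivAt_const (if k = 0 then x else 0) t⟩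

theorem IsSmoothCurve.clm_comp {c : ℝ → X} (L : X →L[ℝ] Y) (hc : IsSmoothCurve c) :
    IsSmoothCurve (fun t => L (c t)) := by
  obtain ⟨d, rfl, hd⟩ := hc
  exact ⟨fun k t => L (d k t), rfl, fun k t => (hd k t).clm_comp L⟩

theorem IsSmoothCurve.add [IsTopologicalAddGroup X] {c d : ℝ → X} (hc : IsSmoothCurve c)
    (hd : IsSmoothCurve d) : IsSmoothCurve (fun t => c t + d t) := by
  obtain ⟨c, rfl, hc⟩ := hc
  obtain ⟨d, rfl, hd⟩ := hd
  exact ⟨fun k t => c k t + d k t, rfl, fun k t => (hc k t).add (hd k t)⟩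

theorem HasCurveDerivAt.prodMk {c : ℝ → X} {d : ℝ → Y} {v : X} {w : Y} {t : ℝ}
    (hc : HasCurveDerivAt c v t) (hd : HasCurveDerivAt d w t) :
    HasCurveDerivAt (fun s => (c s, d s)) (v, w) t :=
  (hc.prodMk_nhds hd).congr fun _ => rfl

theorem IsSmoothCurve.prodMk {c : ℝ → X} {d : ℝ → Y} (hc : IsSmoothCurve c)
    (hd : IsSmoothCurve d) : IsSmoothCurve (fun t => (c t, d t)) := by
  obtain ⟨c, rfl, hc⟩ := hc
  obtain ⟨d, rfl, hd⟩ := hd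
  exact ⟨fun k t => (c k t, d k t), rfl, fun k t => (hc k t).prodMk (hd k t)⟩

variable [IsTopologicalAddGroup X] [ContinuousSMul ℝ X]

theorem HasCurveDerivAt.tendsto {c : ℝ → X} {v : X} {t : ℝ} (h : HasCurveDerivAt c v t) :
    Tendsto (fun s => c (t + s)) (𝓝 0) (𝓝 (c t)) := by
  have h0 : Tendsto (fun s : ℝ => s) (𝓝[≠] 0) (𝓝 0) := nhdsWithin_le_nhds
  have h1 : Tendsto (fun s => c (t + s)) (𝓝[≠] 0) (𝓝 (c t)) := by
    have h2 := (h0.smul h).add (tendsto_const_nhds (x := c t))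
    rw [zero_smul, zero_add] at h2
    refine h2.congr' ?_
    filter_upwards [self_mem_nhdsWithin] with s hs
    have hs' : s ≠ 0 := hs
    rw [smul_smul, mul_inv_cancel₀ hs', one_smul, sub_add_cancel]
  rw [← pure_sup_nhdsNE, tendsto_sup]
  refine ⟨?_, h1⟩
  have : (fun s => c (t + s)) 0 = c t := by simp
  exact this ▸ tendsto_pure_nhds (fun s => c (t + s)) 0

/-- The chain rule for reparametrised curves. -/
theorem HasCurveDerivAt.comp_hasDerivAt {c : ℝ → X} {v : X} {t g' : ℝ} {g : ℝ → ℝ}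
    (hc : HasCurveDerivAt c v (g t)) (hg : HasDerivAt g g' t) :
    HasCurveDerivAt (fun s => c (g s)) (g' • v) t := by
  classical
  -- The difference quotient is completed by its limit at `0`, so that increments `h` with `g (t +
  -- h) = g t` need no separate limit.
  set q : ℝ → X := fun k => if k = 0 then v else k⁻¹ • (c (g t + k) - c (g t)) with hq
  have hq0 : Tendsto q (𝓝 0) (𝓝 v) := by
    rw [← pure_sup_nhdsNE, tendsto_sup]
    refine ⟨?_, hc.congr' ?_⟩
    · have : q 0 = v := by simp [hq]
      exact this ▸ tendsto_pure_nhds q 0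
    · filter_upwards [self_mem_nhdsWithin] with s hs
      exact (if_neg hs).symm
  have hd : Tendsto (fun h => g (t + h) - g t) (𝓝[≠] 0) (𝓝 0) := by
    have h1 : Tendsto (fun h => g (t + h)) (𝓝 0) (𝓝 (g t)) := by
      have := hg.continuousAt.tendsto.comp
        ((continuous_const_add t).tendsto' (0 : ℝ) t (by simp))
      exact this
    simpa using (h1.sub_const (g t)).mono_left nhdsWithin_le_nhds
  have h2 := (hasDerivAt_iff_tendsto_slope_zero.1 hg).smul (hq0.comp hd)
  refine h2.congr fun h => ?_
  by_cases h0 : g (t + h) - g t = 0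
  · have : g (t + h) = g t := sub_eq_zero.1 h0
    simp [this]
  · simp only [Function.comp_apply, hq, if_neg h0, smul_eq_mul]
    rw [smul_smul, mul_assoc, mul_inv_cancel₀ h0, mul_one, add_sub_cancel]

theorem HasCurveDerivAt.smul {c : ℝ → X} {v : X} {t g' : ℝ} {g : ℝ → ℝ}
    (hg : HasDerivAt g g' t) (hc : HasCurveDerivAt c v t) :
    HasCurveDerivAt (fun s => g s • c s) (g' • c t + g t • v) t := by
  have h1 : Tendsto (fun h => g (t + h)) (𝓝[≠] 0) (𝓝 (g t)) :=
    (hg.continuousAt.tendsto.comp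
      ((continuous_const_add t).tendsto' (0 : ℝ) t (by simp))).mono_left nhdsWithin_le_nhds
  have h2 := ((hasDerivAt_iff_tendsto_slope_zero.1 hg).smul_const (c t)).add (h1.smul hc)
  refine h2.congr fun h => ?_
  rw [smul_eq_mul, mul_smul, smul_comm (g (t + h)), ← smul_add, sub_smul, smul_sub]
  congr 1
  abel

theorem hasDerivAt_of_contDiff_infty {F : Type*} [NormedAddCommGroup F] [NormedSpace ℝ F]
    {g : ℝ → F} (hg : ContDiff ℝ (⊤ : ℕ∞) g) (t : ℝ) : HasDerivAt g (deriv g t) t :=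
  ((contDiff_infty_iff_deriv.1 hg).1 t).hasDerivAt

/-- Linear combinations of reparametrisations of smooth curves are smooth. -/
theorem IsSmoothCurve.smul_comp {c : ℝ → X} {g f : ℝ → ℝ} (hc : IsSmoothCurve c)
    (hf : ContDiff ℝ (⊤ : ℕ∞) f) (hg : ContDiff ℝ (⊤ : ℕ∞) g) :
    IsSmoothCurve (fun t => f t • c (g t)) := by
  -- The derivative of `f • (c ∘ g)` is a sum of two curves of this kind, so the coinduction runs on
  -- the additive closure of `S`, which is stable under differentiation.
  let S : Set (ℝ → X) := {e | ∃ (c : ℝ → X) (f : ℝ → ℝ), IsSmoothCurve c ∧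
    ContDiff ℝ (⊤ : ℕ∞) f ∧ e = fun t => f t • c (g t)}
  refine IsSmoothCurve.coinduction (fun e => e ∈ AddSubmonoid.closure S) (fun e he => ?_)
    (AddSubmonoid.subset_closure ⟨c, f, hc, hf, rfl⟩)
  induction he using AddSubmonoid.closure_induction with
  | mem e he =>
    obtain ⟨c, f, hc, hf, rfl⟩ := he
    obtain ⟨c', hc', hcc'⟩ := hc.exists_deriv
    refine ⟨(fun t => deriv f t • c (g t)) + fun t => (f t * deriv g t) • c' (g t),
      add_mem (AddSubmonoid.subset_closure
          ⟨c, _, hc, (contDiff_infty_iff_deriv.1 hf).2, rfl⟩)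
        (AddSubmonoid.subset_closure
          ⟨c', _, hc', hf.mul (contDiff_infty_iff_deriv.1 hg).2, rfl⟩), fun t => ?_⟩
    have := HasCurveDerivAt.smul (hasDerivAt_of_contDiff_infty hf t)
      ((hcc' (g t)).comp_hasDerivAt (hasDerivAt_of_contDiff_infty hg t))
    simpa [smul_smul] using this
  | zero => exact ⟨0, zero_mem _, fun t => hasCurveDerivAt_const 0 t⟩
  | add d e _ _ hd he =>
    obtain ⟨d', hd', hdd'⟩ := hd
    obtain ⟨e', he', hee'⟩ := he
    exact ⟨d' + e', add_mem hd' he', fun t => (hdd' t).add (hee' t)⟩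

theorem IsSmoothCurve.comp {c : ℝ → X} {g : ℝ → ℝ} (hc : IsSmoothCurve c)
    (hg : ContDiff ℝ (⊤ : ℕ∞) g) : IsSmoothCurve (fun t => c (g t)) := by
  simpa using hc.smul_comp (contDiff_const (c := (1 : ℝ))) hg

theorem isSmoothCurve_line (x v : X) : IsSmoothCurve (fun t : ℝ => x + t • v) :=
  (isSmoothCurve_const x).add
    ((isSmoothCurve_const v).smul_comp (f := fun t => t) contDiff_id contDiff_id)

end Curves

section NormedCurves

variable {F : Type*} [NormedAddCommGroup F] [NormedSpace ℝ F]

theorem hasCurveDerivAt_iff_hasDerivAt {c : ℝ → F} {v : F} {t : ℝ} :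
    HasCurveDerivAt c v t ↔ HasDerivAt c v t :=
  hasDerivAt_iff_tendsto_slope_zero.symm

theorem isSmoothCurve_iff_contDiff {c : ℝ → F} :
    IsSmoothCurve c ↔ ContDiff ℝ (⊤ : ℕ∞) c := by
  constructor
  · rintro ⟨d, rfl, hd⟩
    simp only [hasCurveDerivAt_iff_hasDerivAt] at hd
    -- All `k` are treated together: `d k` is of class `C^(m+1)` once its derivative `d (k + 1)` is
    -- of class `C^m`.
    have key : ∀ m k : ℕ, ContDiff ℝ m (d k) := by
      intro m
      induction m with
      | zero =>
        intro k
        rw [Nat.cast_zero, contDiff_zero, continuous_iff_continuousAt]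
        exact fun t => (hd k t).continuousAt
      | succ m ih =>
        intro k
        have : deriv (d k) = d (k + 1) := funext fun t => (hd k t).deriv
        rw [Nat.cast_succ, contDiff_succ_iff_deriv]
        exact ⟨fun t => (hd k t).differentiableAt, by simp, this ▸ ih (k + 1)⟩
    exact contDiff_infty.2 fun m => key m 0
  · intro hc
    exact IsSmoothCurve.coinduction (fun c => ContDiff ℝ (⊤ : ℕ∞) c)
      (fun c hc => ⟨deriv c, (contDiff_infty_iff_deriv.1 hc).2, fun t =>
        hasCurveDerivAt_iff_hasDerivAt.2 (hasDerivAt_of_contDiff_infty hc t)⟩) hc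

end NormedCurves

end Colombeau

end

noncomputable section

namespace Colombeau

/-! ### Boman's theorem -/

section SpecialCurve

variable {V : Type*} [NormedAddCommGroup V] [NormedSpace ℝ V] [CompleteSpace V]

/-- The `k`-th derivative of the `n`-th term is at most `C k * |l n| ^ k * a n`, where `C k` bounds
the `k`-th derivative of `θ`, whatever the centres `τ n` are. The series may therefore be
differentiated termwise to any order. -/
theorem contDiff_tsum_smul_const {θ : ℝ → ℝ} (hθ : ContDiff ℝ (⊤ : ℕ∞) θ)
    (hs : HasCompactSupport θ) {l τ a : ℕ → ℝ} {z : ℕ → V} (hz : ∀ n, ‖z n‖ ≤ a n)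
    (hsum : ∀ k : ℕ, Summable fun n => |l n| ^ k * a n) :
    ContDiff ℝ (⊤ : ℕ∞) fun s => ∑' n, θ (l n * (s - τ n)) • z n := by
  have hb : ∀ k : ℕ, ∃ C, ∀ s, ‖iteratedDeriv k θ s‖ ≤ C := fun k => by
    obtain ⟨C, hC⟩ := (hs.iteratedFDeriv (𝕜 := ℝ) k).exists_bound_of_continuous
      (hθ.continuous_iteratedFDeriv (m := k) (by exact_mod_cast le_top))
    exact ⟨C, fun s => by rw [← norm_iteratedFDeriv_eq_norm_iteratedDeriv]; exact hC s⟩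
  choose C hC using hb
  have hψ : ∀ n, ContDiff ℝ (⊤ : ℕ∞) fun s => θ (l n * (s - τ n)) := fun n =>
    hθ.comp (contDiff_const.mul (contDiff_id.sub contDiff_const))
  refine contDiff_tsum (N := ⊤) (v := fun k n => C k * (|l n| ^ k * a n))
    (fun n => (hψ n).smul contDiff_const) (fun k _ => (hsum k).mul_left _) fun k n s _ => ?_
  have h1 := ContinuousLinearMap.norm_iteratedFDeriv_comp_left (n := k)
    (ContinuousLinearMap.toSpanSingleton ℝ (z n)) ((hψ n).contDiffAt (x := s))
    (by exact_mod_cast le_top)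
  have h2 : (ContinuousLinearMap.toSpanSingleton ℝ (z n)) ∘ (fun s => θ (l n * (s - τ n))) =
      fun s => θ (l n * (s - τ n)) • z n := by ext; simp
  have h3 : iteratedDeriv k (fun s => θ (l n * (s - τ n))) s =
      l n ^ k * iteratedDeriv k θ (l n * (s - τ n)) := by
    rw [iteratedDeriv_comp_sub_const k (fun s => θ (l n * s)) (τ n),
      iteratedDeriv_comp_const_mul (hθ.of_le (by exact_mod_cast le_top))]
  rw [h2, norm_iteratedFDeriv_eq_norm_iteratedDeriv (f := fun s => θ (l n * (s - τ n))), h3,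
    ContinuousLinearMap.norm_toSpanSingleton, norm_mul, norm_pow, Real.norm_eq_abs] at h1
  refine h1.trans ?_
  calc ‖z n‖ * (|l n| ^ k * ‖iteratedDeriv k θ (l n * (s - τ n))‖)
      ≤ a n * (|l n| ^ k * C k) := by
        gcongr
        · exact (norm_nonneg _).trans (hz n)
        · exact hz n
        · exact hC k _
    _ = _ := by ring

/-- The special curve lemma: a smooth curve running through infinitely short pieces of lines
through the points of a fast converging sequence. -/
theorem exists_special_curve (x : V) (xs : ℕ → V) (w : V)
    (hxs : ∀ n, ‖xs n - x‖ ≤ 1 / (n.factorial : ℝ)) :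
    ∃ c : ℝ → V, ContDiff ℝ (⊤ : ℕ∞) c ∧ c 0 = x ∧ ∀ n : ℕ, c =ᶠ[𝓝 ((2⁻¹ : ℝ) ^ n)] fun t =>
      xs n + ((1 / (n.factorial : ℝ)) * (t - (2⁻¹ : ℝ) ^ n)) • w := by
  let φ : ContDiffBump (0 : ℝ) := ⟨1, 2, one_pos, one_lt_two⟩
  have hφ : ContDiff ℝ (⊤ : ℕ∞) φ := φ.contDiff
  -- The `n`-th bump is centred at `τ n = 2⁻ⁿ` and rescaled so that it is `1` within `τ n / 16` of
  -- the centre and `0` beyond `τ n / 8`. Distinct bumps do not overlap, and the powers of `l n`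
  -- grow only geometrically, which `1 / n!` absorbs.
  let l : ℕ → ℝ := fun n => 16 * 2 ^ n
  let τ : ℕ → ℝ := fun n => (2⁻¹ : ℝ) ^ n
  have hl : ∀ n, 0 < l n := fun n => by positivity
  have hτ : ∀ n, 0 < τ n := fun n => by positivity
  have hlτ : ∀ n, l n * τ n = 16 := fun n => by
    simp only [l, τ, inv_pow]
    field_simp
  have hsum : ∀ k : ℕ, Summable fun n => |l n| ^ k * (1 / (n.factorial : ℝ)) := fun k => by
    refine ((Real.summable_pow_div_factorial ((2 : ℝ) ^ k)).mul_left (16 ^ k)).congr fun n => ?_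
    rw [abs_of_pos (hl n)]
    simp only [l, mul_pow, ← pow_mul, mul_comm n k]
    ring
  -- `c1` places the curve at `xs n`, while `c2` adds the linear motion there. The profile `r * φ r`
  -- equals `r` near `0`, and the factor `(l n)⁻¹` undoes the rescaling of its argument.
  let c1 : ℝ → V := fun s => ∑' n, φ (l n * (s - τ n)) • (xs n - x)
  let c2 : ℝ → V := fun s => ∑' n, (fun r => r * φ r) (l n * (s - τ n)) •
    ((1 / (n.factorial : ℝ)) • (l n)⁻¹ • w)
  have h1 : ContDiff ℝ (⊤ : ℕ∞) c1 :=
    contDiff_tsum_smul_const hφ φ.hasCompactSupport hxs hsum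
  have h2 : ContDiff ℝ (⊤ : ℕ∞) c2 := by
    refine contDiff_tsum_smul_const (contDiff_id.mul hφ) φ.hasCompactSupport.mul_left
      (a := fun n => ‖w‖ * (1 / (n.factorial : ℝ))) (fun n => ?_) fun k => ?_
    · rw [norm_smul, norm_smul, Real.norm_of_nonneg (by positivity),
        Real.norm_of_nonneg (inv_nonneg.2 (hl n).le), mul_comm ‖w‖]
      have : (l n)⁻¹ ≤ 1 := inv_le_one_of_one_le₀ (by
        have : (1 : ℝ) ≤ 2 ^ n := one_le_pow₀ one_le_two
        simp only [l]; linarith)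
      gcongr
      exact mul_le_of_le_one_left (norm_nonneg _) this
    · exact ((hsum k).mul_left ‖w‖).congr fun n => by ring
  have hφ0 : ∀ r, 2 ≤ |r| → φ r = 0 := fun r hr => φ.zero_of_le_dist (by simpa using hr)
  have hφ1 : ∀ r, |r| ≤ 1 → φ r = 1 := fun r hr => φ.one_of_mem_closedBall (by simpa using hr)
  refine ⟨fun s => x + c1 s + c2 s, (contDiff_const.add h1).add h2, ?_, fun n => ?_⟩
  · have h0 : ∀ n, φ (l n * (0 - τ n)) = 0 := fun n => hφ0 _ (by
      rw [zero_sub, mul_neg, hlτ, abs_neg]; norm_num)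
    simp only [c1, c2, h0]
    simp
  · have hev : ∀ᶠ t in 𝓝 (τ n), |t - τ n| < τ n / 16 := by
      have := Metric.ball_mem_nhds (τ n) (ε := τ n / 16) (by linarith [hτ n])
      filter_upwards [this] with t ht
      simpa [Real.dist_eq] using ht
    filter_upwards [hev] with t ht
    -- Centres on either side of `τ n` differ from it by a factor of at least `2`, so a point within
    -- `τ n / 16` of `τ n` is farther than `τ m / 8` from `τ m`.
    have hne : ∀ m, m ≠ n → φ (l m * (t - τ m)) = 0 := by
      intro m hm
      refine hφ0 _ ?_
      rw [abs_mul, abs_of_pos (hl m)]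
      suffices h : τ m / 8 ≤ |t - τ m| by
        calc (2 : ℝ) = l m * (τ m / 8) := by rw [mul_div_assoc', hlτ]; norm_num
          _ ≤ _ := by gcongr
      rw [abs_lt] at ht
      rcases lt_or_gt_of_ne hm with h | h
      · have : τ n ≤ τ m / 2 := by
          have : τ n ≤ τ (m + 1) := pow_le_pow_of_le_one (by norm_num) (by norm_num) h
          simp only [τ, pow_succ] at this ⊢
          linarith
        rw [abs_of_neg (by linarith [hτ m])]
        linarith [hτ m]
      · have : τ m ≤ τ n / 2 := by
          have : τ m ≤ τ (n + 1) := pow_le_pow_of_le_one (by norm_num) (by norm_num) h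
          simp only [τ, pow_succ] at this ⊢
          linarith
        rw [abs_of_pos (by linarith [hτ m])]
        linarith [hτ m]
    have hn : φ (l n * (t - τ n)) = 1 := by
      refine hφ1 _ ?_
      rw [abs_mul, abs_of_pos (hl n)]
      calc l n * |t - τ n| ≤ l n * (τ n / 16) := by gcongr
        _ = 1 := by rw [mul_div_assoc', hlτ]; norm_num
    have e1 : c1 t = xs n - x := by
      simp only [c1]
      rw [tsum_eq_single n fun m hm => by rw [hne m hm, zero_smul], hn, one_smul]
    have e2 : c2 t = ((1 / (n.factorial : ℝ)) * (t - τ n)) • w := by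
      simp only [c2]
      rw [tsum_eq_single n fun m hm => by rw [hne m hm, mul_zero, zero_smul], hn]
      rw [smul_smul, smul_smul]
      congr 1
      field_simp [(hl n).ne']
    simp only [e1, e2, τ]
    abel

end SpecialCurve

/-! ### Local bounds for derivatives along lines -/

section Boman

variable {V E : Type*} [NormedAddCommGroup V] [NormedSpace ℝ V]
  [NormedAddCommGroup E] [NormedSpace ℝ E]

/-- The `p`-th derivative of `h` at `z` along the line with direction `v`. -/
def lineIterDeriv (h : V → E) (v : V) (p : ℕ) (z : V) : E :=
  iteratedDeriv p (fun t : ℝ => h (z + t • v)) 0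

/-- `h` maps smooth curves to smooth curves. -/
def AlongCurves (h : V → E) : Prop :=
  ∀ c : ℝ → V, ContDiff ℝ (⊤ : ℕ∞) c → ContDiff ℝ (⊤ : ℕ∞) fun t => h (c t)

theorem AlongCurves.line {h : V → E} (hh : AlongCurves h) (v z : V) :
    ContDiff ℝ (⊤ : ℕ∞) fun t : ℝ => h (z + t • v) :=
  hh _ (contDiff_const.add (contDiff_id.smul contDiff_const))

/-- If boundedness fails, there are points `xs n` within `1 / n!` of `x` whose `p`-th derivative
exceeds `n * (n!) ^ p`. The special curve crosses `xs n` at time `2⁻ⁿ` with velocity `v / n!`, so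
the `p`-th derivative of `h ∘ c` there has norm more than `n`. This contradicts its continuity at
time `0`. -/
theorem AlongCurves.locally_bounded [CompleteSpace V] {h : V → E}
    (hh : AlongCurves h) (v : V) (p : ℕ) (x : V) :
    ∃ C, ∀ᶠ z in 𝓝 x, ‖lineIterDeriv h v p z‖ ≤ C := by
  by_contra! hcon
  have hex : ∀ n : ℕ, ∃ z, ‖z - x‖ ≤ 1 / (n.factorial : ℝ) ∧
      n * (n.factorial : ℝ) ^ p < ‖lineIterDeriv h v p z‖ := by
    intro n
    obtain ⟨z, hz, hz'⟩ := ((hcon (n * (n.factorial : ℝ) ^ p)).and_eventually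
      (Metric.closedBall_mem_nhds x (ε := 1 / (n.factorial : ℝ)) (by positivity))).exists
    exact ⟨z, by simpa [dist_eq_norm] using hz', hz⟩
  choose xs hxs hbig using hex
  obtain ⟨c, hc, -, hcn⟩ := exists_special_curve x xs v hxs
  have hcont : Continuous (iteratedDeriv p fun t => h (c t)) :=
    (hh c hc).continuous_iteratedDeriv p (by exact_mod_cast le_top)
  have hval : ∀ n : ℕ, iteratedDeriv p (fun t => h (c t)) ((2⁻¹ : ℝ) ^ n) =
      (1 / (n.factorial : ℝ)) ^ p • lineIterDeriv h v p (xs n) := by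
    intro n
    have h1 : (fun t => h (c t)) =ᶠ[𝓝 ((2⁻¹ : ℝ) ^ n)] fun t =>
        h (xs n + ((1 / (n.factorial : ℝ)) * (t - (2⁻¹ : ℝ) ^ n)) • v) :=
      (hcn n).fun_comp h
    rw [h1.iteratedDeriv_eq, iteratedDeriv_comp_sub_const p
      (fun t => h (xs n + ((1 / (n.factorial : ℝ)) * t) • v)),
      iteratedDeriv_comp_const_smul (f := fun t => h (xs n + t • v))
        ((hh.line v (xs n)).of_le (by exact_mod_cast le_top))]
    simp [lineIterDeriv]
  have hlim : Tendsto (fun n : ℕ => ‖iteratedDeriv p (fun t => h (c t)) ((2⁻¹ : ℝ) ^ n)‖) atTop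
      (𝓝 ‖iteratedDeriv p (fun t => h (c t)) 0‖) :=
    ((hcont.tendsto 0).comp
      (tendsto_pow_atTop_nhds_zero_of_lt_one (by norm_num) (by norm_num))).norm
  refine not_tendsto_nhds_of_tendsto_atTop ?_ _ hlim
  refine tendsto_atTop_mono (fun n => ?_) (tendsto_natCast_atTop_atTop (R := ℝ))
  rw [hval, norm_smul, norm_pow, Real.norm_of_nonneg (by positivity), one_div, inv_pow,
    inv_mul_eq_div, le_div_iff₀ (by positivity)]
  exact (hbig n).le

/-- The special curve with zero velocity suffices: it sits at `xs n` at time `2⁻ⁿ` and at `x` at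
time `0`, so `h (xs n)` must tend to `h x` for every sequence converging fast enough. -/
theorem AlongCurves.continuous [CompleteSpace V] {h : V → E} (hh : AlongCurves h) :
    Continuous h := by
  rw [continuous_iff_continuousAt]
  intro x
  by_contra hcon
  have hcon' : ∃ ε > 0, ∃ᶠ z in 𝓝 x, ε ≤ ‖h z - h x‖ := by
    rw [ContinuousAt, Metric.tendsto_nhds] at hcon
    push Not at hcon
    obtain ⟨ε, hε, h1⟩ := hcon
    exact ⟨ε, hε, h1.mono fun z hz => by simpa [dist_eq_norm] using hz⟩
  obtain ⟨ε, hε, hfr⟩ := hcon'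
  have hex : ∀ n : ℕ, ∃ z, ‖z - x‖ ≤ 1 / (n.factorial : ℝ) ∧ ε ≤ ‖h z - h x‖ := by
    intro n
    obtain ⟨z, hz, hz'⟩ := (hfr.and_eventually
      (Metric.closedBall_mem_nhds x (ε := 1 / (n.factorial : ℝ)) (by positivity))).exists
    exact ⟨z, by simpa [dist_eq_norm] using hz', hz⟩
  choose xs hxs hbig using hex
  obtain ⟨c, hc, hc0, hcn⟩ := exists_special_curve x xs 0 hxs
  have hlim : Tendsto (fun n : ℕ => ‖h (c ((2⁻¹ : ℝ) ^ n)) - h x‖) atTop (𝓝 0) := by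
    have h1 := (((hh c hc).continuous.tendsto 0).comp
      (tendsto_pow_atTop_nhds_zero_of_lt_one (r := (2⁻¹ : ℝ)) (by norm_num) (by norm_num)))
    rw [hc0] at h1
    simpa using (h1.sub_const (h x)).norm
  obtain ⟨n, hn⟩ := ((tendsto_order.1 hlim).2 ε hε).exists
  rw [(hcn n).eq_of_nhds] at hn
  simp only [sub_self, mul_zero, smul_zero, add_zero] at hn
  exact absurd (hbig n) (not_le.2 hn)

theorem AlongCurves.hasLineDerivAt {h : V → E} (hh : AlongCurves h) (v : V) (p : ℕ) (z : V) :
    HasLineDerivAt ℝ (lineIterDeriv h v p) (lineIterDeriv h v (p + 1) z) z v := by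
  -- Along the line through `z` all the values are derivatives of the single one-variable function
  -- `t ↦ h (z + t • v)`.
  have h1 : (fun t : ℝ => lineIterDeriv h v p (z + t • v)) =
      iteratedDeriv p (fun t : ℝ => h (z + t • v)) := by
    ext t
    have h2 := congrFun (iteratedDeriv_comp_const_add p (fun s : ℝ => h (z + s • v)) t) 0
    simp only [add_zero] at h2
    rw [← h2, lineIterDeriv]
    simp only [add_smul, add_assoc]
  rw [HasLineDerivAt, h1, lineIterDeriv, iteratedDeriv_succ]
  exact (((hh.line v z).differentiable_iteratedDeriv p
    (by exact_mod_cast ENat.natCast_lt_top p)) 0).hasDerivAt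

theorem lineIterDeriv_eq_zero {h : V → E} {v z : V} (p : ℕ) (hz : z ∉ tsupport h) :
    lineIterDeriv h v p z = 0 := by
  have h1 : h =ᶠ[𝓝 z] 0 := notMem_tsupport_iff_eventuallyEq.1 hz
  have h2 : Tendsto (fun t : ℝ => z + t • v) (𝓝 0) (𝓝 z) :=
    Continuous.tendsto' (by fun_prop) _ _ (by simp)
  have h3 : (fun t : ℝ => h (z + t • v)) =ᶠ[𝓝 0] fun _ => 0 := h2.eventually h1
  rw [lineIterDeriv, h3.iteratedDeriv_eq]
  simp

end Boman

end Colombeau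

end

noncomputable section

namespace Colombeau

/-! ### Decay of the Fourier transform and Boman's theorem -/

section BomanFourier

variable {V E : Type*} [NormedAddCommGroup V] [InnerProductSpace ℝ V] [FiniteDimensional ℝ V]
  [MeasurableSpace V] [BorelSpace V] [NormedAddCommGroup E] [NormedSpace ℂ E]

/-- Integration by parts against the character in the direction `v`. Only differentiability along
lines parallel to `v` is assumed, because total differentiability is what Boman's theorem has yet to
establish. -/
theorem fourier_of_hasLineDerivAt {f f' : V → E} {v : V} (hf : Integrable f)
    (hf' : Integrable f') (h : ∀ x, HasLineDerivAt ℝ f (f' x) x v) (ξ : V) :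
    𝓕 f' ξ = (2 * Real.pi * Complex.I * (inner ℝ v ξ : ℝ) : ℂ) • 𝓕 f ξ := by
  rw [Real.fourier_eq, Real.fourier_eq]
  have hi := (Real.fourierIntegral_convergent_iff (f := f) ξ).2 hf
  have hi' := (Real.fourierIntegral_convergent_iff (f := f') ξ).2 hf'
  have hd : ∀ x, HasLineDerivAt ℝ (fun x : V => (Real.fourierChar (-inner ℝ x ξ) : ℂ))
      (-(2 * Real.pi * Complex.I * (inner ℝ v ξ : ℝ)) * (Real.fourierChar (-inner ℝ x ξ) : ℂ))
      x v := by
    intro x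
    have h1 := ((Real.hasFDerivAt_fourierChar_neg_bilinear_left (innerSL ℝ (E := V)) x
      ξ).hasLineDerivAt v)
    have h2 : ((-2 * ↑Real.pi * Complex.I * (Real.fourierChar (-inner ℝ x ξ) : ℂ)) •
        Complex.ofRealCLM ∘L (innerSL ℝ (E := V)).flip ξ) v =
        -(2 * Real.pi * Complex.I * (inner ℝ v ξ : ℝ)) * (Real.fourierChar (-inner ℝ x ξ) : ℂ) := by
      have h3 : innerSL ℝ (E := V) ξ v = inner ℝ v ξ := real_inner_comm v ξ
      simp [h3]
      ring
    exact h2 ▸ h1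
  have key := integral_bilinear_hasLineDerivAt_right_eq_neg_left_of_integrable
    (μ := (volume : Measure V)) (f := fun x : V => (Real.fourierChar (-inner ℝ x ξ) : ℂ)) (g := f)
    (B := ContinuousLinearMap.lsmul ℝ ℂ) (g' := f') (v := v) (f' := fun x =>
      -(2 * Real.pi * Complex.I * (inner ℝ v ξ : ℝ)) * (Real.fourierChar (-inner ℝ x ξ) : ℂ))
    (by
      simp only [ContinuousLinearMap.lsmul_apply, mul_smul]
      simp only [Circle.smul_def] at hi
      exact hi.smul (-(2 * Real.pi * Complex.I * (inner ℝ v ξ : ℝ)) : ℂ))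
    hi' hi (fun x _ => hd x) fun x _ => h x
  simp only [ContinuousLinearMap.lsmul_apply, mul_smul, integral_smul] at key
  simp only [Circle.smul_def]
  rw [key, neg_smul, neg_neg]

/-- Continuity of the line derivatives in the base point is not yet available. Each one is, however,
a pointwise limit of difference quotients of the previous one with steps `1 / k`, and this preserves
measurability. -/
theorem AlongCurves.stronglyMeasurable {h : V → E} (hh : AlongCurves h) (v : V) (p : ℕ) :
    StronglyMeasurable (lineIterDeriv h v p) := by
  induction p with
  | zero =>
    have : lineIterDeriv h v 0 = h := by ext z; simp [lineIterDeriv]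
    rw [this]
    exact hh.continuous.stronglyMeasurable
  | succ p ih =>
    refine stronglyMeasurable_of_tendsto atTop (f := fun (k : ℕ) z =>
      (k : ℝ) • (lineIterDeriv h v p (z + (k : ℝ)⁻¹ • v) - lineIterDeriv h v p z))
      (fun k => ((ih.comp_measurable (measurable_add_const _)).sub ih).const_smul _)
      (tendsto_pi_nhds.2 fun z => ?_)
    have h1 := hasDerivAt_iff_tendsto_slope_zero.1 (hh.hasLineDerivAt v p z)
    have h2 : Tendsto (fun k : ℕ => (k : ℝ)⁻¹) atTop (𝓝[≠] 0) :=
      tendsto_nhdsWithin_iff.2 ⟨tendsto_inv_atTop_nhds_zero_nat,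
        (eventually_gt_atTop 0).mono fun k hk => by simpa using hk.ne'⟩
    refine (h1.comp h2).congr fun k => ?_
    simp

/-- A finite subcover of the compact support makes the local bounds global, and the derivatives
vanish off the support. -/
theorem AlongCurves.integrable {h : V → E} (hh : AlongCurves h) (hs : HasCompactSupport h) (v : V)
    (p : ℕ) : Integrable (lineIterDeriv h v p) := by
  choose C hC using fun x => hh.locally_bounded v p x
  obtain ⟨s, -, hs'⟩ := hs.isCompact.elim_nhds_subcover _ fun x _ => hC x
  have hbd : ∀ z, ‖lineIterDeriv h v p z‖ ≤ ∑ x ∈ s, |C x| := by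
    intro z
    by_cases hz : z ∈ tsupport h
    · obtain ⟨x, hx, hzx⟩ := Set.mem_iUnion₂.1 (hs' hz)
      exact le_trans hzx ((le_abs_self _).trans
        (Finset.single_le_sum (f := fun x => |C x|) (fun _ _ => abs_nonneg _) hx))
    · rw [lineIterDeriv_eq_zero p hz, norm_zero]
      exact Finset.sum_nonneg fun _ _ => abs_nonneg _
  have hsub : Function.support (lineIterDeriv h v p) ⊆ tsupport h := fun z hz => by
    by_contra hcon
    exact hz (lineIterDeriv_eq_zero p hcon)
  rw [← integrableOn_iff_integrable_of_support_subset hsub]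
  exact Measure.integrableOn_of_bounded hs.isCompact.measure_lt_top.ne
    (hh.stronglyMeasurable v p).aestronglyMeasurable (Eventually.of_forall hbd)

/-- The Fourier transform of the `p`-th line derivative is `(2πi⟨v, ξ⟩) ^ p • 𝓕 h ξ` and is bounded
by an `L¹` norm. The factor `2π ≥ 1` is dropped. -/
theorem AlongCurves.fourier_decay {h : V → E} (hh : AlongCurves h) (hs : HasCompactSupport h)
    (v : V) (p : ℕ) : ∃ C, ∀ ξ, |inner ℝ v ξ| ^ p * ‖𝓕 h ξ‖ ≤ C := by
  refine ⟨∫ z, ‖lineIterDeriv h v p z‖, fun ξ => ?_⟩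
  have h1 : 𝓕 (lineIterDeriv h v p) ξ =
      (2 * Real.pi * Complex.I * (inner ℝ v ξ : ℝ) : ℂ) ^ p • 𝓕 h ξ := by
    induction p with
    | zero =>
      have : lineIterDeriv h v 0 = h := by ext z; simp [lineIterDeriv]
      simp [this]
    | succ p ih =>
      rw [fourier_of_hasLineDerivAt (hh.integrable hs v p) (hh.integrable hs v (p + 1))
        (hh.hasLineDerivAt v p), ih, smul_smul, pow_succ']
  have h2 : ‖𝓕 (lineIterDeriv h v p) ξ‖ ≤ ∫ z, ‖lineIterDeriv h v p z‖ :=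
    VectorFourier.norm_fourierIntegral_le_integral_norm _ _ _ _ _
  rw [h1, norm_smul, norm_pow] at h2
  refine le_trans ?_ h2
  gcongr
  have hpi : (1 : ℝ) ≤ 2 * Real.pi := by linarith [Real.pi_gt_three]
  simp only [norm_mul, Complex.norm_I, Complex.norm_real, Real.norm_eq_abs, mul_one,
    Complex.norm_ofNat, abs_of_pos Real.pi_pos]
  exact le_mul_of_one_le_left (abs_nonneg _) hpi

theorem AlongCurves.fourier_norm_decay {h : V → E} (hh : AlongCurves h)
    (hs : HasCompactSupport h) (p : ℕ) : ∃ C, ∀ ξ, ‖ξ‖ ^ p * ‖𝓕 h ξ‖ ≤ C := by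
  let b := stdOrthonormalBasis ℝ V
  choose C hC using fun i => hh.fourier_decay hs (b i) p
  obtain ⟨C0, hC0⟩ := hh.fourier_decay hs 0 0
  let d : ℝ := Fintype.card (Fin (Module.finrank ℝ V))
  refine ⟨∑ i, d ^ p * |C i| + |C0|, fun ξ => ?_⟩
  have hS : 0 ≤ ∑ i, d ^ p * |C i| := Finset.sum_nonneg fun i _ => by positivity
  have hξ : ‖ξ‖ ≤ ∑ i, |inner ℝ (b i) ξ| := by
    conv_lhs => rw [← b.sum_repr' ξ]
    refine (norm_sum_le _ _).trans (Finset.sum_le_sum fun i _ => ?_)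
    simp [norm_smul]
  -- In dimension `0` there is no largest coordinate. There `ξ = 0` and `‖ξ‖ ^ p ≤ 1`, so the bound
  -- `C0` for exponent `0` is enough.
  rcases isEmpty_or_nonempty (Fin (Module.finrank ℝ V)) with hE | hE
  · have h0 : ξ = 0 := by
      rw [← norm_le_zero_iff]
      simpa using hξ
    have h1 := hC0 ξ
    simp only [pow_zero, one_mul] at h1
    calc ‖ξ‖ ^ p * ‖𝓕 h ξ‖ ≤ 1 * ‖𝓕 h ξ‖ := by
          gcongr
          exact pow_le_one₀ (norm_nonneg _) (by simp [h0])
      _ ≤ _ := by linarith [le_abs_self C0]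
  · obtain ⟨i, -, hi⟩ := Finset.exists_max_image Finset.univ (fun i => |inner ℝ (b i) ξ|)
      Finset.univ_nonempty
    have h1 : ‖ξ‖ ≤ d * |inner ℝ (b i) ξ| := by
      refine hξ.trans ((Finset.sum_le_card_nsmul _ _ _ hi).trans (le_of_eq ?_))
      simp [d]
    calc ‖ξ‖ ^ p * ‖𝓕 h ξ‖ ≤ (d * |inner ℝ (b i) ξ|) ^ p * ‖𝓕 h ξ‖ := by gcongr
      _ = d ^ p * (|inner ℝ (b i) ξ| ^ p * ‖𝓕 h ξ‖) := by ring
      _ ≤ d ^ p * |C i| := by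
        gcongr
        exact (hC i ξ).trans (le_abs_self _)
      _ ≤ ∑ i, d ^ p * |C i| := Finset.single_le_sum (f := fun i => d ^ p * |C i|)
          (fun i _ => by positivity) (Finset.mem_univ i)
      _ ≤ _ := by linarith [abs_nonneg C0]

/-- Rapid decay makes every `‖ξ‖ ^ p * ‖𝓕 h ξ‖` integrable. Hence the inverse transform of `𝓕 h` is
smooth, and by continuity of `h` the inversion formula identifies it with `h`. -/
theorem AlongCurves.contDiff_of_hasCompactSupport [CompleteSpace E] {h : V → E}
    (hh : AlongCurves h) (hs : HasCompactSupport h) : ContDiff ℝ (⊤ : ℕ∞) h := by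
  have hint : Integrable h := hh.continuous.integrable_of_hasCompactSupport hs
  have hFc : Continuous (𝓕 h) := VectorFourier.fourierIntegral_continuous
    Real.continuous_fourierChar (by exact continuous_inner) hint
  have hFi : ∀ p : ℕ, Integrable fun ξ => ‖ξ‖ ^ p * ‖𝓕 h ξ‖ := by
    intro p
    -- One more than the dimension is enough for `(1 + ‖ξ‖) ^ (-r)` to be integrable.
    let r : ℕ := Module.finrank ℝ V + 1
    obtain ⟨C, hC⟩ := hh.fourier_norm_decay hs p
    obtain ⟨C', hC'⟩ := hh.fourier_norm_decay hs (p + r)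
    have hI : Integrable (fun ξ : V => (2 ^ r * (|C| + |C'|)) * (1 + ‖ξ‖) ^ (-(r : ℝ))) :=
      (integrable_one_add_norm (by simp [r])).const_mul _
    refine hI.mono' (by fun_prop) (Eventually.of_forall fun ξ => ?_)
    rw [Real.norm_of_nonneg (by positivity), Real.rpow_neg (by positivity), Real.rpow_natCast,
      ← div_eq_mul_inv, le_div_iff₀ (by positivity)]
    have h1 : (1 + ‖ξ‖) ^ r ≤ 2 ^ r * (1 + ‖ξ‖ ^ r) := by
      rcases le_total ‖ξ‖ 1 with h | h
      · calc (1 + ‖ξ‖) ^ r ≤ 2 ^ r := by gcongr; linarith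
          _ ≤ _ := le_mul_of_one_le_right (by positivity) (by simp)
      · calc (1 + ‖ξ‖) ^ r ≤ (2 * ‖ξ‖) ^ r := by gcongr; linarith
          _ = 2 ^ r * ‖ξ‖ ^ r := mul_pow _ _ _
          _ ≤ _ := by gcongr; linarith
    calc ‖ξ‖ ^ p * ‖𝓕 h ξ‖ * (1 + ‖ξ‖) ^ r
        ≤ ‖ξ‖ ^ p * ‖𝓕 h ξ‖ * (2 ^ r * (1 + ‖ξ‖ ^ r)) := by gcongr
      _ = 2 ^ r * (‖ξ‖ ^ p * ‖𝓕 h ξ‖ + ‖ξ‖ ^ (p + r) * ‖𝓕 h ξ‖) := by ring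
      _ ≤ _ := by
        gcongr
        · exact (hC ξ).trans (le_abs_self _)
        · exact (hC' ξ).trans (le_abs_self _)
  have hF0 : Integrable (𝓕 h) := by
    rw [← integrable_norm_iff hFc.aestronglyMeasurable]
    simpa using hFi 0
  rw [← hh.continuous.fourierInv_fourier_eq hint hF0]
  have h2 : ContDiff ℝ (⊤ : ℕ∞) (𝓕 (𝓕 h)) := Real.contDiff_fourier fun p _ => hFi p
  have h3 : 𝓕⁻ (𝓕 h) = fun w => 𝓕 (𝓕 h) (-w) := by
    ext w; rw [Real.fourierInv_eq_fourier_neg]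
  rw [h3]
  exact h2.comp contDiff_neg

/-- **Boman's theorem**: a map that sends smooth curves to smooth curves is smooth. -/
theorem AlongCurves.contDiff [CompleteSpace E] {h : V → E} (hh : AlongCurves h) :
    ContDiff ℝ (⊤ : ℕ∞) h := by
  rw [contDiff_iff_contDiffAt]
  intro x
  -- Smoothness is local: a cut-off equal to `1` near `x` leaves the germ of `h` unchanged, and `φ •
  -- h` still maps smooth curves to smooth curves.
  let φ : ContDiffBump x := ⟨1, 2, one_pos, one_lt_two⟩
  have h1 : AlongCurves fun z => φ z • h z := fun c hc => (φ.contDiff.comp hc).smul (hh c hc)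
  refine (h1.contDiff_of_hasCompactSupport
    φ.hasCompactSupport.smul_right).contDiffAt.congr_of_eventuallyEq ?_
  filter_upwards [φ.eventuallyEq_one] with z hz
  simp [hz]

end BomanFourier

end Colombeau

end

noncomputable section

namespace Colombeau

/-! ### Completeness of the Schwartz space -/

section SchwartzComplete

variable {E F : Type*} [NormedAddCommGroup E] [NormedSpace ℝ E] [NormedAddCommGroup F]
  [NormedSpace ℝ F]

theorem iteratedFDeriv_schwartz_sub (f g : 𝓢(E, F)) (l : ℕ) (x : E) :
    iteratedFDeriv ℝ l (f - g) x = iteratedFDeriv ℝ l f x - iteratedFDeriv ℝ l g x := by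
  have h : ((f - g : 𝓢(E, F)) : E → F) = (f : E → F) - g := rfl
  rw [h, iteratedFDeriv_sub_apply (f.smooth l).contDiffAt (g.smooth l).contDiffAt]

/-- Along a Cauchy filter every derivative converges pointwise to some `u l`, uniformly even after
multiplication by any `‖x‖ ^ k`. Uniform convergence makes `u (l + 1)` the derivative of `u l`, so
`u 0` is a Schwartz function with derivatives `u l` and is the limit in all seminorms. -/
theorem completeSpace_schwartz [CompleteSpace F] : CompleteSpace 𝓢(E, F) := by
  refine ⟨@fun G hG => ?_⟩
  have := hG.1
  have hC : ∀ k l : ℕ, ∀ ε > 0, ∀ᶠ q : 𝓢(E, F) × 𝓢(E, F) in G ×ˢ G,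
      SchwartzMap.seminorm ℝ k l (q.1 - q.2) < ε := by
    intro k l ε hε
    have h1 := ((schwartz_withSeminorms ℝ E F).tendsto_nhds _ _).1
      ((IsUniformAddGroup.cauchy_iff_tendsto G).1 hG).2 (k, l) ε hε
    simpa using h1
  have hpt : ∀ (l : ℕ) (x : E), ∃ y, Tendsto (fun f : 𝓢(E, F) => iteratedFDeriv ℝ l f x) G (𝓝 y) := by
    intro l x
    refine CompleteSpace.complete ((IsUniformAddGroup.cauchy_map_iff_tendsto _ _).2
      ⟨‹_›, Metric.tendsto_nhds.2 fun ε hε => ?_⟩)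
    filter_upwards [hC 0 l ε hε] with q hq
    rw [dist_zero_right, ← iteratedFDeriv_schwartz_sub]
    exact (norm_iteratedFDeriv_le_seminorm ℝ (q.1 - q.2) l x).trans_lt hq
  choose u hu using hpt
  have hB : ∀ k l : ℕ, ∀ ε > 0, ∀ᶠ f : 𝓢(E, F) in G, ∀ x : E,
      ‖x‖ ^ k * ‖iteratedFDeriv ℝ l f x - u l x‖ ≤ ε := by
    intro k l ε hε
    -- With `f` fixed, the second member of the Cauchy estimate goes to its limit, which turns `<`
    -- into `≤`.
    filter_upwards [(hC k l ε hε).curry] with f hf x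
    have h1 : Tendsto (fun g : 𝓢(E, F) => ‖x‖ ^ k * ‖iteratedFDeriv ℝ l f x -
        iteratedFDeriv ℝ l g x‖) G (𝓝 (‖x‖ ^ k * ‖iteratedFDeriv ℝ l f x - u l x‖)) :=
      ((hu l x).const_sub _).norm.const_mul _
    refine le_of_tendsto h1 ?_
    filter_upwards [hf] with g hg
    rw [← iteratedFDeriv_schwartz_sub]
    exact (le_seminorm ℝ k l (f - g) x).trans hg.le
  have hU : ∀ l : ℕ, TendstoUniformly (fun (f : 𝓢(E, F)) x => iteratedFDeriv ℝ l f x) (u l) G := by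
    intro l
    refine Metric.tendstoUniformly_iff.2 fun ε hε => ?_
    filter_upwards [hB 0 l (ε / 2) (half_pos hε)] with f hf x
    rw [dist_comm, dist_eq_norm]
    have := hf x
    rw [pow_zero, one_mul] at this
    linarith
  have hderiv : ∀ (l : ℕ) (x : E), HasFDerivAt (u l) (u (l + 1) x).curryLeft x := by
    intro l
    refine hasFDerivAt_of_tendstoUniformly (l := G)
      (f := fun (f : 𝓢(E, F)) x => iteratedFDeriv ℝ l f x)
      (f' := fun (f : 𝓢(E, F)) x => (iteratedFDeriv ℝ (l + 1) f x).curryLeft)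
      ?_ (fun f x => ?_) (hu l)
    · exact (continuousMultilinearCurryLeftEquiv ℝ (fun _ : Fin (l + 1) => E)
        F).isometry.uniformContinuous.comp_tendstoUniformly (hU (l + 1))
    · have h1 := (f.smooth (l + 1 : ℕ)).differentiable_iteratedFDeriv (m := l)
        (by exact_mod_cast Nat.lt_succ_self l) x
      have h2 := h1.hasFDerivAt
      rw [fderiv_iteratedFDeriv] at h2
      exact h2
  have hT : HasFTaylorSeriesUpTo (⊤ : ℕ∞) (fun x => (u 0 x).curry0) fun x l => u l x :=
    ⟨fun x => rfl, fun m _ x => hderiv m x, fun m _ =>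
      continuous_iff_continuousAt.2 fun x => (hderiv m x).continuousAt⟩
  have hiter : ∀ l x, iteratedFDeriv ℝ l (fun x => (u 0 x).curry0) x = u l x := fun l x =>
    (hT.eq_iteratedFDeriv (by exact_mod_cast le_top) x).symm
  -- A single `f` at weighted distance at most `1` from the limit provides the required decay of `u
  -- l`.
  let ψ : 𝓢(E, F) := ⟨fun x => (u 0 x).curry0, hT.contDiff, fun k l => by
    obtain ⟨f, hf⟩ := (hB k l 1 one_pos).exists
    refine ⟨SchwartzMap.seminorm ℝ k l f + 1, fun x => ?_⟩
    rw [hiter]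
    calc ‖x‖ ^ k * ‖u l x‖
        ≤ ‖x‖ ^ k * (‖iteratedFDeriv ℝ l f x‖ + ‖iteratedFDeriv ℝ l f x - u l x‖) := by
          gcongr
          exact norm_le_insert _ _
      _ ≤ _ := by
          rw [mul_add]
          exact add_le_add (le_seminorm ℝ k l f x) (hf x)⟩
  refine ⟨ψ, ((schwartz_withSeminorms ℝ E F).tendsto_nhds id ψ).2 fun ⟨k, l⟩ ε hε => ?_⟩
  filter_upwards [hB k l (ε / 2) (half_pos hε)] with f hf
  refine lt_of_le_of_lt (seminorm_le_bound ℝ k l _ (half_pos hε).le fun x => ?_) (half_lt_self hε)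
  rw [id, iteratedFDeriv_schwartz_sub]
  exact (hiter l x).symm ▸ hf x

end SchwartzComplete

/-! ### Smooth maps into complete locally convex spaces -/

/-- Every seminorm is the norm of a linear map to a Banach space. -/
theorem exists_banach_of_seminorm.{u} {Y : Type u} [AddCommGroup Y] [Module ℂ Y]
    (p : Seminorm ℂ Y) :
    ∃ (E : Type u) (_ : NormedAddCommGroup E) (_ : NormedSpace ℂ E) (_ : CompleteSpace E)
      (J : Y →ₗ[ℂ] E), ∀ y, ‖J y‖ = p y := by
  let _ : SeminormedAddCommGroup Y := p.toAddGroupSeminorm.toSeminormedAddCommGroup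
  let _ : NormedSpace ℂ Y := { norm_smul_le := fun a y => (map_smul_eq_mul p a y).le }
  exact ⟨UniformSpace.Completion Y, inferInstance, inferInstance, inferInstance,
    (UniformSpace.Completion.toComplₗᵢ (𝕜 := ℂ) (E := Y)).toLinearMap,
    fun y => UniformSpace.Completion.norm_coe y⟩

end Colombeau

end

noncomputable section

namespace Colombeau

/-! ### Differential calculus for smooth maps into `𝒮` -/

section Differential

set_option linter.unusedSectionVars false

variable {n : ℕ} {X : Type*} [AddCommGroup X] [Module ℝ X] [TopologicalSpace X]
  [IsTopologicalAddGroup X] [ContinuousSMul ℝ X]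

/-- Each Schwartz seminorm is `‖J ·‖` for a continuous linear `J` into a Banach space. Questions
about `𝒮` thereby become Banach-valued ones, to which Boman's theorem applies. -/
theorem tendsto_of_forall_banach {α : Type*} {u : α → Sch n} {l : Filter α} {y : Sch n}
    (h : ∀ (E : Type) [NormedAddCommGroup E] [NormedSpace ℂ E] [CompleteSpace E]
      (J : Sch n →L[ℂ] E), Tendsto (fun a => J (u a)) l (𝓝 (J y))) : Tendsto u l (𝓝 y) := by
  refine ((schwartz_withSeminorms ℂ (Eucl n) ℂ).tendsto_nhds u y).2 fun i ε hε => ?_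
  obtain ⟨E, _, _, _, J, hJ⟩ := exists_banach_of_seminorm (schwartzSeminormFamily ℂ (Eucl n) ℂ i)
  have hc : Continuous J := by
    refine continuous_of_continuousAt_zero J ?_
    rw [ContinuousAt, map_zero, tendsto_zero_iff_norm_tendsto_zero]
    simp only [hJ]
    exact ((schwartz_withSeminorms ℂ (Eucl n) ℂ).continuous_seminorm i).tendsto' _ _ (map_zero _)
  have h1 := (Metric.tendsto_nhds.1 (h E ⟨J, hc⟩)) ε hε
  filter_upwards [h1] with a ha
  have h2 : dist (J (u a)) (J y) < ε := ha
  rwa [dist_eq_norm, ← map_sub, hJ] at h2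

theorem eq_of_forall_banach {x y : Sch n}
    (h : ∀ (E : Type) [NormedAddCommGroup E] [NormedSpace ℂ E] [CompleteSpace E]
      (J : Sch n →L[ℂ] E), J x = J y) : x = y := by
  have h1 : Tendsto (fun _ : ℕ => x) atTop (𝓝 y) := tendsto_of_forall_banach
    fun E _ _ _ J => by rw [← h E J]; exact tendsto_const_nhds
  exact tendsto_nhds_unique tendsto_const_nhds h1

/-- A curve in `𝒮` is smooth as soon as its images in Banach spaces are smooth. -/
theorem isSmoothCurve_of_forall_banach {c : ℝ → Sch n}
    (h : ∀ (E : Type) [NormedAddCommGroup E] [NormedSpace ℂ E] [CompleteSpace E]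
      (J : Sch n →L[ℂ] E), ContDiff ℝ (⊤ : ℕ∞) fun t => J (c t)) : IsSmoothCurve c := by
  have : CompleteSpace (Sch n) := completeSpace_schwartz
  refine IsSmoothCurve.coinduction (fun c : ℝ → Sch n => ∀ (E : Type) [NormedAddCommGroup E]
    [NormedSpace ℂ E] [CompleteSpace E] (J : Sch n →L[ℂ] E), ContDiff ℝ (⊤ : ℕ∞) fun t => J (c t))
    (fun c h => ?_) h
  have hJ : ∀ (E : Type) [NormedAddCommGroup E] [NormedSpace ℂ E] [CompleteSpace E]
      (J : Sch n →L[ℂ] E) (t : ℝ), Tendsto (fun s : ℝ => J (s⁻¹ • (c (t + s) - c t))) (𝓝[≠] 0)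
        (𝓝 (deriv (fun t => J (c t)) t)) := by
    intro E _ _ _ J t
    refine (hasDerivAt_iff_tendsto_slope_zero.1 (hasDerivAt_of_contDiff_infty (h E J) t)).congr
      fun s => ?_
    rw [← map_sub, J.map_smul_of_tower]
  have hex : ∀ t, ∃ v, HasCurveDerivAt c v t := by
    intro t
    -- The difference quotients converge after every `J`, so their differences tend to `0` in `𝒮`.
    -- They form a Cauchy filter, and completeness supplies the derivative.
    refine CompleteSpace.complete ((IsUniformAddGroup.cauchy_map_iff_tendsto _ _).2
      ⟨inferInstance, tendsto_of_forall_banach fun E _ _ _ J => ?_⟩)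
    have h1 := ((hJ E J t).comp tendsto_fst).sub ((hJ E J t).comp (tendsto_snd (f := 𝓝[≠] 0)))
    rw [sub_self] at h1
    rw [map_zero]
    exact h1.congr fun q => (map_sub J _ _).symm
  choose c' hc' using hex
  refine ⟨c', fun E _ _ _ J => ?_, hc'⟩
  have h1 : (fun t => J (c' t)) = deriv fun t => J (c t) := by
    ext t
    exact tendsto_nhds_unique ((J.continuous.tendsto _).comp (hc' t)) (hJ E J t)
  rw [h1]
  exact (contDiff_infty_iff_deriv.1 (h E J)).2

/-- Boman's theorem for a smooth map restricted to a finite-dimensional family. -/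
theorem IsSmoothMap.contDiff_comp {V : Type*} [NormedAddCommGroup V] [InnerProductSpace ℝ V]
    [FiniteDimensional ℝ V] {f : X → Sch n} (hf : IsSmoothMap f) {F : V → X}
    (hF : ∀ γ : ℝ → V, ContDiff ℝ (⊤ : ℕ∞) γ → IsSmoothCurve fun t => F (γ t))
    {E : Type*} [NormedAddCommGroup E] [NormedSpace ℂ E] [CompleteSpace E] (J : Sch n →L[ℂ] E) :
    ContDiff ℝ (⊤ : ℕ∞) fun z => J (f (F z)) := by
  let _ : MeasurableSpace V := borel V
  have : BorelSpace V := ⟨rfl⟩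
  refine AlongCurves.contDiff fun γ hγ => isSmoothCurve_iff_contDiff.1 ?_
  exact (hf _ (hF γ hγ)).clm_comp (J.restrictScalars ℝ)

theorem differential_eq {f : X → Sch n} {x v : X} {y : Sch n}
    (h : HasCurveDerivAt (fun t : ℝ => f (x + t • v)) y 0) : differential f x v = y :=
  Tendsto.limUnder_eq (h.congr fun s => by simp)

/-- Lines are smooth curves, so for a smooth map the limit defining `differential` exists and the
default value of `limUnder` never enters. -/
theorem IsSmoothMap.hasCurveDerivAt_line {f : X → Sch n} (hf : IsSmoothMap f) (x v : X) :
    HasCurveDerivAt (fun t : ℝ => f (x + t • v)) (differential f x v) 0 := by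
  obtain ⟨d, hd, hd'⟩ := hf _ (isSmoothCurve_line x v)
  have h1 : HasCurveDerivAt (fun t : ℝ => f (x + t • v)) (d 1 0) 0 := hd ▸ hd' 0 0
  rwa [differential_eq h1]

/-- The bridge to finite dimensions: seen through a family `F` and a map `J`, the differential is a
directional derivative of a Banach-valued function on `V`, where ordinary calculus is available. -/
theorem IsSmoothMap.apply_differential {V : Type*} [NormedAddCommGroup V]
    [NormedSpace ℝ V] {f : X → Sch n} (hf : IsSmoothMap f) {F : V → X}
    {E : Type*} [NormedAddCommGroup E] [NormedSpace ℂ E] (J : Sch n →L[ℂ] E) {z e : V} {x v : X}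
    (hd : DifferentiableAt ℝ (fun z => J (f (F z))) z) (hl : ∀ t : ℝ, F (z + t • e) = x + t • v) :
    J (differential f x v) = fderiv ℝ (fun z => J (f (F z))) z e := by
  have h1 : HasDerivAt (fun t : ℝ => J (f (F (z + t • e)))) (J (differential f x v)) 0 := by
    simp only [hl]
    exact hasCurveDerivAt_iff_hasDerivAt.1
      ((hf.hasCurveDerivAt_line x v).clm_comp (J.restrictScalars ℝ))
  exact h1.unique (hd.hasFDerivAt.hasLineDerivAt e)

/-- The differential of a smooth map is smooth. -/
theorem IsSmoothMap.isSmoothMap_differential {f : X → Sch n} (hf : IsSmoothMap f) :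
    IsSmoothMap fun q : X × X => differential f q.1 q.2 := by
  intro c hc
  have h1 : IsSmoothCurve fun t => (c t).1 := hc.clm_comp (ContinuousLinearMap.fst ℝ X X)
  have h2 : IsSmoothCurve fun t => (c t).2 := hc.clm_comp (ContinuousLinearMap.snd ℝ X X)
  refine isSmoothCurve_of_forall_banach fun E _ _ _ J => ?_
  -- On the surface `(s, r) ↦ x(s) + r v(s)`, where `(x, v)` is the given curve, `df(x(t))(v(t))` is
  -- the `r`-derivative at `(t, 0)`. This is smooth in `t` because `f` is jointly smooth on the
  -- surface.
  let F : EuclideanSpace ℝ (Fin 2) → X := fun z => (c (z 0)).1 + z 1 • (c (z 0)).2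
  have hF : ContDiff ℝ (⊤ : ℕ∞) fun z => J (f (F z)) := by
    refine hf.contDiff_comp (fun γ hγ => ?_) J
    have hγi : ∀ i, ContDiff ℝ (⊤ : ℕ∞) fun t => γ t i := fun i =>
      (EuclideanSpace.proj (𝕜 := ℝ) i).contDiff.comp hγ
    exact (h1.comp (hγi 0)).add (h2.smul_comp (hγi 1) (hγi 0))
  let e : Fin 2 → EuclideanSpace ℝ (Fin 2) := fun i => EuclideanSpace.single i 1
  have h3 : (fun t => J (differential f (c t).1 (c t).2)) =
      fun t : ℝ => fderiv ℝ (fun z => J (f (F z))) (t • e 0) (e 1) := by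
    ext t
    refine hf.apply_differential J (hF.differentiable (by simp) _) fun s => ?_
    simp [F, e]
  rw [h3]
  exact ((hF.fderiv_right (m := (⊤ : ℕ∞)) (by simp)).comp
    (contDiff_id.smul contDiff_const)).clm_apply contDiff_const

theorem IsSmoothMap.isSmoothMap_differential_right {f : X → Sch n} (hf : IsSmoothMap f) (v : X) :
    IsSmoothMap fun x => differential f x v :=
  fun c hc => hf.isSmoothMap_differential (fun t => (c t, v)) (hc.prodMk (isSmoothCurve_const v))

/-- Additivity is not visible from limits along single lines. On the plane `x + ℝ v + ℝ w` Boman's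
theorem provides a Fréchet derivative, which is linear. -/
theorem IsSmoothMap.differential_add {f : X → Sch n} (hf : IsSmoothMap f) (x v w : X) :
    differential f x (v + w) =
      differential f x v + differential f x w := by
  refine eq_of_forall_banach fun E _ _ _ J => ?_
  let F : EuclideanSpace ℝ (Fin 2) → X := fun z => x + (z 0 • v + z 1 • w)
  have hF : ContDiff ℝ (⊤ : ℕ∞) fun z => J (f (F z)) := by
    refine hf.contDiff_comp (fun γ hγ => ?_) J
    have hγi : ∀ i, ContDiff ℝ (⊤ : ℕ∞) fun t => γ t i := fun i =>
      (EuclideanSpace.proj (𝕜 := ℝ) i).contDiff.comp hγ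
    exact (isSmoothCurve_const x).add (((isSmoothCurve_const v).smul_comp (hγi 0) contDiff_id).add
      ((isSmoothCurve_const w).smul_comp (hγi 1) contDiff_id))
  let e : Fin 2 → EuclideanSpace ℝ (Fin 2) := fun i => EuclideanSpace.single i 1
  have hd := hF.differentiable (by simp) 0
  rw [map_add, hf.apply_differential J hd (e := e 0 + e 1) (by simp [F, e]),
    hf.apply_differential J hd (x := x) (v := v) (e := e 0) (by simp [F, e]),
    hf.apply_differential J hd (x := x) (v := w) (e := e 1) (by simp [F, e]), map_add]

theorem IsSmoothMap.differential_smul {f : X → Sch n} (hf : IsSmoothMap f) (a : ℝ) (x v : X) :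
    differential f x (a • v) = a • differential f x v := by
  refine differential_eq ?_
  have h1 : HasDerivAt (fun s : ℝ => s * a) a 0 := hasDerivAt_mul_const a
  have h2 := HasCurveDerivAt.comp_hasDerivAt (g := fun s => s * a) (t := 0) (g' := a)
    (by simpa using hf.hasCurveDerivAt_line x v) h1
  simpa [mul_smul] using h2

/-- The iterated differential of `f` along a list of directions; the first entry of the list is
the direction of the last differentiation. -/
def iterDiff (f : X → Sch n) : List X → X → Sch n
  | [] => f
  | v :: vs => fun x => differential (iterDiff f vs) x v

theorem IsSmoothMap.isSmoothMap_iterDiff {f : X → Sch n} (hf : IsSmoothMap f) :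
    ∀ vs : List X, IsSmoothMap (iterDiff f vs)
  | [] => hf
  | v :: vs => (hf.isSmoothMap_iterDiff vs).isSmoothMap_differential_right v

theorem iterDiff_append (f : X → Sch n) (ws : List X) :
    ∀ vs : List X, iterDiff f (vs ++ ws) = iterDiff (iterDiff f ws) vs
  | [] => rfl
  | v :: vs => by
    rw [List.cons_append]
    simp only [iterDiff, iterDiff_append f ws vs]

theorem IsSmoothMap.hasIteratedDifferential {f : X → Sch n} (hf : IsSmoothMap f) :
    ∀ {l : ℕ} (x : X) (v : Fin l → X),
      HasIteratedDifferential l f x v (iterDiff f (List.ofFn v) x)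
  | 0, _, _ => rfl
  | l + 1, x, v => by
    refine ⟨fun t => iterDiff f (List.ofFn (Fin.tail v)) (x + t • v 0),
      fun t => hf.hasIteratedDifferential _ _, ?_⟩
    rw [List.ofFn_succ]
    exact (hf.isSmoothMap_iterDiff _).hasCurveDerivAt_line x (v 0)

theorem HasIteratedDifferential.unique {f : X → Sch n} :
    ∀ {l : ℕ} {x : X} {v : Fin l → X} {y z : Sch n}, HasIteratedDifferential l f x v y →
      HasIteratedDifferential l f x v z → y = z
  | 0, _, _, _, _, hy, hz => hy.symm.trans hz
  | l + 1, _, _, _, _, ⟨g, hg, hy⟩, ⟨g', hg', hz⟩ => by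
    have : g = g' := funext fun t => (hg t).unique (hg' t)
    exact hy.unique (this ▸ hz)

theorem IsSmoothMap.hasIteratedDifferential_iff {f : X → Sch n} (hf : IsSmoothMap f) {l : ℕ}
    {x : X} {v : Fin l → X} {y : Sch n} :
    HasIteratedDifferential l f x v y ↔ iterDiff f (List.ofFn v) x = y :=
  ⟨fun h => (hf.hasIteratedDifferential x v).unique h,
    fun h => h ▸ hf.hasIteratedDifferential x v⟩

/-! ### Rules for iterated differentials -/

theorem iterDiff_add {f g : X → Sch n} (hf : IsSmoothMap f) (hg : IsSmoothMap g) :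
    ∀ vs : List X, iterDiff (f + g) vs = iterDiff f vs + iterDiff g vs
  | [] => rfl
  | v :: vs => by
    ext1 x
    simp only [iterDiff, iterDiff_add hf hg vs]
    exact differential_eq
      (((hf.isSmoothMap_iterDiff vs).hasCurveDerivAt_line x v).add
        ((hg.isSmoothMap_iterDiff vs).hasCurveDerivAt_line x v))

theorem IsSmoothMap.clm_comp {m : ℕ} {f : X → Sch n} (L : Sch n →L[ℝ] Sch m)
    (hf : IsSmoothMap f) : IsSmoothMap fun x => L (f x) :=
  fun c hc => (hf c hc).clm_comp L

theorem iterDiff_clm_comp {m : ℕ} {f : X → Sch n} (L : Sch n →L[ℝ] Sch m) (hf : IsSmoothMap f) :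
    ∀ vs : List X, iterDiff (fun x => L (f x)) vs = fun x => L (iterDiff f vs x)
  | [] => rfl
  | v :: vs => by
    ext1 x
    simp only [iterDiff, iterDiff_clm_comp L hf vs]
    exact differential_eq
      (((hf.isSmoothMap_iterDiff vs).hasCurveDerivAt_line x v).clm_comp L)

variable {Z : Type*} [AddCommGroup Z] [Module ℝ Z] [TopologicalSpace Z]
  [IsTopologicalAddGroup Z] [ContinuousSMul ℝ Z]

theorem IsSmoothMap.comp_clm {f : X → Sch n} (A : Z →L[ℝ] X) (hf : IsSmoothMap f) :
    IsSmoothMap fun z => f (A z) :=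
  fun _ hc => hf _ (hc.clm_comp A)

theorem IsSmoothMap.differential_comp_clm {f : X → Sch n} (A : Z →L[ℝ] X) (hf : IsSmoothMap f)
    (z w : Z) : differential (fun z => f (A z)) z w =
      differential f (A z) (A w) := by
  refine differential_eq ?_
  simpa using hf.hasCurveDerivAt_line (A z) (A w)

theorem iterDiff_comp_clm {f : X → Sch n} (A : Z →L[ℝ] X) (hf : IsSmoothMap f) :
    ∀ vs : List Z, iterDiff (fun z => f (A z)) vs = fun z => iterDiff f (vs.map A) (A z)
  | [] => rfl
  | v :: vs => by
    ext1 z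
    simp only [iterDiff, iterDiff_comp_clm A hf vs, List.map_cons]
    exact (hf.isSmoothMap_iterDiff _).differential_comp_clm A z v

end Differential

end Colombeau

end

noncomputable section

namespace Colombeau

/-! ### Iterated differentials of `x ↦ df(x)(A x)` and of bilinear expressions -/

section LeibnizRules

set_option linter.unusedSectionVars false

variable {n : ℕ} {X : Type*} [AddCommGroup X] [Module ℝ X] [TopologicalSpace X]
  [IsTopologicalAddGroup X] [ContinuousSMul ℝ X] {ι : Type*}

theorem HasCurveDerivAt.list_sum {κ : Type*} {c : κ → ℝ → X} {v : κ → X} {t : ℝ} :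
    ∀ {L : List κ}, (∀ k ∈ L, HasCurveDerivAt (c k) (v k) t) →
      HasCurveDerivAt (fun s => (L.map fun k => c k s).sum) (L.map v).sum t
  | [], _ => by simpa using hasCurveDerivAt_const (0 : X) t
  | k :: L, h => by
    simp only [List.map_cons, List.sum_cons]
    exact (h k (by simp)).add (HasCurveDerivAt.list_sum fun j hj => h j (by simp [hj]))

/-- The last entry of the list is the direction of the first differentiation, and linearity of that
differential survives all later ones. This is what permits differentiation when the last entry
itself moves with the base point. -/
theorem iterDiff_append_add_smul {f : X → Sch n} (hf : IsSmoothMap f) (vs : List X) (u w : X)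
    (t : ℝ) : iterDiff f (vs ++ [u + t • w]) =
      fun x => iterDiff f (vs ++ [u]) x + t • iterDiff f (vs ++ [w]) x := by
  simp only [iterDiff_append]
  have h1 : iterDiff f [u + t • w] = iterDiff f [u] + fun x =>
      (t • ContinuousLinearMap.id ℝ (Sch n)) (iterDiff f [w] x) := by
    ext1 x
    simp only [iterDiff, Pi.add_apply, hf.differential_add, hf.differential_smul]
    rfl
  have hw := hf.isSmoothMap_iterDiff [w]
  rw [h1, iterDiff_add (hf.isSmoothMap_iterDiff [u]) (hw.clm_comp _), iterDiff_clm_comp _ hw]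
  rfl

theorem IsSmoothMap.isSmoothMap_differential_self {f : X → Sch n} (hf : IsSmoothMap f)
    (A : X →L[ℝ] X) : IsSmoothMap fun x => differential f x (A x) :=
  fun c hc => hf.isSmoothMap_differential (fun t => (c t, A (c t))) (hc.prodMk (hc.clm_comp A))

/-- The directions of the lower-order terms in the iterated differential of `x ↦ df(x)(A x)`. -/
def hatTerms (A : ι → ι) : List ι → List (List ι)
  | [] => []
  | i :: is => (is ++ [A i]) :: (hatTerms A is).map (i :: ·)

theorem mem_of_mem_hatTerms {A : ι → ι} {S : Set ι} (hA : ∀ i ∈ S, A i ∈ S) :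
    ∀ {is : List ι}, (∀ i ∈ is, i ∈ S) → ∀ w ∈ hatTerms A is, ∀ j ∈ w, j ∈ S
  | [], _, w, hw => by simp [hatTerms] at hw
  | i :: is, h, w, hw => by
    simp only [hatTerms, List.mem_cons, List.mem_map] at hw
    have hi : i ∈ S := h i (by simp)
    have his : ∀ i ∈ is, i ∈ S := fun j hj => h j (by simp [hj])
    rcases hw with rfl | ⟨w, hw, rfl⟩
    · intro j hj
      rcases List.mem_append.1 hj with hj | hj
      · exact his j hj
      · rw [List.mem_singleton.1 hj]
        exact hA i hi
    · intro j hj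
      rcases List.mem_cons.1 hj with rfl | hj
      · exact hi
      · exact mem_of_mem_hatTerms hA his w hw j hj

/-- Differentiating `iterDiff f (… ++ [A x]) x` along `v i` acts either on the base point, which
lengthens the list, or on the last entry, which replaces `A x` by `A (v i)`. The terms of the second
kind are collected, with their later derivatives, in `hatTerms`. Directions are named by indices so
that the list of terms can be formed once and evaluated for every `ε`. -/
theorem iterDiff_differential_self {f : X → Sch n} (hf : IsSmoothMap f) (A : X →L[ℝ] X)
    {A' : ι → ι} {v : ι → X} (hv : ∀ i, v (A' i) = A (v i)) (is : List ι) :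
    iterDiff (fun x => differential f x (A x)) (is.map v) = fun x =>
      iterDiff f (is.map v ++ [A x]) x +
        ((hatTerms A' is).map fun w => iterDiff f (w.map v) x).sum := by
  induction is with
  | nil =>
    ext1 x
    simp [iterDiff, hatTerms]
  | cons i is ih =>
    ext1 x
    rw [List.map_cons, iterDiff, ih]
    refine differential_eq ?_
    have h1 : ∀ ws : List X, HasCurveDerivAt (fun t : ℝ => iterDiff f ws (x + t • v i))
        (iterDiff f (v i :: ws) x) 0 := fun ws =>
      (hf.isSmoothMap_iterDiff ws).hasCurveDerivAt_line x (v i)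
    have h2 : HasCurveDerivAt
        (fun t : ℝ => iterDiff f (is.map v ++ [A (x + t • v i)]) (x + t • v i))
        (iterDiff f (v i :: (is.map v ++ [A x])) x + iterDiff f (is.map v ++ [A (v i)]) x) 0 := by
      have h3 := (h1 (is.map v ++ [A x])).add
        (HasCurveDerivAt.smul (hasDerivAt_id (0 : ℝ)) (h1 (is.map v ++ [A (v i)])))
      simpa [iterDiff_append_add_smul hf] using h3
    have h5 := HasCurveDerivAt.list_sum (L := hatTerms A' is) (t := 0)
      (c := fun w t => iterDiff f (w.map v) (x + t • v i))
      (v := fun w => iterDiff f (v i :: w.map v) x) fun w _ => by simpa using h1 (w.map v)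
    have h4 := h2.add h5
    convert h4 using 1
    simp only [hatTerms, List.map_cons, List.sum_cons, List.map_append, List.map_nil, hv,
      List.map_map, Function.comp_def, List.cons_append, iterDiff, add_assoc]

section Bilinear

variable {B : Sch n →ₗ[ℝ] Sch n →ₗ[ℝ] Sch n} (hB : Continuous fun q : Sch n × Sch n => B q.1 q.2)
include hB

theorem HasCurveDerivAt.bilin {c d : ℝ → Sch n} {v w : Sch n} {t : ℝ}
    (hc : HasCurveDerivAt c v t) (hd : HasCurveDerivAt d w t) :
    HasCurveDerivAt (fun s => B (c s) (d s)) (B v (d t) + B (c t) w) t := by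
  have h1 : Tendsto (fun s => d (t + s)) (𝓝[≠] 0) (𝓝 (d t)) :=
    hd.tendsto.mono_left nhdsWithin_le_nhds
  have h2 := (hB.tendsto (v, d t)).comp (Tendsto.prodMk_nhds hc h1)
  have h3 := (hB.tendsto (c t, w)).comp (tendsto_const_nhds.prodMk_nhds hd)
  refine (h2.add h3).congr fun s => ?_
  simp only [Function.comp_apply, map_smul, map_sub, LinearMap.smul_apply, LinearMap.sub_apply]
  rw [← smul_add]
  congr 1
  abel

theorem IsSmoothMap.bilin {f g : X → Sch n} (hf : IsSmoothMap f) (hg : IsSmoothMap g) :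
    IsSmoothMap fun x => B (f x) (g x) := by
  intro c hc
  -- The product rule expresses the derivative of such a curve as a sum of two others, so the
  -- additive closure of `S` is stable under differentiation.
  let S : Set (ℝ → Sch n) := {e | ∃ c d : ℝ → Sch n, IsSmoothCurve c ∧ IsSmoothCurve d ∧
    e = fun t => B (c t) (d t)}
  refine IsSmoothCurve.coinduction (fun e => e ∈ AddSubmonoid.closure S) (fun e he => ?_)
    (AddSubmonoid.subset_closure ⟨_, _, hf c hc, hg c hc, rfl⟩)
  induction he using AddSubmonoid.closure_induction with
  | mem e he =>
    obtain ⟨c, d, hc, hd, rfl⟩ := he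
    obtain ⟨c', hc', hcc'⟩ := hc.exists_deriv
    obtain ⟨d', hd', hdd'⟩ := hd.exists_deriv
    exact ⟨(fun t => B (c' t) (d t)) + fun t => B (c t) (d' t),
      add_mem (AddSubmonoid.subset_closure ⟨_, _, hc', hd, rfl⟩)
        (AddSubmonoid.subset_closure ⟨_, _, hc, hd', rfl⟩),
      fun t => HasCurveDerivAt.bilin hB (hcc' t) (hdd' t)⟩
  | zero => exact ⟨0, zero_mem _, fun t => hasCurveDerivAt_const 0 t⟩
  | add d e _ _ hd he =>
    obtain ⟨d', hd', hdd'⟩ := hd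
    obtain ⟨e', he', hee'⟩ := he
    exact ⟨d' + e', add_mem hd' he', fun t => (hdd' t).add (hee' t)⟩

omit hB in
/-- All ways of distributing the entries of a list over two lists. -/
def splits : List ι → List (List ι × List ι)
  | [] => [([], [])]
  | i :: is => (splits is).map (fun q => (i :: q.1, q.2)) ++
      (splits is).map fun q => (q.1, i :: q.2)

omit hB in
theorem mem_of_mem_splits {S : Set ι} : ∀ {is : List ι}, (∀ i ∈ is, i ∈ S) →
    ∀ q ∈ splits is, (∀ j ∈ q.1, j ∈ S) ∧ ∀ j ∈ q.2, j ∈ S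
  | [], _, q, hq => by
    rw [splits, List.mem_singleton] at hq
    simp [hq]
  | i :: is, h, q, hq => by
    have hi : i ∈ S := h i (by simp)
    have ih := mem_of_mem_splits (is := is) fun j hj => h j (by simp [hj])
    simp only [splits, List.mem_append, List.mem_map] at hq
    rcases hq with ⟨r, hr, rfl⟩ | ⟨r, hr, rfl⟩
    · refine ⟨fun j hj => ?_, (ih r hr).2⟩
      rcases List.mem_cons.1 hj with rfl | hj
      exacts [hi, (ih r hr).1 j hj]
    · refine ⟨(ih r hr).1, fun j hj => ?_⟩
      rcases List.mem_cons.1 hj with rfl | hj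
      exacts [hi, (ih r hr).2 j hj]

/-- The Leibniz rule for iterated differentials. -/
theorem iterDiff_bilin {f g : X → Sch n} (hf : IsSmoothMap f) (hg : IsSmoothMap g) (v : ι → X)
    (is : List ι) : iterDiff (fun x => B (f x) (g x)) (is.map v) = fun x =>
      ((splits is).map fun q => B (iterDiff f (q.1.map v) x) (iterDiff g (q.2.map v) x)).sum := by
  induction is with
  | nil =>
    ext1 x
    simp [iterDiff, splits]
  | cons i is ih =>
    ext1 x
    rw [List.map_cons, iterDiff, ih]
    refine differential_eq ?_
    have h1 := HasCurveDerivAt.list_sum (L := splits is) (t := 0)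
      (c := fun q t => B (iterDiff f (q.1.map v) (x + t • v i))
        (iterDiff g (q.2.map v) (x + t • v i)))
      (v := fun q => B (differential (iterDiff f (q.1.map v)) x (v i)) (iterDiff g (q.2.map v) x) +
        B (iterDiff f (q.1.map v) x) (differential (iterDiff g (q.2.map v)) x (v i))) fun q _ => by
      simpa using HasCurveDerivAt.bilin hB
        ((hf.isSmoothMap_iterDiff (q.1.map v)).hasCurveDerivAt_line x (v i))
        ((hg.isSmoothMap_iterDiff (q.2.map v)).hasCurveDerivAt_line x (v i))
    convert h1 using 1
    simp [splits, iterDiff, List.sum_map_add, Function.comp_def]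

end Bilinear

end LeibnizRules

end Colombeau

end

noncomputable section

namespace Colombeau

/-! ### The product of Schwartz functions -/

section Product

variable {n : ℕ}

/-- The pointwise product on `𝒮` as a bilinear map. -/
def mulBilin (n : ℕ) : Sch n →ₗ[ℝ] Sch n →ₗ[ℝ] Sch n :=
  LinearMap.mk₂ ℝ (fun f g => pairing (ContinuousLinearMap.mul ℂ ℂ) f g)
    (fun f g h => by ext; simp) (fun c f g => by ext; simp)
    (fun f g h => by ext; simp) (fun c f g => by ext; simp)

theorem mulBilin_apply_apply (f g : Sch n) (x : Eucl n) : mulBilin n f g x = f x * g x := rfl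

/-- In the Leibniz formula the weight `‖x‖ ^ k` is given to the first factor alone, and the second
is estimated without weight. The constant `2 ^ l` is the sum of the binomial coefficients. -/
theorem seminorm_mulBilin_le (k l : ℕ) (f g : Sch n) :
    SchwartzMap.seminorm ℂ k l (mulBilin n f g) ≤
      2 ^ l * ((Finset.Iic (k, l)).sup (schwartzSeminormFamily ℂ (Eucl n) ℂ) f *
        (Finset.Iic (k, l)).sup (schwartzSeminormFamily ℂ (Eucl n) ℂ) g) := by
  set P := (Finset.Iic (k, l)).sup (schwartzSeminormFamily ℂ (Eucl n) ℂ)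
  have hP : ∀ i j, i ≤ k → j ≤ l → ∀ h : Sch n, SchwartzMap.seminorm ℂ i j h ≤ P h :=
    fun i j hi hj h => by
      have : schwartzSeminormFamily ℂ (Eucl n) ℂ (i, j) ≤ P :=
        Finset.le_sup (f := schwartzSeminormFamily ℂ (Eucl n) ℂ)
          (Finset.mem_Iic.2 (Prod.mk_le_mk.2 ⟨hi, hj⟩))
      exact this h
  refine seminorm_le_bound ℂ k l _ (by positivity) fun x => ?_
  have h1 : ‖iteratedFDeriv ℝ l (mulBilin n f g) x‖ ≤ ∑ i ∈ Finset.range (l + 1),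
      (l.choose i : ℝ) * ‖iteratedFDeriv ℝ i f x‖ * ‖iteratedFDeriv ℝ (l - i) g x‖ :=
    norm_iteratedFDeriv_mul_le (f.smooth l) (g.smooth l) x (n := l) le_rfl
  calc ‖x‖ ^ k * ‖iteratedFDeriv ℝ l (mulBilin n f g) x‖
      ≤ ‖x‖ ^ k * ∑ i ∈ Finset.range (l + 1),
      (l.choose i : ℝ) * ‖iteratedFDeriv ℝ i f x‖ * ‖iteratedFDeriv ℝ (l - i) g x‖ := by gcongr
    _ = ∑ i ∈ Finset.range (l + 1), (l.choose i : ℝ) *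
        ((‖x‖ ^ k * ‖iteratedFDeriv ℝ i f x‖) * ‖iteratedFDeriv ℝ (l - i) g x‖) := by
      rw [Finset.mul_sum]
      exact Finset.sum_congr rfl fun i _ => by ring
    _ ≤ ∑ i ∈ Finset.range (l + 1), (l.choose i : ℝ) * (P f * P g) := by
      refine Finset.sum_le_sum fun i hi => ?_
      have hi' : i ≤ l := Nat.lt_succ_iff.1 (Finset.mem_range.1 hi)
      gcongr
      · exact (le_seminorm ℂ k i f x).trans (hP k i le_rfl hi' f)
      · exact (norm_iteratedFDeriv_le_seminorm ℂ g _ x).trans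
          (hP 0 _ (Nat.zero_le _) (Nat.sub_le _ _) g)
    _ = _ := by
      rw [← Finset.sum_mul]
      congr 1
      exact_mod_cast Nat.sum_range_choose l

theorem exists_seminorm_mulBilin_le (p : Seminorm ℂ (Sch n)) (hp : Continuous p) :
    ∃ (C : ℝ) (q : Seminorm ℂ (Sch n)), 0 ≤ C ∧ Continuous q ∧
      ∀ f g, p (mulBilin n f g) ≤ C * (q f * q g) := by
  obtain ⟨s, C, -, hC⟩ := Seminorm.bound_of_continuous (schwartz_withSeminorms ℂ (Eucl n) ℂ) p hp
  -- The componentwise supremum of the indices in `s`: the seminorm `q` built from it controls both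
  -- factors for every index that occurs.
  let K : ℕ × ℕ := s.sup id
  let q := (Finset.Iic K).sup (schwartzSeminormFamily ℂ (Eucl n) ℂ)
  refine ⟨C * 2 ^ K.2, q, by positivity, ?_, fun f g => ?_⟩
  · exact Seminorm.continuous_finsetSup fun i _ =>
      (schwartz_withSeminorms ℂ (Eucl n) ℂ).continuous_seminorm i
  · refine (hC _).trans ?_
    rw [smul_apply, NNReal.smul_def, smul_eq_mul, mul_assoc]
    gcongr
    refine Seminorm.finset_sup_apply_le (by positivity) fun ⟨k, l⟩ hkl => ?_
    have hK : (k, l) ≤ K := Finset.le_sup (f := id) hkl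
    have hq : ∀ h : Sch n, (Finset.Iic (k, l)).sup (schwartzSeminormFamily ℂ (Eucl n) ℂ) h ≤ q h :=
      fun h => Seminorm.le_def.1 (Finset.sup_mono (Finset.Iic_subset_Iic.2 hK)) h
    refine (seminorm_mulBilin_le k l f g).trans ?_
    gcongr
    · exact one_le_two
    · exact hK.2
    · exact hq f
    · exact hq g

theorem continuous_mulBilin : Continuous fun q : Sch n × Sch n => mulBilin n q.1 q.2 := by
  rw [continuous_iff_continuousAt]
  rintro ⟨f, g⟩
  refine ((schwartz_withSeminorms ℂ (Eucl n) ℂ).tendsto_nhds _ _).2 fun i ε hε => ?_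
  obtain ⟨C, q, hC, hq, h⟩ := exists_seminorm_mulBilin_le _
    ((schwartz_withSeminorms ℂ (Eucl n) ℂ).continuous_seminorm i)
  have h1 : Tendsto (fun r : Sch n × Sch n => C * (q (r.1 - f) * q r.2) +
      C * (q f * q (r.2 - g))) (𝓝 (f, g)) (𝓝 0) := by
    have : Continuous fun r : Sch n × Sch n => C * (q (r.1 - f) * q r.2) +
      C * (q f * q (r.2 - g)) := by fun_prop
    exact this.tendsto' _ _ (by simp)
  filter_upwards [(tendsto_order.1 h1).2 ε hε] with r hr
  refine lt_of_le_of_lt ?_ hr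
  have h2 : mulBilin n r.1 r.2 - mulBilin n f g =
      mulBilin n (r.1 - f) r.2 + mulBilin n f (r.2 - g) := by
    simp only [map_sub, LinearMap.sub_apply]
    abel
  change schwartzSeminormFamily ℂ (Eucl n) ℂ i (mulBilin n r.1 r.2 - mulBilin n f g) ≤ _
  rw [h2]
  exact (map_add_le_add _ _ _).trans (add_le_add (h _ _) (h _ _))

end Product

/-! ### Moderate and negligible nets -/

section Nets

variable {n : ℕ}

/-- Nets in `𝒮` of at most polynomial growth in `1/ε`. -/
def moderateNets (n : ℕ) : AddSubgroup (Par → Sch n) where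
  carrier := {y | ∀ p : Seminorm ℂ (Sch n), Continuous p →
    ∃ N : ℕ, (fun ε => p (y ε)) =O[toZero] fun ε => (ε : ℝ)⁻¹ ^ N}
  zero_mem' := fun p _ => ⟨0, (isBigO_zero _ _).congr_left fun _ => (map_zero p).symm⟩
  add_mem' := by
    intro y z hy hz p hp
    obtain ⟨N, hN⟩ := hy p hp
    obtain ⟨M, hM⟩ := hz p hp
    have hmono : ∀ {a b : ℕ}, a ≤ b → (fun ε : Par => (ε : ℝ)⁻¹ ^ a) =O[toZero]
        fun ε => (ε : ℝ)⁻¹ ^ b := fun {a b} hab => IsBigO.of_norm_le fun ε => by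
      have h1 : (1 : ℝ) ≤ (ε : ℝ)⁻¹ := (one_le_inv₀ ε.2.1).2 ε.2.2
      rw [Real.norm_of_nonneg (by positivity)]
      exact pow_le_pow_right₀ h1 hab
    refine ⟨max N M, (IsBigO.of_norm_le fun ε => ?_).trans
      ((hN.trans (hmono (le_max_left N M))).norm_left.add
        (hM.trans (hmono (le_max_right N M))).norm_left)⟩
    simpa [abs_of_nonneg (apply_nonneg p _)] using map_add_le_add p (y ε) (z ε)
  neg_mem' := by
    intro y hy p hp
    simpa using hy p hp

/-- Nets in `𝒮` which decrease faster than any power of `ε`. -/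
def negligibleNets (n : ℕ) : AddSubgroup (Par → Sch n) where
  carrier := {y | ∀ p : Seminorm ℂ (Sch n), Continuous p →
    ∀ m : ℕ, (fun ε => p (y ε)) =O[toZero] fun ε => (ε : ℝ) ^ m}
  zero_mem' := fun p _ _ => (isBigO_zero _ _).congr_left fun _ => (map_zero p).symm
  add_mem' := by
    intro y z hy hz p hp m
    refine (IsBigO.of_norm_le fun ε => ?_).trans ((hy p hp m).norm_left.add (hz p hp m).norm_left)
    simpa [abs_of_nonneg (apply_nonneg p _)] using map_add_le_add p (y ε) (z ε)
  neg_mem' := by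
    intro y hy p hp
    simpa using hy p hp

theorem clm_comp_mem_moderateNets (T : Sch n →L[ℂ] Sch n) {y : Par → Sch n}
    (hy : y ∈ moderateNets n) : (fun ε => T (y ε)) ∈ moderateNets n :=
  fun p hp => hy (p.comp T.toLinearMap) (hp.comp T.continuous)

theorem clm_comp_mem_negligibleNets (T : Sch n →L[ℂ] Sch n) {y : Par → Sch n}
    (hy : y ∈ negligibleNets n) : (fun ε => T (y ε)) ∈ negligibleNets n :=
  fun p hp => hy (p.comp T.toLinearMap) (hp.comp T.continuous)

theorem norm_mulBilin_isBigO {p q : Seminorm ℂ (Sch n)} {C : ℝ}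
    (h : ∀ f g, p (mulBilin n f g) ≤ C * (q f * q g)) (y z : Par → Sch n) :
    (fun ε => p (mulBilin n (y ε) (z ε))) =O[toZero] fun ε => q (y ε) * q (z ε) := by
  refine IsBigO.of_bound C (Eventually.of_forall fun ε => ?_)
  rw [Real.norm_of_nonneg (apply_nonneg _ _), Real.norm_of_nonneg
    (mul_nonneg (apply_nonneg _ _) (apply_nonneg _ _))]
  exact h _ _

theorem mul_mem_moderateNets {y z : Par → Sch n} (hy : y ∈ moderateNets n)
    (hz : z ∈ moderateNets n) : (fun ε => mulBilin n (y ε) (z ε)) ∈ moderateNets n := by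
  intro p hp
  obtain ⟨C, q, -, hq, h⟩ := exists_seminorm_mulBilin_le p hp
  obtain ⟨N, hN⟩ := hy q hq
  obtain ⟨M, hM⟩ := hz q hq
  refine ⟨N + M, (norm_mulBilin_isBigO h y z).trans ?_⟩
  simpa only [pow_add] using hN.mul hM

/-- Decay of order `N + m` absorbs growth of order `N` and leaves `ε ^ m`. This is why negligible
nets absorb products with moderate ones. -/
theorem isBigO_pow_of_mul {f g : Par → ℝ} {N m : ℕ} (hf : f =O[toZero] fun ε => (ε : ℝ)⁻¹ ^ N)
    (hg : g =O[toZero] fun ε => (ε : ℝ) ^ (N + m)) :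
    (fun ε => f ε * g ε) =O[toZero] fun ε => (ε : ℝ) ^ m := by
  refine (hf.mul hg).congr_right fun ε => ?_
  have : (ε : ℝ) ≠ 0 := ε.2.1.ne'
  rw [pow_add, ← mul_assoc, ← mul_pow, inv_mul_cancel₀ this, one_pow, one_mul]

theorem mul_mem_negligibleNets {y z : Par → Sch n} (hy : y ∈ moderateNets n)
    (hz : z ∈ negligibleNets n) : (fun ε => mulBilin n (y ε) (z ε)) ∈ negligibleNets n := by
  intro p hp m
  obtain ⟨C, q, -, hq, h⟩ := exists_seminorm_mulBilin_le p hp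
  obtain ⟨N, hN⟩ := hy q hq
  exact (norm_mulBilin_isBigO h y z).trans (isBigO_pow_of_mul hN (hz q hq (N + m)))

theorem mulBilin_comm (f g : Sch n) : mulBilin n f g = mulBilin n g f := by
  ext x
  simp [mulBilin_apply_apply, mul_comm]

instance : ContinuousSMul ℝ (SmOp n) := IsScalarTower.continuousSMul ℂ

/-- `R` is smooth and all its differentials along test objects are nets in `𝒩`. -/
def DifferentialsIn (𝒩 : AddSubgroup (Par → Sch n)) (R : SmOp n → Sch n) : Prop :=
  IsSmoothMap R ∧ ∀ Φ ∈ testObjects n, ∀ vs : List (Par → SmOp n),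
    (∀ ψ ∈ vs, ψ ∈ zeroTestObjects n) →
      (fun ε => iterDiff R (vs.map fun ψ => ψ ε) (Φ ε)) ∈ 𝒩

/-- For smooth `R` the iterated differential exists and is unique, so the existential in
`DifferentialIsBigO` can be evaluated on `iterDiff`. -/
theorem differentialIsBigO_iff {R : SmOp n → Sch n} (hR : IsSmoothMap R)
    {p : Seminorm ℂ (Sch n)} {l : ℕ} {Φ : Par → SmOp n} {Ψ : Fin l → Par → SmOp n} {r : Par → ℝ} :
    DifferentialIsBigO R p l Φ Ψ r ↔
      (fun ε => p (iterDiff R ((List.ofFn Ψ).map fun ψ => ψ ε) (Φ ε))) =O[toZero] r := by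
  simp only [List.map_ofFn]
  constructor
  · rintro ⟨y, hy, hyr⟩
    refine hyr.congr_left fun ε => ?_
    rw [← hR.hasIteratedDifferential_iff.1 (hy ε)]
    rfl
  · exact fun h => ⟨_, fun ε => hR.hasIteratedDifferential _ _, h⟩

/-- Moderateness and negligibility become one predicate with a subgroup of nets as parameter, so
each linear operation is analysed once for both. -/
theorem mem_moderate_iff {R : SmOp n → Sch n} :
    R ∈ moderate n ↔ DifferentialsIn (moderateNets n) R := by
  constructor
  · rintro ⟨hR, h⟩
    refine ⟨hR, fun Φ hΦ vs hvs p hp => ?_⟩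
    obtain ⟨N, hN⟩ := h p hp vs.length Φ hΦ vs.get fun i => hvs _ (List.get_mem vs i)
    rw [differentialIsBigO_iff hR, List.ofFn_get] at hN
    exact ⟨N, hN⟩
  · rintro ⟨hR, h⟩
    refine ⟨hR, fun p hp l Φ hΦ Ψ hΨ => ?_⟩
    obtain ⟨N, hN⟩ := h Φ hΦ (List.ofFn Ψ)
      (fun ψ hψ => by obtain ⟨i, rfl⟩ := List.mem_ofFn.1 hψ; exact hΨ i) p hp
    exact ⟨N, (differentialIsBigO_iff hR).2 hN⟩

theorem mem_negligible_iff {R : SmOp n → Sch n} :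
    R ∈ negligible n ↔ DifferentialsIn (negligibleNets n) R := by
  constructor
  · rintro ⟨hR, h⟩
    refine ⟨hR, fun Φ hΦ vs hvs p hp m => ?_⟩
    have hN := h p hp vs.length m Φ hΦ vs.get fun i => hvs _ (List.get_mem vs i)
    rwa [differentialIsBigO_iff hR, List.ofFn_get] at hN
  · rintro ⟨hR, h⟩
    refine ⟨hR, fun p hp l m Φ hΦ Ψ hΨ => (differentialIsBigO_iff hR).2 (h Φ hΦ (List.ofFn Ψ)
      (fun ψ hψ => by obtain ⟨i, rfl⟩ := List.mem_ofFn.1 hψ; exact hΨ i) p hp m)⟩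

variable {𝒩 : AddSubgroup (Par → Sch n)}

theorem list_sum_apply (L : List (Par → Sch n)) (ε : Par) :
    L.sum ε = (L.map fun y => y ε).sum :=
  map_list_sum (Pi.evalAddMonoidHom (fun _ : Par => Sch n) ε) L

/-- A complex continuous linear map, regarded as a real one. -/
def realCLM (A : SmOp n →L[ℂ] SmOp n) : SmOp n →L[ℝ] SmOp n := A.restrictScalars ℝ

theorem realCLM_apply (A : SmOp n →L[ℂ] SmOp n) (Φ : SmOp n) : realCLM A Φ = A Φ := rfl

theorem DifferentialsIn.clm_comp {R : SmOp n → Sch n} (hR : DifferentialsIn 𝒩 R)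
    (T : Sch n →L[ℂ] Sch n) (hT : ∀ y ∈ 𝒩, (fun ε => T (y ε)) ∈ 𝒩) :
    DifferentialsIn 𝒩 (compRep T R) := by
  refine ⟨hR.1.clm_comp (T.restrictScalars ℝ), fun Φ hΦ vs hvs => ?_⟩
  have h1 : ∀ vs, iterDiff (compRep T R) vs = fun x => T (iterDiff R vs x) :=
    iterDiff_clm_comp (T.restrictScalars ℝ) hR.1
  simp only [h1]
  exact hT _ (hR.2 Φ hΦ vs hvs)

/-- By the chain rule with a linear inner map, the differentials of `R ∘ A` along given test objects
are those of `R` along their images under `A`. -/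
theorem DifferentialsIn.comp_clm {R : SmOp n → Sch n} (hR : DifferentialsIn 𝒩 R)
    (A : SmOp n →L[ℂ] SmOp n)
    (hA : ∀ Φ ∈ testObjects n, (fun ε => A (Φ ε)) ∈ testObjects n)
    (hA0 : ∀ Φ ∈ zeroTestObjects n, (fun ε => A (Φ ε)) ∈ zeroTestObjects n) :
    DifferentialsIn 𝒩 fun Φ => R (A Φ) := by
  have hs : IsSmoothMap fun Φ => R (realCLM A Φ) :=
    IsSmoothMap.comp_clm (X := SmOp n) (Z := SmOp n) (realCLM A) hR.1
  refine ⟨hs, fun Φ hΦ vs hvs => ?_⟩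
  have h1 : ∀ vs, iterDiff (fun Φ => R (realCLM A Φ)) vs =
      fun x => iterDiff R (vs.map (realCLM A)) (realCLM A x) :=
    iterDiff_comp_clm (X := SmOp n) (Z := SmOp n) (realCLM A) hR.1
  change ∀ vs, iterDiff (fun Φ => R (A Φ)) vs =
    fun x => iterDiff R (vs.map fun Φ => A Φ) (A x) at h1
  have h2 := hR.2 _ (hA Φ hΦ) (vs.map fun ψ ε => A (ψ ε)) fun ψ hψ => by
    obtain ⟨φ, hφ, rfl⟩ := List.mem_map.1 hψ
    exact hA0 φ (hvs φ hφ)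
  simpa only [h1, List.map_map, Function.comp_def] using h2

/-- Every term of `iterDiff_differential_self` is an iterated differential of `R` at `Φ`. Its
directions are the given ones, their images under `A`, or `A Φ`, and all of these are `0`-test
objects by `hA` and `hA0`. -/
theorem DifferentialsIn.differential_self {R : SmOp n → Sch n} (hR : DifferentialsIn 𝒩 R)
    (A : SmOp n →L[ℂ] SmOp n)
    (hA : ∀ Φ ∈ testObjects n, (fun ε => A (Φ ε)) ∈ zeroTestObjects n)
    (hA0 : ∀ Φ ∈ zeroTestObjects n, (fun ε => A (Φ ε)) ∈ zeroTestObjects n) :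
    DifferentialsIn 𝒩 fun Φ => differential R Φ (A Φ) := by
  have hs : IsSmoothMap fun Φ => differential R Φ (realCLM A Φ) :=
    hR.1.isSmoothMap_differential_self (realCLM A)
  refine ⟨hs, fun Φ hΦ vs hvs => ?_⟩
  -- The indices are whole nets and `v` is evaluation at `ε`, so `hatTerms` is a list of lists of
  -- nets independent of `ε`.
  have h1 : ∀ (vs : List (Par → SmOp n)) (ε : Par),
      iterDiff (fun Φ => differential R Φ (realCLM A Φ)) (vs.map fun ψ => ψ ε) =
      fun x => iterDiff R (vs.map (fun ψ => ψ ε) ++ [realCLM A x]) x +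
        ((hatTerms (fun ψ ε => A (ψ ε)) vs).map fun w => iterDiff R (w.map fun ψ => ψ ε) x).sum :=
    fun vs ε => iterDiff_differential_self hR.1 (realCLM A)
      (A' := fun (ψ : Par → SmOp n) ε => A (ψ ε)) (v := fun ψ => ψ ε) (fun ψ => rfl) vs
  simp only [realCLM_apply] at h1
  simp only [h1]
  have h2 := hR.2 Φ hΦ (vs ++ [fun ε => A (Φ ε)]) fun ψ hψ => by
    rcases List.mem_append.1 hψ with hψ | hψ
    · exact hvs ψ hψ
    · rw [List.mem_singleton.1 hψ]
      exact hA Φ hΦ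
  simp only [List.map_append, List.map_cons, List.map_nil] at h2
  have h3 := list_sum_mem (S := 𝒩) (l := (hatTerms (fun ψ ε => A (ψ ε)) vs).map
    fun w ε => iterDiff R (w.map fun ψ => ψ ε) (Φ ε)) fun y hy => by
      obtain ⟨w, hw, rfl⟩ := List.mem_map.1 hy
      exact hR.2 Φ hΦ w (mem_of_mem_hatTerms (S := zeroTestObjects n) hA0 hvs w hw)
  convert add_mem h2 h3 using 1
  ext1 ε
  rw [Pi.add_apply, list_sum_apply, List.map_map]
  rfl

/-- Three independent subgroups let the same argument serve for moderate times moderate and for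
moderate times negligible. -/
theorem DifferentialsIn.mul {𝒩' 𝒩'' : AddSubgroup (Par → Sch n)} {R Q : SmOp n → Sch n}
    (hR : DifferentialsIn 𝒩 R) (hQ : DifferentialsIn 𝒩' Q)
    (hmul : ∀ y ∈ 𝒩, ∀ z ∈ 𝒩', (fun ε => mulBilin n (y ε) (z ε)) ∈ 𝒩'') :
    DifferentialsIn 𝒩'' (mulRep R Q) := by
  refine ⟨hR.1.bilin continuous_mulBilin hQ.1, fun Φ hΦ vs hvs => ?_⟩
  have h1 : ∀ (vs : List (Par → SmOp n)) (ε : Par), iterDiff (mulRep R Q)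
      (vs.map fun ψ => ψ ε) = fun x => ((splits vs).map fun q =>
        mulBilin n (iterDiff R (q.1.map fun ψ => ψ ε) x)
          (iterDiff Q (q.2.map fun ψ => ψ ε) x)).sum := fun vs ε =>
    iterDiff_bilin continuous_mulBilin hR.1 hQ.1 (fun ψ : Par → SmOp n => ψ ε) vs
  simp only [h1]
  have h3 := list_sum_mem (S := 𝒩'') (l := (splits vs).map fun q ε =>
      mulBilin n (iterDiff R (q.1.map fun ψ => ψ ε) (Φ ε))
        (iterDiff Q (q.2.map fun ψ => ψ ε) (Φ ε))) fun y hy => by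
      obtain ⟨q, hq, rfl⟩ := List.mem_map.1 hy
      obtain ⟨hq1, hq2⟩ := mem_of_mem_splits (S := zeroTestObjects n) hvs q hq
      exact hmul _ (hR.2 Φ hΦ q.1 hq1) _ (hQ.2 Φ hΦ q.2 hq2)
  convert h3 using 1
  ext1 ε
  rw [list_sum_apply, List.map_map]
  rfl

end Nets

end Colombeau

end

noncomputable section

namespace Colombeau

/-! ### Operators acting on test objects -/

section TestObjects

variable {n : ℕ}

/-- The operator `Φ ↦ a ∘ Φ ∘ b`. -/
def sandwich (a : Sch n →L[ℂ] Sch n) (b : TD n →L[ℂ] TD n) : SmOp n →L[ℂ] SmOp n :=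
  ContinuousLinearMap.postcomp (TD n) a ∘L ContinuousLinearMap.precomp (Sch n) b

theorem sandwich_apply (a : Sch n →L[ℂ] Sch n) (b : TD n →L[ℂ] TD n) (Φ : SmOp n) :
    sandwich a b Φ = a ∘L Φ ∘L b := rfl

/-- The operator `Φ ↦ a ∘ Φ ∘ b` on endomorphisms of `𝒮`. -/
def sandwichSch (a b : Sch n →L[ℂ] Sch n) : (Sch n →L[ℂ] Sch n) →L[ℂ] (Sch n →L[ℂ] Sch n) :=
  ContinuousLinearMap.postcomp (Sch n) a ∘L ContinuousLinearMap.precomp (Sch n) b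

/-- The operator `Φ ↦ a ∘ Φ ∘ b` on endomorphisms of `𝒮'`. -/
def sandwichTD (a b : TD n →L[ℂ] TD n) : (TD n →L[ℂ] TD n) →L[ℂ] (TD n →L[ℂ] TD n) :=
  ContinuousLinearMap.postcomp (TD n) a ∘L ContinuousLinearMap.precomp (TD n) b

instance : ContinuousSub (SmOp n) :=
  IsTopologicalAddGroup.to_continuousSub (G := SmOp n)

instance : ContinuousSub (TD n →L[ℂ] TD n) :=
  IsTopologicalAddGroup.to_continuousSub (G := TD n →L[ℂ] TD n)

/-- The operator `Φ ↦ T ∘ Φ - Φ ∘ T`. -/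
def commutator (T : Sch n →L[ℂ] Sch n) (TTD : TD n →L[ℂ] TD n) : SmOp n →L[ℂ] SmOp n where
  toFun Φ := T ∘L Φ - Φ ∘L TTD
  map_add' Φ Ψ := by
    ext1 u
    simp only [ContinuousLinearMap.comp_apply, add_apply, sub_apply, map_add]
    abel
  map_smul' c Φ := by
    ext1 u
    simp only [ContinuousLinearMap.comp_apply, smul_apply, sub_apply, map_smul, smul_sub,
      RingHom.id_apply]
  cont := (sandwich T (.id ℂ _)).continuous.sub (sandwich (.id ℂ _) TTD).continuous

/-- The operator `Φ ↦ T ∘ Φ - Φ ∘ T` on endomorphisms of `𝒮`. -/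
def commutatorSch (T : Sch n →L[ℂ] Sch n) : (Sch n →L[ℂ] Sch n) →L[ℂ] (Sch n →L[ℂ] Sch n) where
  toFun Φ := T ∘L Φ - Φ ∘L T
  map_add' Φ Ψ := by
    ext1 u
    simp only [ContinuousLinearMap.comp_apply, add_apply, sub_apply, map_add]
    abel
  map_smul' c Φ := by
    ext1 u
    simp only [ContinuousLinearMap.comp_apply, smul_apply, sub_apply, map_smul, smul_sub,
      RingHom.id_apply]
  cont := (sandwichSch T (.id ℂ _)).continuous.sub (sandwichSch (.id ℂ _) T).continuous

/-- The operator `Φ ↦ T ∘ Φ - Φ ∘ T` on endomorphisms of `𝒮'`. -/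
def commutatorTD (T : TD n →L[ℂ] TD n) : (TD n →L[ℂ] TD n) →L[ℂ] (TD n →L[ℂ] TD n) where
  toFun Φ := T ∘L Φ - Φ ∘L T
  map_add' Φ Ψ := by
    ext1 u
    simp only [ContinuousLinearMap.comp_apply, add_apply, sub_apply, map_add]
    abel
  map_smul' c Φ := by
    ext1 u
    simp only [ContinuousLinearMap.comp_apply, smul_apply, sub_apply, map_smul, smul_sub,
      RingHom.id_apply]
  cont := (sandwichTD T (.id ℂ _)).continuous.sub (sandwichTD (.id ℂ _) T).continuous

/-- `A` acts on `ℒ_b(𝒮', 𝒮)` compatibly with `K` on `ℒ_b(𝒮', 𝒮')` and `K'` on `ℒ_b(𝒮, 𝒮)`. -/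
structure Compatible (A : SmOp n →L[ℂ] SmOp n) (K : (TD n →L[ℂ] TD n) →L[ℂ] (TD n →L[ℂ] TD n))
    (K' : (Sch n →L[ℂ] Sch n) →L[ℂ] (Sch n →L[ℂ] Sch n)) : Prop where
  left : ∀ Φ, incl n ∘L A Φ = K (incl n ∘L Φ)
  right : ∀ Φ, A Φ ∘L incl n = K' (Φ ∘L incl n)

variable {A : SmOp n →L[ℂ] SmOp n} {K : (TD n →L[ℂ] TD n) →L[ℂ] (TD n →L[ℂ] TD n)}
  {K' : (Sch n →L[ℂ] Sch n) →L[ℂ] (Sch n →L[ℂ] Sch n)}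

theorem moderate_clm_comp {Φ : Par → SmOp n} (A : SmOp n →L[ℂ] SmOp n)
    (h : ∀ p : Seminorm ℂ (SmOp n), Continuous p →
      ∃ N : ℕ, (fun ε => p (Φ ε)) =O[toZero] fun ε => (ε : ℝ)⁻¹ ^ N)
    (p : Seminorm ℂ (SmOp n)) (hp : Continuous p) :
    ∃ N : ℕ, (fun ε => p (A (Φ ε))) =O[toZero] fun ε => (ε : ℝ)⁻¹ ^ N :=
  h (p.comp A.toLinearMap) (hp.comp A.continuous)

/-- The three conditions live in three operator spaces, and each is preserved by the continuous
linear map acting there: `K`, `K'` and `A`. -/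
theorem Compatible.zeroTestObjects (h : Compatible A K K') {Φ : Par → SmOp n}
    (hΦ : Φ ∈ zeroTestObjects n) : (fun ε => A (Φ ε)) ∈ zeroTestObjects n := by
  refine ⟨?_, fun m p hp => ?_, moderate_clm_comp A hΦ.2.2⟩
  · simp only [h.left]
    have := (K.continuous.tendsto 0).comp hΦ.1
    rwa [K.map_zero] at this
  · simp only [h.right]
    exact hΦ.2.1 m (p.comp K'.toLinearMap) (hp.comp K'.continuous)

theorem Compatible.testObjects (h : Compatible A K K')
    (hK : K (.id ℂ (TD n)) = .id ℂ (TD n)) (hK' : K' (.id ℂ (Sch n)) = .id ℂ (Sch n))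
    {Φ : Par → SmOp n} (hΦ : Φ ∈ testObjects n) : (fun ε => A (Φ ε)) ∈ testObjects n := by
  refine ⟨?_, fun m p hp => ?_, moderate_clm_comp A hΦ.2.2⟩
  · simp only [h.left]
    have := (K.continuous.tendsto _).comp hΦ.1
    rwa [hK] at this
  · refine (hΦ.2.1 m (p.comp K'.toLinearMap) (hp.comp K'.continuous)).congr_left fun ε => ?_
    have : K' (Φ ε ∘L incl n - .id ℂ (Sch n)) = A (Φ ε) ∘L incl n - .id ℂ (Sch n) := by
      rw [map_sub, hK', h.right]
    exact congrArg p this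

/-- The identities in the definition of a test object disappear under `K` and `K'`, which leaves the
conditions for a `0`-test object. Commutators are the case of interest. -/
theorem Compatible.testObjects_zero (h : Compatible A K K')
    (hK : K (.id ℂ (TD n)) = 0) (hK' : K' (.id ℂ (Sch n)) = 0)
    {Φ : Par → SmOp n} (hΦ : Φ ∈ Colombeau.testObjects n) :
    (fun ε => A (Φ ε)) ∈ Colombeau.zeroTestObjects n := by
  refine ⟨?_, fun m p hp => ?_, moderate_clm_comp A hΦ.2.2⟩
  · simp only [h.left]
    have := (K.continuous.tendsto _).comp hΦ.1
    rwa [hK] at this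
  · refine (hΦ.2.1 m (p.comp K'.toLinearMap) (hp.comp K'.continuous)).congr_left fun ε => ?_
    have : K' (Φ ε ∘L incl n - .id ℂ (Sch n)) = A (Φ ε) ∘L incl n := by
      rw [map_sub, hK', h.right, sub_zero]
    exact congrArg p this

theorem compatible_sandwich {f fInv : Sch n →L[ℂ] Sch n} {fTD fInvTD : TD n →L[ℂ] TD n}
    (h1 : incl n ∘L fInv = fInvTD ∘L incl n) (h2 : incl n ∘L f = fTD ∘L incl n) :
    Compatible (sandwich fInv fTD) (sandwichTD fInvTD fTD) (sandwichSch fInv f) := by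
  refine ⟨fun Φ => ?_, fun Φ => ?_⟩
  · change (incl n ∘L fInv) ∘L (Φ ∘L fTD) = _
    rw [h1]
    rfl
  · change fInv ∘L (Φ ∘L (fTD ∘L incl n)) = _
    rw [← h2]
    rfl

theorem compatible_commutator {T : Sch n →L[ℂ] Sch n} {TTD : TD n →L[ℂ] TD n}
    (h : incl n ∘L T = TTD ∘L incl n) :
    Compatible (commutator T TTD) (commutatorTD TTD) (commutatorSch T) := by
  have h' : ∀ f, incl n (T f) = TTD (incl n f) := fun f => DFunLike.congr_fun h f
  refine ⟨fun Φ => ?_, fun Φ => ?_⟩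
  · ext1 u
    change incl n (T (Φ u) - Φ (TTD u)) = TTD (incl n (Φ u)) - incl n (Φ (TTD u))
    rw [map_sub, h']
  · ext1 u
    change T (Φ (incl n u)) - Φ (TTD (incl n u)) = T (Φ (incl n u)) - Φ (incl n (T u))
    rw [h']

end TestObjects

/-! ### Operations on representatives -/

section Operations

variable {n : ℕ} {𝒩 : AddSubgroup (Par → Sch n)}

theorem DifferentialsIn.add {R Q : SmOp n → Sch n} (hR : DifferentialsIn 𝒩 R)
    (hQ : DifferentialsIn 𝒩 Q) : DifferentialsIn 𝒩 (R + Q) := by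
  refine ⟨hR.1.add hQ.1, fun Φ hΦ vs hvs => ?_⟩
  simp only [iterDiff_add hR.1 hQ.1]
  exact add_mem (hR.2 Φ hΦ vs hvs) (hQ.2 Φ hΦ vs hvs)

theorem DifferentialsIn.sub {R Q : SmOp n → Sch n} (hR : DifferentialsIn 𝒩 R)
    (hQ : DifferentialsIn 𝒩 Q) : DifferentialsIn 𝒩 (R - Q) := by
  have h := hR.add (hQ.clm_comp (-.id ℂ (Sch n)) fun y hy => neg_mem hy)
  rw [sub_eq_add_neg]
  exact h

theorem DifferentialsIn.conjRep {f fInv : Sch n →L[ℂ] Sch n} {fTD fInvTD : TD n →L[ℂ] TD n}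
    (h1 : incl n ∘L fInv = fInvTD ∘L incl n) (h2 : incl n ∘L f = fTD ∘L incl n)
    (h3 : fInv ∘L f = .id ℂ _) (h4 : fInvTD ∘L fTD = .id ℂ _) {R : SmOp n → Sch n}
    (hT : ∀ y ∈ 𝒩, (fun ε => f (y ε)) ∈ 𝒩) (hR : DifferentialsIn 𝒩 R) :
    DifferentialsIn 𝒩 (conjRep f fInv fTD R) := by
  have hc := compatible_sandwich h1 h2
  exact (hR.comp_clm (sandwich fInv fTD) (fun Φ hΦ => hc.testObjects h4 h3 hΦ)
    fun Φ hΦ => hc.zeroTestObjects hΦ).clm_comp f hT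

/-- The operator `T` commutes with the identities, so `Φ ↦ T ∘ Φ - Φ ∘ T` turns test objects into
`0`-test objects, which are admissible directions for the differentials of `R`. -/
theorem DifferentialsIn.hatRep {T : Sch n →L[ℂ] Sch n} {TTD : TD n →L[ℂ] TD n}
    (h : incl n ∘L T = TTD ∘L incl n) {R : SmOp n → Sch n}
    (hT : ∀ y ∈ 𝒩, (fun ε => T (y ε)) ∈ 𝒩) (hR : DifferentialsIn 𝒩 R) :
    DifferentialsIn 𝒩 (hatRep T TTD R) := by
  have hc := compatible_commutator h
  exact (hR.clm_comp T hT).sub (hR.differential_self (commutator T TTD)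
    (fun Φ hΦ => hc.testObjects_zero (sub_self TTD) (sub_self T) hΦ)
    fun Φ hΦ => hc.zeroTestObjects hΦ)

/-- Since `differential` is a limit with a default value, its additivity in the map uses smoothness
of both maps, which makes the limits exist. -/
theorem hatRep_sub (T : Sch n →L[ℂ] Sch n) (TTD : TD n →L[ℂ] TD n) {R Q : SmOp n → Sch n}
    (hR : IsSmoothMap R) (hQ : IsSmoothMap Q) :
    hatRep T TTD R - hatRep T TTD Q = hatRep T TTD (R - Q) := by
  ext1 Φ
  have hQ' : IsSmoothMap (fun Φ => (-.id ℝ (Sch n) : Sch n →L[ℝ] Sch n) (Q Φ)) := hQ.clm_comp _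
  have h1 : R - Q = R + fun Φ => (-.id ℝ (Sch n) : Sch n →L[ℝ] Sch n) (Q Φ) := by
    rw [sub_eq_add_neg]
    rfl
  have h2 : ∀ v, differential (R - Q) Φ v = differential R Φ v - differential Q Φ v := by
    intro v
    have h3 := congrFun (iterDiff_add hR hQ' [v]) Φ
    rw [← h1, iterDiff_clm_comp _ hQ] at h3
    rw [sub_eq_add_neg]
    exact h3
  simp only [hatRep, Pi.sub_apply, h2, map_sub]
  abel

theorem iterDiff_clm_singleton (L : SmOp n →L[ℝ] Sch n) (v : SmOp n) :
    iterDiff L [v] = fun _ => L v := by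
  ext1 x
  refine differential_eq (f := L) ?_
  have := (hasCurveDerivAt_const (L x) (0 : ℝ)).add
    (HasCurveDerivAt.smul (hasDerivAt_id (0 : ℝ)) (hasCurveDerivAt_const (L v) 0))
  simpa using this

theorem iterDiff_clm_cons_cons (L : SmOp n →L[ℝ] Sch n) (u v : SmOp n) (vs : List (SmOp n)) :
    iterDiff L (u :: v :: vs) = fun _ => 0 := by
  induction vs generalizing u v with
  | nil =>
    ext1 x
    change differential (iterDiff L [v]) x u = 0
    rw [iterDiff_clm_singleton]
    exact differential_eq (hasCurveDerivAt_const _ 0)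
  | cons w vs ih =>
    ext1 x
    change differential (iterDiff L (v :: w :: vs)) x u = 0
    rw [ih]
    exact differential_eq (hasCurveDerivAt_const _ 0)

/-- Evaluation at `u`, as a continuous linear map. -/
def evalCLM (u : TD n) : SmOp n →L[ℂ] Sch n where
  toFun Φ := Φ u
  map_add' _ _ := rfl
  map_smul' _ _ := rfl
  cont := continuous_eval_const u

/-- The map is linear in `Φ`: its first differential is evaluation of the direction at `u` and the
higher ones vanish. Evaluation is continuous, so the growth condition on test objects and `0`-test
objects gives the bound. -/
theorem iotaRep_mem_moderate (u : TD n) : iotaRep u ∈ moderate n := by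
  rw [mem_moderate_iff]
  let L : SmOp n →L[ℝ] Sch n := (evalCLM u).restrictScalars ℝ
  have hL : ∀ Φ : Par → SmOp n, (∀ p : Seminorm ℂ (SmOp n), Continuous p →
      ∃ N : ℕ, (fun ε => p (Φ ε)) =O[toZero] fun ε => (ε : ℝ)⁻¹ ^ N) →
      (fun ε => L (Φ ε)) ∈ moderateNets n := fun Φ h p hp =>
    h (p.comp (evalCLM u).toLinearMap) (hp.comp (evalCLM u).continuous)
  refine ⟨fun c hc => hc.clm_comp L, fun Φ hΦ vs hvs => ?_⟩
  change (fun ε => iterDiff L (vs.map fun ψ => ψ ε) (Φ ε)) ∈ moderateNets n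
  match vs, hvs with
  | [], _ => exact hL Φ hΦ.2.2
  | [ψ], hvs =>
    simp only [List.map_cons, List.map_nil, iterDiff_clm_singleton]
    exact hL ψ (hvs ψ (by simp)).2.2
  | ψ :: φ :: vs, _ =>
    simp only [List.map_cons, iterDiff_clm_cons_cons]
    exact zero_mem _

theorem sigmaRep_mem_moderate (f : Sch n) : sigmaRep f ∈ moderate n := by
  rw [mem_moderate_iff]
  refine ⟨fun c _ => isSmoothCurve_const f, fun Φ _ vs _ => ?_⟩
  have h : ∀ v vs, iterDiff (sigmaRep f) (v :: vs) = fun _ => 0 := by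
    intro v vs
    induction vs generalizing v with
    | nil =>
      ext1 x
      exact differential_eq (hasCurveDerivAt_const _ 0)
    | cons w vs ih =>
      ext1 x
      change differential (iterDiff (sigmaRep f) (w :: vs)) x v = 0
      rw [ih]
      exact differential_eq (hasCurveDerivAt_const _ 0)
  match vs with
  | [] => exact fun p _ => ⟨0, (isBigO_refl _ _).trans
      ((isBigO_const_const (p f) one_ne_zero _).congr_right fun _ => by simp)⟩
  | ψ :: vs =>
    simp only [List.map_cons, h]
    exact zero_mem _

end Operations

end Colombeau

end

noncomputable section

namespace Colombeau

/-! ### The Fourier transform on `𝒮` and `𝒮'` -/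

section Fourier

variable {n : ℕ}

theorem four_comp_fourInv : four n ∘L fourInv n = .id ℂ (Sch n) := by
  ext1 f
  exact fourier_fourierInv_eq (F := Sch n) f

theorem fourInv_comp_four : fourInv n ∘L four n = .id ℂ (Sch n) := by
  ext1 f
  exact fourierInv_fourier_eq (E := Sch n) (F := Sch n) f

theorem transpose_comp_transpose (S T : Sch n →L[ℂ] Sch n) :
    transpose S ∘L transpose T = transpose (T ∘L S) := rfl

theorem transpose_id : transpose (.id ℂ (Sch n)) = .id ℂ (TD n) := rfl

theorem fourTD_comp_fourInvTD : fourTD n ∘L fourInvTD n = .id ℂ (TD n) := by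
  rw [fourTD, fourInvTD, transpose_comp_transpose, fourInv_comp_four, transpose_id]

theorem fourInvTD_comp_fourTD : fourInvTD n ∘L fourTD n = .id ℂ (TD n) := by
  rw [fourTD, fourInvTD, transpose_comp_transpose, four_comp_fourInv, transpose_id]

/-- An operator on `𝒮` is extended to `𝒮'` as the transpose of its formal adjoint, so compatibility
with the inclusion amounts to an identity between integrals. -/
theorem incl_comp_eq_transpose {S T : Sch n →L[ℂ] Sch n}
    (h : ∀ f g : Sch n, ∫ x, S f x * g x = ∫ x, f x * T g x) :
    incl n ∘L S = transpose T ∘L incl n := by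
  ext f g
  change incl n (S f) g = incl n f (T g)
  rw [incl_apply, incl_apply, h]

theorem incl_comp_four : incl n ∘L four n = fourTD n ∘L incl n :=
  incl_comp_eq_transpose fun f g => integral_fourier_mul_eq f g

theorem incl_comp_fourInv : incl n ∘L fourInv n = fourInvTD n ∘L incl n :=
  incl_comp_eq_transpose fun f g => integral_fourierInv_mul_eq f g

theorem incl_comp_translate (a : Eucl n) :
    incl n ∘L translate a = transTD a ∘L incl n :=
  incl_comp_eq_transpose fun f g => by
    change ∫ x, f (x - a) * g x = ∫ x, f x * g (x - -a)
    rw [← integral_sub_right_eq_self (fun x => f x * g (x - -a)) a]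
    simp

theorem incl_comp_chi (a : Eucl n) : incl n ∘L chi a = chiTD a ∘L incl n :=
  incl_comp_eq_transpose fun f g => by
    simp only [chi_apply]
    congr 1 with x
    ring

theorem incl_comp_mulMon (c : ℂ) (α : Fin n → ℕ) :
    incl n ∘L mulMon c α = mulMonTD c α ∘L incl n :=
  incl_comp_eq_transpose fun f g => by
    simp only [mulMon_apply]
    congr 1 with x
    ring

theorem translate_comp_translate_neg (a : Eucl n) :
    translate a ∘L translate (-a) = .id ℂ (Sch n) := by
  ext f x
  change f (x - a - -a) = f x
  simp

theorem chiFun_mul_chiFun_neg (a x : Eucl n) : chiFun a x * chiFun (-a) x = 1 := by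
  rw [chiFun, chiFun, ← Complex.exp_add]
  simp

theorem chi_comp_chi_neg (a : Eucl n) : chi a ∘L chi (-a) = .id ℂ (Sch n) := by
  ext f x
  change chi a (chi (-a) f) x = f x
  rw [chi_apply, chi_apply, ← mul_assoc, chiFun_mul_chiFun_neg, one_mul]

theorem transTD_comp_transTD_neg (a : Eucl n) :
    transTD a ∘L transTD (-a) = .id ℂ (TD n) := by
  rw [transTD, transTD, transpose_comp_transpose, neg_neg, translate_comp_translate_neg,
    transpose_id]

theorem chiTD_comp_chiTD_neg (a : Eucl n) : chiTD a ∘L chiTD (-a) = .id ℂ (TD n) := by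
  have h := chi_comp_chi_neg (-a)
  rw [neg_neg] at h
  rw [chiTD, chiTD, transpose_comp_transpose, h, transpose_id]

/-- With the kernel written as `chiFun`, the rules for translation and modulation come down to
multiplicativity and symmetry of the character. -/
theorem four_apply_apply (f : Sch n) (ξ : Eucl n) :
    four n f ξ = ∫ x, chiFun (-ξ) x * f x := by
  change 𝓕 f ξ = _
  rw [fourier_coe, Real.fourier_eq']
  congr 1 with x
  rw [smul_eq_mul, chiFun, inner_neg_left, real_inner_comm]
  push_cast
  ring_nf

theorem chiFun_add_left (a b x : Eucl n) : chiFun (a + b) x = chiFun a x * chiFun b x := by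
  rw [chiFun, chiFun, chiFun, ← Complex.exp_add, inner_add_left]
  push_cast
  ring_nf

theorem chiFun_add_right (a x y : Eucl n) : chiFun a (x + y) = chiFun a x * chiFun a y := by
  rw [chiFun, chiFun, chiFun, ← Complex.exp_add, inner_add_right]
  push_cast
  ring_nf

theorem chiFun_neg_comm (a x : Eucl n) : chiFun (-a) x = chiFun (-x) a := by
  rw [chiFun, chiFun, inner_neg_left, inner_neg_left, real_inner_comm]

theorem four_comp_translate (a : Eucl n) : four n ∘L translate a = chi (-a) ∘L four n := by
  ext f ξ
  change four n (translate a f) ξ = chi (-a) (four n f) ξ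
  rw [chi_apply, four_apply_apply, four_apply_apply, ← integral_const_mul,
    ← integral_add_right_eq_self (fun x => chiFun (-ξ) x * translate a f x) a]
  congr 1 with x
  change _ * f (x + a - a) = _
  rw [chiFun_add_right, add_sub_cancel_right, chiFun_neg_comm a]
  ring

theorem four_comp_chi (a : Eucl n) : four n ∘L chi a = translate a ∘L four n := by
  ext f ξ
  change four n (chi a f) ξ = four n f (ξ - a)
  rw [four_apply_apply, four_apply_apply]
  congr 1 with x
  rw [chi_apply, neg_sub, sub_eq_add_neg, chiFun_add_left]
  ring

/-! ### Derivatives and multiplication by monomials -/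

theorem mulMon_comp_mulMon (c : ℂ) (α β : Fin n → ℕ) :
    mulMon c α * mulMon c β = mulMon c (α + β) := by
  ext f x
  change mulMon c α (mulMon c β f) x = _
  simp only [mulMon_apply, monomialFun, Pi.add_apply, pow_add, Finset.prod_mul_distrib, mul_assoc]

theorem mulMon_zero (c : ℂ) : mulMon c (0 : Fin n → ℕ) = 1 := by
  ext f x
  simp [mulMon_apply, monomialFun]

theorem mulMon_nsmul (c : ℂ) (α : Fin n → ℕ) (k : ℕ) : mulMon c (k • α) = mulMon c α ^ k := by
  induction k with
  | zero => rw [zero_smul, mulMon_zero, pow_zero]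
  | succ k ih => rw [succ_nsmul, pow_succ, ← ih, mulMon_comp_mulMon]

/-- The ordered product has the same shape as the definition of `pderiv`, so relations between the
two families need checking only for first-order operators. -/
theorem mulMon_eq_prod (c : ℂ) (α : Fin n → ℕ) :
    mulMon c α = ((List.finRange n).map fun j => mulMon c (Pi.single j 1) ^ α j).prod := by
  have h1 : ∀ L : List (Fin n → ℕ), mulMon c L.sum = (L.map (mulMon c)).prod := by
    intro L
    induction L with
    | nil => exact mulMon_zero c
    | cons β L ih => rw [List.sum_cons, List.map_cons, List.prod_cons, ← ih, mulMon_comp_mulMon]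
  have h2 : α = ((List.finRange n).map fun j => α j • Pi.single j 1).sum := by
    rw [← Fin.sum_univ_def]
    ext i
    simp [Finset.sum_apply, Pi.single_apply]
  conv_lhs => rw [h2]
  rw [h1, List.map_map]
  congr 2
  ext1 j
  exact mulMon_nsmul c _ _

theorem monomialFun_single (c : ℂ) (j : Fin n) (x : Eucl n) :
    monomialFun c (Pi.single j 1) x = c * (x j : ℂ) := by
  rw [monomialFun, Finset.prod_eq_single j (fun i _ hi => by simp [hi]) (by simp)]
  simp

/-- In the monoid of endomorphisms of `𝒮`, `SemiconjBy` is the intertwining relation, which passes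
from single factors to powers and products. -/
theorem semiconjBy_prod_map {M ι : Type*} [Monoid M] {a : M} {f g : ι → M}
    (h : ∀ i, SemiconjBy a (f i) (g i)) (k : ι → ℕ) (L : List ι) :
    SemiconjBy a (L.map fun i => f i ^ k i).prod (L.map fun i => g i ^ k i).prod := by
  induction L with
  | nil => exact SemiconjBy.one_right a
  | cons i L ih =>
    simp only [List.map_cons, List.prod_cons]
    exact ((h i).pow_right _).mul_right ih

theorem four_comp_mulMon (α : Fin n → ℕ) :
    four n ∘L mulMon (-2 * Real.pi * Complex.I) α = pderiv α ∘L four n := by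
  rw [mulMon_eq_prod, pderiv]
  refine semiconjBy_prod_map (a := four n) (fun j => ?_) α _
  ext1 f
  change 𝓕 (mulMon _ (Pi.single j 1) f) = ∂_{EuclideanSpace.single j (1 : ℝ)} (𝓕 f)
  rw [SchwartzMap.lineDerivOp_fourier_eq]
  congr 1
  ext x
  rw [mulMon_apply, monomialFun_single, smul_apply, smulLeftCLM_apply_apply (by fun_prop)]
  simp [EuclideanSpace.inner_single_right]
  ring

theorem four_comp_pderiv (α : Fin n → ℕ) :
    four n ∘L pderiv α = mulMon (2 * Real.pi * Complex.I) α ∘L four n := by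
  rw [mulMon_eq_prod, pderiv]
  refine semiconjBy_prod_map (a := four n) (fun j => ?_) α _
  ext f x
  change 𝓕 (∂_{EuclideanSpace.single j (1 : ℝ)} f) x = mulMon _ (Pi.single j 1) (𝓕 f) x
  rw [SchwartzMap.fourier_lineDerivOp_eq, mulMon_apply, monomialFun_single, smul_apply,
    smulLeftCLM_apply_apply (by fun_prop)]
  simp [EuclideanSpace.inner_single_right]
  ring

theorem mulMon_neg (c : ℂ) (α : Fin n → ℕ) :
    mulMon (-c) α = (-1 : ℂ) ^ (∑ j, α j) • mulMon c α := by
  ext f x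
  change _ = (-1 : ℂ) ^ (∑ j, α j) * mulMon c α f x
  rw [mulMon_apply, mulMon_apply, ← mul_assoc]
  congr 1
  simp_rw [monomialFun, ← Finset.prod_pow_eq_pow_sum, ← Finset.prod_mul_distrib, ← mul_pow]
  simp

/-- Transposition reverses the order of composition, so this follows from the rule for derivatives
on `𝒮`. The sign in `pderivTD` accounts for the passage from `2πi` to `-2πi`. -/
theorem fourTD_comp_mulMonTD (α : Fin n → ℕ) :
    fourTD n ∘L mulMonTD (-2 * Real.pi * Complex.I) α = pderivTD α ∘L fourTD n := by
  have h : (-2 * Real.pi * Complex.I : ℂ) = -(2 * Real.pi * Complex.I) := by ring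
  ext u f
  change u (mulMon _ α (four n f)) = (-1 : ℂ) ^ (∑ j, α j) • u ((four n ∘L pderiv α) f)
  rw [four_comp_pderiv, h, mulMon_neg, smul_apply, map_smul]
  rfl

theorem fourTD_comp_pderivTD (α : Fin n → ℕ) :
    fourTD n ∘L pderivTD α = mulMonTD (2 * Real.pi * Complex.I) α ∘L fourTD n := by
  have h : (2 * Real.pi * Complex.I : ℂ) = -(-2 * Real.pi * Complex.I) := by ring
  ext u f
  change (-1 : ℂ) ^ (∑ j, α j) • u ((pderiv α ∘L four n) f) = u ((four n ∘L mulMon _ α) f)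
  rw [← four_comp_mulMon, h, mulMon_neg]
  change _ = u (four n ((-1 : ℂ) ^ (∑ j, α j) • mulMon _ α f))
  rw [map_smul, map_smul]
  rfl

/-- No integration by parts is needed: `D^α = ℱ ∘ (-2πi M)^α ∘ ℱ⁻¹`, and each of the three factors
commutes with the inclusion. -/
theorem incl_comp_pderiv (α : Fin n → ℕ) : incl n ∘L pderiv α = pderivTD α ∘L incl n := by
  have h1 : pderiv α = four n ∘L mulMon (-2 * Real.pi * Complex.I) α ∘L fourInv n := by
    rw [← ContinuousLinearMap.comp_assoc, four_comp_mulMon, ContinuousLinearMap.comp_assoc,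
      four_comp_fourInv]
    rfl
  rw [h1, ← ContinuousLinearMap.comp_assoc, incl_comp_four, ContinuousLinearMap.comp_assoc,
    ← ContinuousLinearMap.comp_assoc (incl n), incl_comp_mulMon, ContinuousLinearMap.comp_assoc,
    incl_comp_fourInv, ← ContinuousLinearMap.comp_assoc, fourTD_comp_mulMonTD,
    ContinuousLinearMap.comp_assoc, ← ContinuousLinearMap.comp_assoc (fourTD n),
    fourTD_comp_fourInvTD]
  rfl

theorem convolution_eq (f g : Sch n) :
    SchwartzMap.convolution (ContinuousLinearMap.mul ℂ ℂ) f g =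
      fourInv n (mulBilin n (four n f) (four n g)) :=
  (DFunLike.congr_fun fourInv_comp_four _).symm.trans (congrArg (fourInv n)
    (SchwartzMap.fourier_convolution (ContinuousLinearMap.mul ℂ ℂ) f g))

end Fourier

end Colombeau

end

noncomputable section

namespace Colombeau

/-! ### Passage to the quotient -/

section Quotient

variable {n : ℕ}

theorem cls_of_mem {R : SmOp n → Sch n} (hR : R ∈ moderate n) :
    cls R = Submodule.Quotient.mk ⟨R, hR⟩ :=
  dif_pos hR

theorem cls_eq_cls_iff {R Q : SmOp n → Sch n} (hR : R ∈ moderate n) (hQ : Q ∈ moderate n) :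
    cls R = cls Q ↔ R - Q ∈ negligible n := by
  rw [cls_of_mem hR, cls_of_mem hQ, Submodule.Quotient.eq]
  rfl

theorem rep_mem_moderate (U : Gtau n) : rep U ∈ moderate n :=
  (Function.surjInv (Submodule.mkQ_surjective ((negligible n).submoduleOf (moderate n))) U).2

theorem cls_rep (U : Gtau n) : cls (rep U) = U := by
  rw [cls_of_mem (rep_mem_moderate U)]
  exact Function.surjInv_eq (Submodule.mkQ_surjective ((negligible n).submoduleOf (moderate n))) U

theorem rep_cls_sub_mem_negligible {R : SmOp n → Sch n} (hR : R ∈ moderate n) :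
    rep (cls R) - R ∈ negligible n :=
  (cls_eq_cls_iff (rep_mem_moderate _) hR).1 (cls_rep _)

theorem cls_add {R Q : SmOp n → Sch n} (hR : R ∈ moderate n) (hQ : Q ∈ moderate n) :
    cls (R + Q) = cls R + cls Q := by
  rw [cls_of_mem hR, cls_of_mem hQ, cls_of_mem (add_mem hR hQ)]
  rfl

theorem cls_smul (c : ℂ) {R : SmOp n → Sch n} (hR : R ∈ moderate n) :
    cls (c • R) = c • cls R := by
  rw [cls_of_mem hR, cls_of_mem (Submodule.smul_mem _ c hR)]
  rfl

section Unary

variable {t s t' s' : (SmOp n → Sch n) → (SmOp n → Sch n)}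

/-- The chosen representative of the class of `R` differs from `R` by a negligible map, and `hsub`
reduces the comparison to the image of that difference. It is asked for smooth maps only, so that
`hatRep` is covered. -/
theorem wellDefined_of_sub
    (h : ∀ R, DifferentialsIn (moderateNets n) R → DifferentialsIn (moderateNets n) (t R))
    (h0 : ∀ R, DifferentialsIn (negligibleNets n) R → DifferentialsIn (negligibleNets n) (t R))
    (hsub : ∀ R Q, IsSmoothMap R → IsSmoothMap Q → t R - t Q = t (R - Q)) : WellDefined t := by
  have ht : ∀ R ∈ moderate n, t R ∈ moderate n := fun R hR => by
    rw [mem_moderate_iff] at hR ⊢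
    exact h R hR
  refine fun R hR => ⟨ht R hR, ?_⟩
  rw [descend, cls_eq_cls_iff (ht _ (rep_mem_moderate _)) (ht _ hR),
    hsub _ _ (rep_mem_moderate _).1 hR.1, mem_negligible_iff]
  exact h0 _ (mem_negligible_iff.1 (rep_cls_sub_mem_negligible hR))

/-- An identity between representatives descends to classes. Smoothness of `R` is available because
representatives are moderate, and the geometric operators need it. -/
theorem descend_semiconj (ht : WellDefined t) (hs : WellDefined s) (hs' : WellDefined s')
    (h : ∀ R, IsSmoothMap R → t (s R) = s' (t R)) :
    Function.Semiconj (descend t) (descend s) (descend s') := by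
  intro U
  have hU := rep_mem_moderate U
  rw [← cls_rep U, (hs _ hU).2, (ht _ (hs _ hU).1).2, (ht _ hU).2, (hs' _ (ht _ hU).1).2,
    h _ hU.1]

theorem descend_leftInverse (ht : WellDefined t) (hs : WellDefined s)
    (h : ∀ R, t (s R) = R) : Function.LeftInverse (descend t) (descend s) := by
  intro U
  have hU := rep_mem_moderate U
  rw [← cls_rep U, (hs _ hU).2, (ht _ (hs _ hU).1).2, h]

theorem descend_add (ht : WellDefined t) (h : ∀ R Q, t (R + Q) = t R + t Q) (U V : Gtau n) :
    descend t (U + V) = descend t U + descend t V := by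
  have hU := rep_mem_moderate U
  have hV := rep_mem_moderate V
  rw [← cls_rep U, ← cls_rep V, ← cls_add hU hV, (ht _ (add_mem hU hV)).2, (ht _ hU).2,
    (ht _ hV).2, h, cls_add (ht _ hU).1 (ht _ hV).1]

theorem descend_smul (ht : WellDefined t) (h : ∀ (c : ℂ) R, t (c • R) = c • t R) (c : ℂ)
    (U : Gtau n) : descend t (c • U) = c • descend t U := by
  have hU := rep_mem_moderate U
  rw [← cls_rep U, ← cls_smul c hU, (ht _ (Submodule.smul_mem _ c hU)).2, (ht _ hU).2, h,
    cls_smul c (ht _ hU).1]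

theorem multiPow_semiconj {F : Gtau n → Gtau n} {a b : Fin n → Gtau n → Gtau n}
    (h : ∀ j, Function.Semiconj F (a j) (b j)) (α : Fin n → ℕ) :
    Function.Semiconj F (multiPow a α) (multiPow b α) := by
  unfold multiPow
  induction List.finRange n with
  | nil => exact Function.Semiconj.id_right
  | cons j L ih => exact ((h j).iterate_right (α j)).comp_right ih

end Unary

section Binary

variable {m m' : (SmOp n → Sch n) → (SmOp n → Sch n) → (SmOp n → Sch n)}
  {t : (SmOp n → Sch n) → (SmOp n → Sch n)}

theorem descend_descend₂ (ht : WellDefined t) (hm : WellDefined₂ m) (hm' : WellDefined₂ m')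
    (h : ∀ R Q, t (m R Q) = m' (t R) (t Q)) (U V : Gtau n) :
    descend t (descend₂ m U V) = descend₂ m' (descend t U) (descend t V) := by
  have hU := rep_mem_moderate U
  have hV := rep_mem_moderate V
  rw [← cls_rep U, ← cls_rep V, (hm _ hU _ hV).2, (ht _ (hm _ hU _ hV).1).2, (ht _ hU).2,
    (ht _ hV).2, (hm' _ (ht _ hU).1 _ (ht _ hV).1).2, h]

theorem wellDefined₂_mulRep : WellDefined₂ (mulRep (n := n)) := by
  have hmod : ∀ R ∈ moderate n, ∀ Q ∈ moderate n, mulRep R Q ∈ moderate n := by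
    intro R hR Q hQ
    rw [mem_moderate_iff] at hR hQ ⊢
    exact hR.mul hQ fun y hy z hz => mul_mem_moderateNets hy hz
  have hneg : ∀ R ∈ moderate n, ∀ Q ∈ negligible n, mulRep R Q ∈ negligible n := by
    intro R hR Q hQ
    rw [mem_moderate_iff] at hR
    rw [mem_negligible_iff] at hQ ⊢
    exact hR.mul hQ fun y hy z hz => mul_mem_negligibleNets hy hz
  have hcomm : ∀ R Q : SmOp n → Sch n, mulRep R Q = mulRep Q R := fun R Q =>
    funext fun Φ => mulBilin_comm (R Φ) (Q Φ)
  refine fun R hR Q hQ => ⟨hmod R hR Q hQ, ?_⟩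
  have hR' := rep_mem_moderate (cls R)
  have hQ' := rep_mem_moderate (cls Q)
  rw [descend₂, cls_eq_cls_iff (hmod _ hR' _ hQ') (hmod _ hR _ hQ)]
  -- The usual splitting of a difference of products; commutativity is used to keep the negligible
  -- factor in second place.
  have h1 : mulRep (rep (cls R)) (rep (cls Q)) - mulRep R Q =
      mulRep (rep (cls Q)) (rep (cls R) - R) + mulRep R (rep (cls Q) - Q) := by
    rw [hcomm (rep (cls Q))]
    ext Φ x
    change rep (cls R) Φ x * rep (cls Q) Φ x - R Φ x * Q Φ x =
      (rep (cls R) Φ x - R Φ x) * rep (cls Q) Φ x + R Φ x * (rep (cls Q) Φ x - Q Φ x)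
    ring
  rw [h1]
  exact add_mem (hneg _ hQ' _ (rep_cls_sub_mem_negligible hR))
    (hneg _ hR _ (rep_cls_sub_mem_negligible hQ))

end Binary

/-! ### The operations are well defined -/

theorem wellDefined_compRep (T : Sch n →L[ℂ] Sch n) : WellDefined (compRep T) :=
  wellDefined_of_sub (fun _ hR => hR.clm_comp T fun _ => clm_comp_mem_moderateNets T)
    (fun _ hR => hR.clm_comp T fun _ => clm_comp_mem_negligibleNets T)
    fun _ _ _ _ => funext fun _ => (map_sub T _ _).symm

theorem wellDefined_conjRep {f fInv : Sch n →L[ℂ] Sch n} {fTD fInvTD : TD n →L[ℂ] TD n}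
    (h1 : incl n ∘L fInv = fInvTD ∘L incl n) (h2 : incl n ∘L f = fTD ∘L incl n)
    (h3 : fInv ∘L f = .id ℂ _) (h4 : fInvTD ∘L fTD = .id ℂ _) :
    WellDefined (conjRep f fInv fTD) :=
  wellDefined_of_sub (fun _ hR => hR.conjRep h1 h2 h3 h4 fun _ => clm_comp_mem_moderateNets f)
    (fun _ hR => hR.conjRep h1 h2 h3 h4 fun _ => clm_comp_mem_negligibleNets f)
    fun _ _ _ _ => funext fun _ => (map_sub f _ _).symm

theorem wellDefined_hatRep {T : Sch n →L[ℂ] Sch n} {TTD : TD n →L[ℂ] TD n}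
    (h : incl n ∘L T = TTD ∘L incl n) : WellDefined (hatRep T TTD) :=
  wellDefined_of_sub (fun _ hR => hR.hatRep h fun _ => clm_comp_mem_moderateNets T)
    (fun _ hR => hR.hatRep h fun _ => clm_comp_mem_negligibleNets T)
    fun _ _ hR hQ => hatRep_sub T TTD hR hQ

theorem wellDefined_fourRep : WellDefined (fourRep (n := n)) :=
  wellDefined_conjRep incl_comp_fourInv incl_comp_four fourInv_comp_four fourInvTD_comp_fourTD

theorem wellDefined_fourInvRep : WellDefined (fourInvRep (n := n)) :=
  wellDefined_conjRep incl_comp_four incl_comp_fourInv four_comp_fourInv fourTD_comp_fourInvTD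

theorem wellDefined_hatTransRep (a : Eucl n) : WellDefined (hatTransRep a) := by
  have h1 := translate_comp_translate_neg (-a)
  have h2 := transTD_comp_transTD_neg (-a)
  rw [neg_neg] at h1 h2
  exact wellDefined_conjRep (incl_comp_translate (-a)) (incl_comp_translate a) h1 h2

theorem wellDefined_hatChiRep (a : Eucl n) : WellDefined (hatChiRep a) := by
  have h1 := chi_comp_chi_neg (-a)
  have h2 := chiTD_comp_chiTD_neg (-a)
  rw [neg_neg] at h1 h2
  exact wellDefined_conjRep (incl_comp_chi (-a)) (incl_comp_chi a) h1 h2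

theorem wellDefined_hatPderivRep (α : Fin n → ℕ) : WellDefined (hatPderivRep α) :=
  wellDefined_hatRep (incl_comp_pderiv α)

theorem wellDefined_hatMulMonRep (c : ℂ) (α : Fin n → ℕ) : WellDefined (hatMulMonRep c α) :=
  wellDefined_hatRep (incl_comp_mulMon c α)

theorem convRep_eq (R Q : SmOp n → Sch n) : convRep R Q =
    compRep (fourInv n) (mulRep (compRep (four n) R) (compRep (four n) Q)) :=
  funext fun Φ => convolution_eq (R Φ) (Q Φ)

theorem wellDefined₂_convRep : WellDefined₂ (convRep (n := n)) := by
  intro R hR Q hQ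
  have hF := wellDefined_compRep (four n)
  have hI := wellDefined_compRep (fourInv n)
  have hR' := rep_mem_moderate (cls R)
  have hQ' := rep_mem_moderate (cls Q)
  have hm := wellDefined₂_mulRep _ (hF _ hR).1 _ (hF _ hQ).1
  have hm' := wellDefined₂_mulRep _ (hF _ hR').1 _ (hF _ hQ').1
  rw [descend₂, convRep_eq, convRep_eq]
  refine ⟨(hI _ hm.1).1, ?_⟩
  -- Read backwards, well-definedness writes both classes as operations on the classes of `R` and
  -- `Q`. Since `descend` evaluates at `rep`, the two sides then agree by definition.
  rw [← (hI _ hm.1).2, ← (hI _ hm'.1).2, ← hm.2, ← hm'.2, ← (hF _ hR).2, ← (hF _ hQ).2]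
  rfl

/-! ### Identities between representatives -/

theorem fourRep_fourInvRep (R : SmOp n → Sch n) : fourRep (fourInvRep R) = R := by
  ext1 Φ
  have h1 : ∀ f, four n (fourInv n f) = f := DFunLike.congr_fun four_comp_fourInv
  have h2 : ∀ u, fourTD n (fourInvTD n u) = u := DFunLike.congr_fun fourTD_comp_fourInvTD
  have h3 : four n ∘L (fourInv n ∘L Φ ∘L fourTD n) ∘L fourInvTD n = Φ := by
    ext1 u
    change four n (fourInv n (Φ (fourTD n (fourInvTD n u)))) = Φ u
    rw [h1, h2]
  change four n (fourInv n (R _)) = R Φ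
  rw [h1, h3]

theorem fourInvRep_fourRep (R : SmOp n → Sch n) : fourInvRep (fourRep R) = R := by
  ext1 Φ
  have h1 : ∀ f, fourInv n (four n f) = f := DFunLike.congr_fun fourInv_comp_four
  have h2 : ∀ u, fourInvTD n (fourTD n u) = u := DFunLike.congr_fun fourInvTD_comp_fourTD
  have h3 : fourInv n ∘L (four n ∘L Φ ∘L fourInvTD n) ∘L fourTD n = Φ := by
    ext1 u
    change fourInv n (four n (Φ (fourInvTD n (fourTD n u)))) = Φ u
    rw [h1, h2]
  change fourInv n (four n (R _)) = R Φ
  rw [h1, h3]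

theorem fourRep_iotaRep (u : TD n) : fourRep (iotaRep u) = iotaRep (fourTD n u) :=
  funext fun Φ => DFunLike.congr_fun four_comp_fourInv (Φ (fourTD n u))

theorem fourInvRep_iotaRep (u : TD n) : fourInvRep (iotaRep u) = iotaRep (fourInvTD n u) :=
  funext fun Φ => DFunLike.congr_fun fourInv_comp_four (Φ (fourInvTD n u))

theorem conjRep_compRep {f fInv T T' : Sch n →L[ℂ] Sch n} {fTD : TD n →L[ℂ] TD n}
    (h : f ∘L T = T' ∘L f) (R : SmOp n → Sch n) :
    conjRep f fInv fTD (compRep T R) = compRep T' (conjRep f fInv fTD R) :=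
  funext fun _ => DFunLike.congr_fun h _

theorem conjRep_conjRep {f fInv g gInv g' gInv' : Sch n →L[ℂ] Sch n}
    {fTD gTD gTD' : TD n →L[ℂ] TD n} (h1 : f ∘L g = g' ∘L f)
    (h2 : gInv ∘L fInv = fInv ∘L gInv') (h3 : fTD ∘L gTD = gTD' ∘L fTD) (R : SmOp n → Sch n) :
    conjRep f fInv fTD (conjRep g gInv gTD R) = conjRep g' gInv' gTD' (conjRep f fInv fTD R) := by
  ext1 Φ
  have h4 : gInv ∘L (fInv ∘L Φ ∘L fTD) ∘L gTD = fInv ∘L (gInv' ∘L Φ ∘L gTD') ∘L fTD := by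
    change (gInv ∘L fInv) ∘L Φ ∘L (fTD ∘L gTD) = (fInv ∘L gInv') ∘L Φ ∘L (gTD' ∘L fTD)
    rw [h2, h3]
  change (f ∘L g) (R _) = (g' ∘L f) (R _)
  rw [h1, h4]

theorem differential_conjRep {f fInv : Sch n →L[ℂ] Sch n} {fTD : TD n →L[ℂ] TD n}
    {R : SmOp n → Sch n} (hR : IsSmoothMap R) (Φ Ψ : SmOp n) :
    differential (conjRep f fInv fTD R) Φ Ψ =
      f (differential R (sandwich fInv fTD Φ) (sandwich fInv fTD Ψ)) := by
  have h1 : ∀ t : ℝ, sandwich fInv fTD (Φ + t • Ψ) =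
      sandwich fInv fTD Φ + t • sandwich fInv fTD Ψ := fun t => by
    rw [ContinuousLinearMap.map_add, ContinuousLinearMap.map_smul_of_tower]
  refine differential_eq ?_
  have h2 := (hR.hasCurveDerivAt_line (sandwich fInv fTD Φ) (sandwich fInv fTD Ψ)).clm_comp
    (f.restrictScalars ℝ)
  simp only [← h1] at h2
  exact h2

/-- Conjugation by `f` turns the commutator of `Φ` with `T'` into the commutator of `f⁻¹ ∘ Φ ∘ f`
with `T`. By the chain rule the correction term `dR` therefore transforms exactly as the
componentwise term does. -/
theorem conjRep_hatRep {f fInv T T' : Sch n →L[ℂ] Sch n} {fTD TTD TTD' : TD n →L[ℂ] TD n}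
    (h1 : f ∘L T = T' ∘L f) (h2 : T ∘L fInv = fInv ∘L T') (h3 : fTD ∘L TTD = TTD' ∘L fTD)
    {R : SmOp n → Sch n} (hR : IsSmoothMap R) :
    conjRep f fInv fTD (hatRep T TTD R) = hatRep T' TTD' (conjRep f fInv fTD R) := by
  ext1 Φ
  have h5 : fInv ∘L (T' ∘L Φ - Φ ∘L TTD') ∘L fTD =
      T ∘L (fInv ∘L Φ ∘L fTD) - (fInv ∘L Φ ∘L fTD) ∘L TTD := by
    ext1 u
    change fInv (T' (Φ (fTD u)) - Φ ((TTD' ∘L fTD) u)) =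
      (T ∘L fInv) (Φ (fTD u)) - fInv (Φ ((fTD ∘L TTD) u))
    rw [h2, h3, map_sub]
    rfl
  change f (T (R _) - differential R _ _) = (T' ∘L f) (R _) - _
  rw [differential_conjRep hR, sandwich_apply, sandwich_apply, h5, ← h1, map_sub]
  rfl

theorem comp_fourInv_of_four_comp {T T' : Sch n →L[ℂ] Sch n}
    (h : four n ∘L T = T' ∘L four n) : T ∘L fourInv n = fourInv n ∘L T' := by
  calc T ∘L fourInv n = (fourInv n ∘L four n) ∘L T ∘L fourInv n := by
        rw [fourInv_comp_four]
        rfl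
    _ = fourInv n ∘L (four n ∘L T) ∘L fourInv n := rfl
    _ = fourInv n ∘L T' ∘L (four n ∘L fourInv n) := by
        rw [h]
        rfl
    _ = fourInv n ∘L T' := by
        rw [four_comp_fourInv]
        rfl

theorem fourRep_hatTransRep (a : Eucl n) (R : SmOp n → Sch n) :
    fourRep (hatTransRep a R) = hatChiRep (-a) (fourRep R) := by
  refine conjRep_conjRep (four_comp_translate a)
    (comp_fourInv_of_four_comp (four_comp_translate (-a))) ?_ R
  -- On `𝒮'` transposition exchanges the roles: the rule for `τ_a` is the transpose of the rule for
  -- `χ_{-a}` on `𝒮`.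
  rw [fourTD, transTD, chiTD, transpose_comp_transpose, transpose_comp_transpose, four_comp_chi]

theorem fourRep_hatChiRep (a : Eucl n) (R : SmOp n → Sch n) :
    fourRep (hatChiRep a R) = hatTransRep a (fourRep R) := by
  refine conjRep_conjRep (four_comp_chi a) (comp_fourInv_of_four_comp (four_comp_chi (-a))) ?_ R
  rw [fourTD, transTD, chiTD, transpose_comp_transpose, transpose_comp_transpose,
    four_comp_translate, neg_neg]

theorem fourRep_hatMulMonRep (α : Fin n → ℕ) {R : SmOp n → Sch n} (hR : IsSmoothMap R) :
    fourRep (hatMulMonRep (-2 * Real.pi * Complex.I) α R) = hatPderivRep α (fourRep R) :=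
  conjRep_hatRep (four_comp_mulMon α) (comp_fourInv_of_four_comp (four_comp_mulMon α))
    (fourTD_comp_mulMonTD α) hR

theorem fourRep_hatPderivRep (α : Fin n → ℕ) {R : SmOp n → Sch n} (hR : IsSmoothMap R) :
    fourRep (hatPderivRep α R) = hatMulMonRep (2 * Real.pi * Complex.I) α (fourRep R) :=
  conjRep_hatRep (four_comp_pderiv α) (comp_fourInv_of_four_comp (four_comp_pderiv α))
    (fourTD_comp_pderivTD α) hR

theorem fourInvRep_mulRep (R Q : SmOp n → Sch n) :
    fourInvRep (mulRep R Q) = convRep (fourInvRep R) (fourInvRep Q) := by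
  have h1 : ∀ f, four n (fourInv n f) = f := DFunLike.congr_fun four_comp_fourInv
  rw [convRep_eq]
  ext1 Φ
  change _ = fourInv n (mulBilin n (four n (fourInv n (R _))) (four n (fourInv n (Q _))))
  rw [h1, h1]
  rfl

theorem fourRep_convRep (R Q : SmOp n → Sch n) :
    fourRep (convRep R Q) = mulRep (fourRep R) (fourRep Q) := by
  rw [convRep_eq]
  exact funext fun Φ => DFunLike.congr_fun four_comp_fourInv _

/-! ### The Fourier transform on `𝒢_τ` -/

/-- The Fourier transform as a linear automorphism of `𝒢_τ`. -/
def fourEquiv (n : ℕ) : Gtau n ≃ₗ[ℂ] Gtau n where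
  toFun := fourG
  map_add' := descend_add wellDefined_fourRep fun _ _ => funext fun _ => map_add (four n) _ _
  map_smul' := descend_smul wellDefined_fourRep fun _ _ => funext fun _ => map_smul (four n) _ _
  invFun := fourInvG
  left_inv := descend_leftInverse wellDefined_fourInvRep wellDefined_fourRep fourInvRep_fourRep
  right_inv := descend_leftInverse wellDefined_fourRep wellDefined_fourInvRep fourRep_fourInvRep

theorem fourG_semiconj_hatMulMonG (α : Fin n → ℕ) :
    Function.Semiconj fourG (hatMulMonG (-2 * Real.pi * Complex.I) α) (hatPderivG α) :=
  descend_semiconj wellDefined_fourRep (wellDefined_hatMulMonRep _ α) (wellDefined_hatPderivRep α)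
    fun _ => fourRep_hatMulMonRep α

theorem fourG_semiconj_hatPderivG (α : Fin n → ℕ) :
    Function.Semiconj fourG (hatPderivG α) (hatMulMonG (2 * Real.pi * Complex.I) α) :=
  descend_semiconj wellDefined_fourRep (wellDefined_hatPderivRep α) (wellDefined_hatMulMonRep _ α)
    fun _ => fourRep_hatPderivRep α

theorem fourG_semiconj_comp {T T' : Sch n →L[ℂ] Sch n} (h : four n ∘L T = T' ∘L four n) :
    Function.Semiconj fourG (descend (compRep T)) (descend (compRep T')) :=
  descend_semiconj wellDefined_fourRep (wellDefined_compRep T) (wellDefined_compRep T')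
    fun R _ => conjRep_compRep h R

end Quotient

end Colombeau

end

theorem mainTheorem1 (n : ℕ) :
    -- the Fourier transform, its inverse and all other operations are well defined on `𝒢_τ`
    (Colombeau.WellDefined (n := n) Colombeau.fourRep ∧
      Colombeau.WellDefined (n := n) Colombeau.fourInvRep ∧
      (∀ u : Colombeau.TD n, Colombeau.iotaRep u ∈ Colombeau.moderate n) ∧
      (∀ f : Colombeau.Sch n, Colombeau.sigmaRep f ∈ Colombeau.moderate n) ∧
      (∀ a : Colombeau.Eucl n,
        Colombeau.WellDefined (Colombeau.compRep (Colombeau.translate a)) ∧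
        Colombeau.WellDefined (Colombeau.compRep (Colombeau.chi a)) ∧
        Colombeau.WellDefined (Colombeau.hatTransRep a) ∧
        Colombeau.WellDefined (Colombeau.hatChiRep a)) ∧
      (∀ α : Fin n → ℕ,
        Colombeau.WellDefined (Colombeau.compRep (Colombeau.pderiv α)) ∧
        Colombeau.WellDefined (Colombeau.hatPderivRep α)) ∧
      (∀ (c : ℂ) (α : Fin n → ℕ),
        Colombeau.WellDefined (Colombeau.compRep (Colombeau.mulMon c α)) ∧
        Colombeau.WellDefined (Colombeau.hatMulMonRep c α)) ∧
      Colombeau.WellDefined₂ (n := n) Colombeau.mulRep ∧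
      Colombeau.WellDefined₂ (n := n) Colombeau.convRep) ∧
    -- (i) linear isomorphism with the explicit inverse
    (∃ F : Colombeau.Gtau n ≃ₗ[ℂ] Colombeau.Gtau n,
      (∀ R, F R = Colombeau.fourG R) ∧ (∀ R, F.symm R = Colombeau.fourInvG R)) ∧
    -- (ii) compatibility with the embeddings
    ((∀ u : Colombeau.TD n,
        Colombeau.fourG (Colombeau.iota u) = Colombeau.iota (Colombeau.fourTD n u) ∧
        Colombeau.fourInvG (Colombeau.iota u) = Colombeau.iota (Colombeau.fourInvTD n u)) ∧
      (∀ f : Colombeau.Sch n,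
        Colombeau.fourG (Colombeau.sigma f) = Colombeau.sigma (Colombeau.four n f) ∧
        Colombeau.fourInvG (Colombeau.sigma f) = Colombeau.sigma (Colombeau.fourInv n f))) ∧
    -- (iii) translation and modulation
    (∀ (a : Colombeau.Eucl n) (R : Colombeau.Gtau n),
      Colombeau.fourG (Colombeau.transG a R) = Colombeau.chiG (-a) (Colombeau.fourG R) ∧
      Colombeau.fourG (Colombeau.chiG a R) = Colombeau.transG a (Colombeau.fourG R) ∧
      Colombeau.fourG (Colombeau.hatTransG a R) = Colombeau.hatChiG (-a) (Colombeau.fourG R) ∧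
      Colombeau.fourG (Colombeau.hatChiG a R) = Colombeau.hatTransG a (Colombeau.fourG R)) ∧
    -- (iv) derivatives and multiplication by polynomials
    (∀ (α : Fin n → ℕ) (R : Colombeau.Gtau n),
      -- componentwise
      (Colombeau.pderivG α (Colombeau.fourG R) =
          Colombeau.fourG (Colombeau.mulMonG (-2 * Real.pi * Complex.I) α R) ∧
        Colombeau.mulMonG (2 * Real.pi * Complex.I) α (Colombeau.fourG R) =
          Colombeau.fourG (Colombeau.pderivG α R)) ∧
      -- powers of the geometric first-order operators
      (Colombeau.hatPderivPowG α (Colombeau.fourG R) =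
          Colombeau.fourG (Colombeau.hatMulMonPowG (-2 * Real.pi * Complex.I) α R) ∧
        Colombeau.hatMulMonPowG (2 * Real.pi * Complex.I) α (Colombeau.fourG R) =
          Colombeau.fourG (Colombeau.hatPderivPowG α R)) ∧
      -- geometric extensions of the operators of order `α`
      (Colombeau.hatPderivG α (Colombeau.fourG R) =
          Colombeau.fourG (Colombeau.hatMulMonG (-2 * Real.pi * Complex.I) α R) ∧
        Colombeau.hatMulMonG (2 * Real.pi * Complex.I) α (Colombeau.fourG R) =
          Colombeau.fourG (Colombeau.hatPderivG α R))) ∧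
    -- (v) products and convolutions
    (∀ u v : Colombeau.Gtau n,
      Colombeau.fourInvG (Colombeau.mulG u v) =
          Colombeau.convG (Colombeau.fourInvG u) (Colombeau.fourInvG v) ∧
        Colombeau.fourG (Colombeau.convG u v) =
          Colombeau.mulG (Colombeau.fourG u) (Colombeau.fourG v)) := by
  open Colombeau in
  exact ⟨⟨wellDefined_fourRep, wellDefined_fourInvRep, iotaRep_mem_moderate, sigmaRep_mem_moderate,
      fun a => ⟨wellDefined_compRep _, wellDefined_compRep _, wellDefined_hatTransRep a,
        wellDefined_hatChiRep a⟩,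
      fun α => ⟨wellDefined_compRep _, wellDefined_hatPderivRep α⟩,
      fun c α => ⟨wellDefined_compRep _, wellDefined_hatMulMonRep c α⟩,
      wellDefined₂_mulRep, wellDefined₂_convRep⟩,
    ⟨fourEquiv n, fun _ => rfl, fun _ => rfl⟩,
    ⟨fun u => ⟨(wellDefined_fourRep _ (iotaRep_mem_moderate u)).2.trans
        (congrArg cls (fourRep_iotaRep u)),
      (wellDefined_fourInvRep _ (iotaRep_mem_moderate u)).2.trans
        (congrArg cls (fourInvRep_iotaRep u))⟩,
      -- A constant map does not see the conjugation of its argument, so the identities between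
      -- representatives hold by definition.
      fun f => ⟨(wellDefined_fourRep _ (sigmaRep_mem_moderate f)).2,
        (wellDefined_fourInvRep _ (sigmaRep_mem_moderate f)).2⟩⟩,
    fun a R => ⟨fourG_semiconj_comp (four_comp_translate a) R,
      fourG_semiconj_comp (four_comp_chi a) R,
      descend_semiconj wellDefined_fourRep (wellDefined_hatTransRep a)
        (wellDefined_hatChiRep (-a)) (fun R _ => fourRep_hatTransRep a R) R,
      descend_semiconj wellDefined_fourRep (wellDefined_hatChiRep a)
        (wellDefined_hatTransRep a) (fun R _ => fourRep_hatChiRep a R) R⟩,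
    fun α R => ⟨⟨(fourG_semiconj_comp (four_comp_mulMon α) R).symm,
        (fourG_semiconj_comp (four_comp_pderiv α) R).symm⟩,
      ⟨(multiPow_semiconj (fun _ => fourG_semiconj_hatMulMonG _) α R).symm,
        (multiPow_semiconj (fun _ => fourG_semiconj_hatPderivG _) α R).symm⟩,
      ⟨(fourG_semiconj_hatMulMonG α R).symm, (fourG_semiconj_hatPderivG α R).symm⟩⟩,
    fun u v => ⟨descend_descend₂ wellDefined_fourInvRep wellDefined₂_mulRep wellDefined₂_convRep
        fourInvRep_mulRep u v,
      descend_descend₂ wellDefined_fourRep wellDefined₂_convRep wellDefined₂_mulRep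
        fourRep_convRep u v⟩⟩
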